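/- **Lemma 3.4 (Decomposition).** Let $(M,g)$ be a compact smooth Riemannian manifold without boundary, let $\lambda=p\,dq$ be the Liouville form on $T^*M$ and let $\|p\|$ be the norm of covectors dual to $g$. Let $h_0^t$ be the flow on $T^*M$ of $H_0(q,p)=\frac12\|p\|^2$ (the geodesic flow), and let $R\in(0,\infty]$ be the injectivity radius of $(M,g)$. For an open neighborhood $V$ of the zero section of $T^*M$, a *symplectic twist map of $V$* is a smooth diffeomorphism $F$ of $V$ onto itself such that (1) $F^*\lambda-\lambda=dS$ on $V$ for some smooth function $S:V\to\mathbb R$, and (2) writing $F(q,p)=(Q,P)$, the map $(q,p)\mapsto(q,Q)$ is an embedding of $V$ in $M\times M$. Let $U\subset T^*M$ be a compact neighborhood of the zero section. Let $H_t$, $t\in[0,1]$, be a smooth time-dependent Hamiltonian on an open set $W\subset T^*M$ such that for every $z\in U$ the solution of Hamilton's equations $\dot q=\partial H_t/\partial p$, $\dot p=-\partial H_t/\partial q$ starting at $z$ at time $0$ exists in $W$ for $0\le t\le 1$; denote it by $G_t(z)$. Let $F=G_1|_U$ be the time-1 map, and suppose that $F(U)\subset U$. No convexity of $H$ is assumed.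 For $\varepsilon>0$, consider the following property. $(D_\varepsilon)$: There are an open neighborhood $V$ of the zero section with $U\subset V$, an integer $N\ge1$, and symplectic twist maps $F_1,\dots,F_{2N}$ of $V$ such that $$F=F_{2N}\circ\cdots\circ F_1\ \text{ on } U,\qquad F_{2k}=h_0^{\varepsilon}|_V\quad(1\le k\le N).$$ Moreover, if $G_t(U)=U$ for all $t\in[0,1]$ and $h_0^\varepsilon(U)=U$, then $F_k(U)=U$ for all $1\le k\le 2N$. Then: (a) If $\|p\|\le C$ at all points $(q,p)$ of $\bigcup_{0\le t\le1}G_t(U)$, for some $C<R$, then $(D_1)$ holds; that is, the even factors are the geodesic time-1 map $h_0^1$ of $g$. (b) Without any restriction on the size of $U$ or of its orbits, there is $\varepsilon_0>0$ such that $(D_\varepsilon)$ holds for all $0<\varepsilon<\varepsilon_0$. Here $h_0^\varepsilon$ is the geodesic time-1 map of the rescaled metric $\varepsilon^{-1}g$. -/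

import Mathlib

open Set Bundle Topology
open scoped Manifold ContDiff ENNReal

noncomputable section

namespace TwistMaps

section Cotangent

variable (E : Type*) [NormedAddCommGroup E] [NormedSpace ℝ E]
  (M : Type*) [TopologicalSpace M] [ChartedSpace E M] [IsManifold 𝓘(ℝ, E) ∞ M]

/-- The cotangent bundle `T*M`, as the bundle of continuous linear forms on the tangent spaces.
A point `z` is a pair `(q, p)` with `q = z.proj` and `p = z.2 : T_q M → ℝ`.
Mathlib equips it with the usual topology and (below) with the usual smooth structure. -/
abbrev CotangentBundle : Type _ :=
  TotalSpace (E →L[ℝ] ℝ) (fun x : M ↦ TangentSpace 𝓘(ℝ, E) x →L[ℝ] Bundle.Trivial M ℝ x)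

/-- The model with corners of `T*M`; it is the model vector space `E × E*`, without boundary. -/
abbrev cotangentModel : ModelWithCorners ℝ (E × (E →L[ℝ] ℝ)) (ModelProd E (E →L[ℝ] ℝ)) :=
  𝓘(ℝ, E).prod 𝓘(ℝ, E →L[ℝ] ℝ)

/-- The zero section of `T*M`. -/
def zeroSection : Set (CotangentBundle E M) :=
  {z | z.2 = 0}

variable {E M}

/-- The tangent space `T_z(T*M)`. -/
abbrev CotangentTangent (z : CotangentBundle E M) : Type _ :=
  TangentSpace (cotangentModel E) z

/-- The Liouville form `λ = p dq`, that is `λ_z(ξ) = p (dπ ξ)` for `z = (q, p)`, where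
`π : T*M → M` is the projection. -/
def liouville (z : CotangentBundle E M) (ξ : CotangentTangent z) : ℝ :=
  z.2 (mfderiv (cotangentModel E) 𝓘(ℝ, E) (fun y : CotangentBundle E M ↦ y.proj) z ξ)

/-- The canonical symplectic form of `T*M`, as a bilinear expression on `T_z(T*M)`. In Mathlib,
`T_z(T*M)` is `E × E*` through the preferred chart of `T*M` at `z`. This is the canonical chart
`(q, p)` induced by the preferred chart of `M` at `π z`, and in it the form is
`ω ((q', p'), (w, β)) = β q' - p' w`, which is `dq ∧ dp = - dλ`. -/
def symplecticForm (z : CotangentBundle E M) (X ξ : CotangentTangent z) : ℝ :=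
  let X' : E × (E →L[ℝ] ℝ) := X
  let ξ' : E × (E →L[ℝ] ℝ) := ξ
  ξ'.2 X'.1 - X'.2 ξ'.1

/-- `γ` solves, on the time set `s`, the equations of motion of the time-dependent Hamiltonian `H`:
for each `t ∈ s` the velocity `X` of `γ` at time `t` satisfies `ω(X, ·) = d(H_t)`. In canonical
coordinates this reads `q' = ∂H/∂p`, `p' = - ∂H/∂q`. -/
def IsHamiltonianCurveOn (H : ℝ → CotangentBundle E M → ℝ) (γ : ℝ → CotangentBundle E M)
    (s : Set ℝ) : Prop :=
  ∀ t ∈ s, ∃ X : CotangentTangent (γ t),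
    HasMFDerivWithinAt 𝓘(ℝ, ℝ) (cotangentModel E) γ s t ((1 : ℝ →L[ℝ] ℝ).smulRight X) ∧
    ∀ ξ : CotangentTangent (γ t),
      symplecticForm (γ t) X ξ = mfderiv (cotangentModel E) 𝓘(ℝ, ℝ) (H t) (γ t) ξ

/-- `G t z`, for `z ∈ U` and `0 ≤ t ≤ 1`, is the flow (started at time `0`) of the time-dependent
Hamiltonian `H` defined on the open set `W`: all solutions that start in `U` exist up to time `1`
and stay in the domain `W` of `H`. Nothing is said about `G` for other times or points. -/
structure IsHamiltonianFlowOn (H : ℝ → CotangentBundle E M → ℝ) (W U : Set (CotangentBundle E M))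
    (G : ℝ → CotangentBundle E M → CotangentBundle E M) : Prop where
  init : ∀ z ∈ U, G 0 z = z
  mem : ∀ t ∈ Icc (0 : ℝ) 1, ∀ z ∈ U, G t z ∈ W
  curve : ∀ z ∈ U, IsHamiltonianCurveOn H (fun t ↦ G t z) (Icc 0 1)

/-- The map `ψ : (q, p) ↦ (q, Q)` where `F (q, p) = (Q, P)`. -/
def twistMap (F : CotangentBundle E M → CotangentBundle E M) (z : CotangentBundle E M) : M × M :=
  (z.proj, (F z).proj)

/-- `F` is a symplectic twist map of the open neighbourhood `V` of the zero section: a smooth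
diffeomorphism of `V` onto itself, exact symplectic (`F^* (p dq) - p dq = dS` on `V`), such that
`(q, p) ↦ (q, Q)` is an embedding (an immersion that is a homeomorphism onto its image) of `V`
in `M × M`. -/
structure IsSymplecticTwistMap (V : Set (CotangentBundle E M))
    (F : CotangentBundle E M → CotangentBundle E M) : Prop where
  isOpen : IsOpen V
  zeroSection_subset : zeroSection E M ⊆ V
  bijOn : BijOn F V V
  contMDiffOn : ContMDiffOn (cotangentModel E) (cotangentModel E) ∞ F V
  contMDiffOn_inverse : ∃ F' : CotangentBundle E M → CotangentBundle E M,
    LeftInvOn F' F V ∧ ContMDiffOn (cotangentModel E) (cotangentModel E) ∞ F' V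
  exact : ∃ S : CotangentBundle E M → ℝ,
    ContMDiffOn (cotangentModel E) 𝓘(ℝ, ℝ) ∞ S V ∧
    ∀ z ∈ V, ∀ ξ : CotangentTangent z,
      liouville (F z) (mfderiv (cotangentModel E) (cotangentModel E) F z ξ) - liouville z ξ =
        mfderiv (cotangentModel E) 𝓘(ℝ, ℝ) S z ξ
  twist_immersion : ∀ z ∈ V, Function.Injective
    (mfderiv (cotangentModel E) (𝓘(ℝ, E).prod 𝓘(ℝ, E)) (twistMap F) z)
  twist_embedding : IsEmbedding (V.domRestrict (twistMap F))

/-- The composition `f m ∘ … ∘ f 2 ∘ f 1`. -/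
def iteratedComp {X : Type*} (f : ℕ → X → X) : ℕ → X → X
  | 0 => id
  | m + 1 => f (m + 1) ∘ iteratedComp f m

end Cotangent

section Riemannian

variable {E : Type*} [NormedAddCommGroup E] [NormedSpace ℝ E] [FiniteDimensional ℝ E]
  {M : Type*} [TopologicalSpace M] [ChartedSpace E M] [IsManifold 𝓘(ℝ, E) ∞ M]

variable (E M) in
/-- Smooth Riemannian metrics on `M`. -/
abbrev Metric : Type _ :=
  ContMDiffRiemannianMetric 𝓘(ℝ, E) ∞ E (fun x : M ↦ TangentSpace 𝓘(ℝ, E) x)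

theorem inner_bijective (g : Metric E M) (q : M) : Function.Bijective (g.inner q) := by
  have : FiniteDimensional ℝ (TangentSpace 𝓘(ℝ, E) q) := inferInstanceAs (FiniteDimensional ℝ E)
  have hinj : Function.Injective (g.inner q) := by
    rw [injective_iff_map_eq_zero]
    intro v hv
    by_contra hne
    have h := g.pos q v hne
    rw [hv] at h
    simp at h
  refine ⟨hinj, ?_⟩
  have hdim : Module.finrank ℝ E = Module.finrank ℝ (E →L[ℝ] ℝ) := by
    rw [← (LinearMap.toContinuousLinearMap (𝕜 := ℝ) (E := E) (F' := ℝ)).finrank_eq,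
      Subspace.dual_finrank_eq]
  let L : E →ₗ[ℝ] (E →L[ℝ] ℝ) := (g.inner q).toLinearMap
  exact (LinearMap.injective_iff_surjective_of_finrank_eq_finrank (f := L) hdim).1 hinj

/-- The isomorphism `A(q) : T*_q M → T_q M` given by the metric: `A(q) p` is the vector `v` with
`g(v, ·) = p`. -/
def sharp (g : Metric E M) (z : CotangentBundle E M) : TangentSpace 𝓘(ℝ, E) z.proj :=
  (Equiv.ofBijective (g.inner z.proj) (inner_bijective g z.proj)).symm z.2

/-- The norm `‖p‖` of a covector for the dual metric: `‖p‖² = g^#(p, p) = p (A(q) p)`. -/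
def covectorNorm (g : Metric E M) (z : CotangentBundle E M) : ℝ :=
  Real.sqrt (z.2 (sharp g z))

/-- The Hamiltonian `H₀(q, p) = ‖p‖² / 2` of the geodesic flow. -/
def kineticEnergy (g : Metric E M) (z : CotangentBundle E M) : ℝ :=
  covectorNorm g z ^ 2 / 2

open Classical in
/-- The geodesic flow `h₀^t` on `T*M`: the flow of the Hamiltonian `H₀`. The point `z` goes to
`γ t`, where `γ` is the solution through `γ 0 = z` defined for all times (it exists for all `z`
if `M` is compact; `z` is left fixed otherwise). The projection of `γ` to `M` is the geodesic
`t ↦ exp_q (t A(q) p)`. -/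
def geodesicFlow (g : Metric E M) (t : ℝ) (z : CotangentBundle E M) : CotangentBundle E M :=
  if h : ∃ γ : ℝ → CotangentBundle E M,
      γ 0 = z ∧ IsHamiltonianCurveOn (fun _ ↦ kineticEnergy g) γ univ
  then Classical.choose h t else z

/-- The injectivity radius `R` of `(M, g)` (an extended real): the supremum of the radii `r` such
that each `exp_q` is an injective immersion on the ball of radius `r`, or equivalently such that
`(q, p) ↦ (q, exp_q (A(q) p))` is one on `{‖p‖ < r}`. -/
def injectivityRadius (g : Metric E M) : ℝ≥0∞ :=
  sSup {r : ℝ≥0∞ |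
    InjOn (twistMap (geodesicFlow g 1)) {z | ENNReal.ofReal (covectorNorm g z) < r} ∧
    ∀ z, ENNReal.ofReal (covectorNorm g z) < r → Function.Injective
      (mfderiv (cotangentModel E) (𝓘(ℝ, E).prod 𝓘(ℝ, E)) (twistMap (geodesicFlow g 1)) z)}

/-- The time-one map `G 1` of the isotopy `G t`, `0 ≤ t ≤ 1`, of the set `U` is a finite product
`F_{2N} ∘ … ∘ F_1` (`N ≥ 1`) of symplectic twist maps of one open neighbourhood `V` of the zero
section that contains `U`, with all even factors equal to `h₀^ε`. If all `G t` and
`h₀^ε` map `U` onto itself, then so do the factors. -/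
def HasTwistDecomposition (g : Metric E M) (ε : ℝ) (U : Set (CotangentBundle E M))
    (G : ℝ → CotangentBundle E M → CotangentBundle E M) : Prop :=
  ∃ (V : Set (CotangentBundle E M)) (N : ℕ) (F : ℕ → CotangentBundle E M → CotangentBundle E M),
    U ⊆ V ∧ 0 < N ∧
    (∀ k ∈ Icc 1 (2 * N), IsSymplecticTwistMap V (F k)) ∧
    (∀ k ∈ Icc 1 N, ∀ z ∈ V, F (2 * k) z = geodesicFlow g ε z) ∧
    (∀ z ∈ U, G 1 z = iteratedComp F (2 * N) z) ∧
    ((∀ t ∈ Icc (0 : ℝ) 1, G t '' U = U) → geodesicFlow g ε '' U = U →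
      ∀ k ∈ Icc 1 (2 * N), F k '' U = U)

end Riemannian

end TwistMaps

end

noncomputable section

set_option linter.unusedSectionVars false
set_option synthInstance.maxHeartbeats 200000

/-! The isotopy is cut into short pieces, and each piece `φ` is written as `h₀^ε ∘ (h₀^{-ε} ∘ φ)`. A
short piece is `C¹`-close to the identity on compact sets, so the bracket is close to `h₀^{-ε}`.
Being an injective immersion on a compact set is an open condition in smooth families
(`exists_isTwistOn_of_family`), hence the bracket is twist as soon as `h₀^{-ε}` is. All the twist
comes from the geodesic flow, which is why convexity of `H` plays no role.

The maps `h₀^{±ε}` are twist on the compact set `{‖p‖ ≤ C'}` when `ε C'` is below a radius `r` on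
which `h₀¹` is twist, because `h₀^s (q, p)` and `h₀¹ (q, s p)` have the same projection
(`geodesicFlow_fiberScale`). For (a), `ε = 1` and `r` lies between `C` and the injectivity radius.
For (b), some `r > 0` exists because the exponential map is an injective immersion along the compact
zero section (`exists_injOn_twistMap_geodesicFlow`), and `ε` is taken small.

All factors must be diffeomorphisms of one set `V = {‖p‖ < C'}`. The geodesic flow preserves it by
conservation of energy. The isotopy, known only on `U`, is replaced by a global one that agrees with
it on `U` and fixes every point outside a compact subset of `V`
(`IsHamiltonianFlowOn.exists_extension`): `H` is multiplied by a cutoff equal to one near the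
compact union of the orbits, and time runs through `Real.smoothTransition`, so that smoothness on
the closed time interval suffices. An injective immersion on the compact set containing `V`
restricts to an embedding of `V`.

Two analytic facts support this: flows of smooth fields are smooth in time and initial point
(`IsFlow.contMDiff`), and Hamiltonian flows are exact symplectic with the action `∫ p dq - K dt` as
primitive (`suspFlow_exact`). -/

namespace TwistMaps

/-! ### Composition with a smooth map on spaces of continuous curves. -/

section Nemytskii

universe u

variable {K : Type*} [TopologicalSpace K] [CompactSpace K]

/-- Pointwise application of a continuous family of continuous linear maps to a continuous
function, as a continuous bilinear map. -/
def pointwiseApply (K : Type*) [TopologicalSpace K] [CompactSpace K]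
    (E F : Type*) [NormedAddCommGroup E] [NormedSpace ℝ E]
    [NormedAddCommGroup F] [NormedSpace ℝ F] :
    C(K, E →L[ℝ] F) →L[ℝ] C(K, E) →L[ℝ] C(K, F) :=
  LinearMap.mkContinuous₂
    (LinearMap.mk₂ ℝ (fun (A : C(K, E →L[ℝ] F)) (η : C(K, E)) ↦
        (⟨fun k ↦ A k (η k), by fun_prop⟩ : C(K, F)))
      (fun A A' η ↦ by ext k; simp) (fun c A η ↦ by ext k; simp)
      (fun A η η' ↦ by ext k; simp) (fun c A η ↦ by ext k; simp)) 1
    (fun A η ↦ by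
      rw [ContinuousMap.norm_le _ (by positivity)]
      intro k
      calc ‖A k (η k)‖ ≤ ‖A k‖ * ‖η k‖ := (A k).le_opNorm _
        _ ≤ 1 * ‖A‖ * ‖η‖ := by
          rw [one_mul]
          gcongr
          · exact A.norm_coe_le_norm k
          · exact η.norm_coe_le_norm k)

/-- The range of `γ` is compact, so `f'` is uniformly continuous near it; the mean value inequality
then bounds the remainder at all points `k` simultaneously. -/
theorem hasFDerivAt_postcomp {E F : Type*} [NormedAddCommGroup E] [NormedSpace ℝ E]
    [NormedAddCommGroup F] [NormedSpace ℝ F] (f : C(E, F)) (f' : C(E, E →L[ℝ] F))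
    (hf : ∀ x, HasFDerivAt f (f' x) x) (γ : C(K, E)) :
    HasFDerivAt (fun γ : C(K, E) ↦ f.comp γ) (pointwiseApply K E F (f'.comp γ)) γ := by
  rw [hasFDerivAt_iff_isLittleO_nhds_zero, Asymptotics.isLittleO_iff]
  intro ε hε
  have huc := (isCompact_range γ.continuous).uniformContinuousAt_of_continuousAt f'
    (fun x _ ↦ f'.continuous.continuousAt) (Metric.dist_mem_uniformity hε)
  obtain ⟨δ, hδ, hball⟩ := Metric.mem_uniformity_dist.1 huc
  filter_upwards [Metric.ball_mem_nhds (0 : C(K, E)) hδ] with η hη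
  rw [mem_ball_zero_iff] at hη
  rw [ContinuousMap.norm_le _ (by positivity)]
  intro k
  have hk : ‖η k‖ < δ := (η.norm_coe_le_norm k).trans_lt hη
  have hmv := (convex_ball (γ k) δ).norm_image_sub_le_of_norm_hasFDerivWithin_le'
    (f := f) (f' := f') (φ := f' (γ k)) (C := ε) (x := γ k) (y := γ k + η k)
    (fun x _ ↦ (hf x).hasFDerivWithinAt)
    (fun x hx ↦ by
      have := @hball (γ k) x (by rw [dist_comm]; exact hx) (mem_range_self k)
      rw [← dist_eq_norm, dist_comm]
      exact le_of_lt this)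
    (Metric.mem_ball_self hδ) (by simpa using hk)
  calc ‖f (γ k + η k) - f (γ k) - f' (γ k) (η k)‖ ≤ ε * ‖η k‖ := by simpa using hmv
    _ ≤ ε * ‖η‖ := by gcongr; exact η.norm_coe_le_norm k

/-- The derivative is again a composition operator, that of `fderiv ℝ f`, followed by a bounded
linear map. The target `F` is quantified inside the induction because it becomes `E →L[ℝ] F`; the
common universe makes this possible. -/
theorem contDiff_postcomp_nat {E : Type u} [NormedAddCommGroup E] [NormedSpace ℝ E] (n : ℕ) :
    ∀ {F : Type u} [NormedAddCommGroup F] [NormedSpace ℝ F] (f : C(E, F)),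
      ContDiff ℝ n f → ContDiff ℝ n (fun γ : C(K, E) ↦ f.comp γ) := by
  induction n with
  | zero =>
    intro F _ _ f hf
    exact contDiff_zero.2 (ContinuousMap.continuous_postcomp f)
  | succ n ih =>
    intro F _ _ f hf
    have hf' : ContDiff ℝ n (fderiv ℝ f) := hf.fderiv_right (by norm_cast)
    refine contDiff_succ_iff_hasFDerivAt.2
      ⟨fun γ ↦ pointwiseApply K E F
        ((⟨fderiv ℝ f, hf'.continuous⟩ : C(E, E →L[ℝ] F)).comp γ), ?_, fun γ ↦ ?_⟩
    · exact (pointwiseApply K E F).contDiff.comp (ih ⟨fderiv ℝ f, hf'.continuous⟩ hf')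
    · exact hasFDerivAt_postcomp f ⟨fderiv ℝ f, hf'.continuous⟩
        (fun x ↦ (hf.differentiable (by norm_cast) x).hasFDerivAt) γ

/-- The Nemytskii operator of a smooth map is smooth. -/
theorem contDiff_postcomp {E F : Type u} [NormedAddCommGroup E] [NormedSpace ℝ E]
    [NormedAddCommGroup F] [NormedSpace ℝ F] (f : C(E, F)) (hf : ContDiff ℝ ∞ f) :
    ContDiff ℝ ∞ (fun γ : C(K, E) ↦ f.comp γ) :=
  contDiff_infty.2 fun n ↦ contDiff_postcomp_nat n f (contDiff_infty.1 hf n)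

end Nemytskii

/-! ### Smooth local flows in a vector space, by the implicit function theorem. -/

section LocalFlow

universe u

/-- The time interval `[-2, 2]`. -/
abbrev flowTime : Type := Icc (-2 : ℝ) 2

/-- Extension of a function on `[-2, 2]` to the line, constant outside. -/
def flowExtend {E : Type*} [TopologicalSpace E] (γ : C(flowTime, E)) : ℝ → E :=
  IccExtend (by norm_num : (-2 : ℝ) ≤ 2) γ

theorem continuous_flowExtend {E : Type*} [NormedAddCommGroup E] (γ : C(flowTime, E)) :
    Continuous (flowExtend γ) :=
  γ.continuous.Icc_extend'

theorem norm_flowExtend_le {E : Type*} [NormedAddCommGroup E] (γ : C(flowTime, E)) (t : ℝ) :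
    ‖flowExtend γ t‖ ≤ ‖γ‖ :=
  γ.norm_coe_le_norm _

variable {E : Type u} [NormedAddCommGroup E] [NormedSpace ℝ E]

/-- The primitive vanishing at `0`, as a continuous operator on `C([-2, 2], E)`. -/
def flowPrimitive (E : Type*) [NormedAddCommGroup E] [NormedSpace ℝ E] :
    C(flowTime, E) →L[ℝ] C(flowTime, E) :=
  LinearMap.mkContinuous
    { toFun := fun γ ↦ ⟨fun s ↦ ∫ r in (0 : ℝ)..s, flowExtend γ r, by
        have := intervalIntegral.continuous_primitive (μ := MeasureTheory.volume)
          (fun a b ↦ (continuous_flowExtend γ).intervalIntegrable a b) 0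
        fun_prop⟩
      map_add' := fun γ η ↦ by
        ext s
        exact intervalIntegral.integral_add
          ((continuous_flowExtend γ).intervalIntegrable _ _)
          ((continuous_flowExtend η).intervalIntegrable _ _)
      map_smul' := fun c γ ↦ by
        ext s
        exact intervalIntegral.integral_smul c (flowExtend γ) } 2
    (fun γ ↦ by
      rw [ContinuousMap.norm_le _ (by positivity)]
      intro s
      have h := intervalIntegral.norm_integral_le_of_norm_le_const (a := (0 : ℝ)) (b := s)
        (C := ‖γ‖) (f := flowExtend γ) (fun x _ ↦ norm_flowExtend_le γ x)
      have hs : |(s : ℝ) - 0| ≤ 2 := by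
        rw [sub_zero, abs_le]; exact s.2
      calc _ ≤ ‖γ‖ * |(s : ℝ) - 0| := h
        _ ≤ ‖γ‖ * 2 := by gcongr
        _ = _ := by ring)

theorem flowPrimitive_apply (γ : C(flowTime, E)) (s : flowTime) :
    flowPrimitive E γ s = ∫ r in (0 : ℝ)..s, flowExtend γ r := rfl

/-- Smooth dependence of the solutions of `y' = τ f(y)`, `y(0) = x` on the time scale `τ` and on the
initial point `x`. -/
theorem exists_smooth_localFlow [CompleteSpace E] (f : E → E) (hf : ContDiff ℝ ∞ f) (x₀ : E)
    {Ω : Set E} (hΩ : Ω ∈ 𝓝 x₀) :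
    ∃ y : ℝ → ℝ × E → E, ContDiffAt ℝ ∞ (y 1) (0, x₀) ∧
      ∀ᶠ p in 𝓝 ((0 : ℝ), x₀), y 0 p = p.2 ∧ ∀ s ∈ Ioo (-2 : ℝ) 2,
        HasDerivAt (fun s ↦ y s p) (p.1 • f (y s p)) s ∧ y s p ∈ Ω := by
  let N : C(flowTime, E) → C(flowTime, E) := fun γ ↦ (⟨f, hf.continuous⟩ : C(E, E)).comp γ
  have hN : ContDiff ℝ ∞ N := contDiff_postcomp _ hf
  let c : E →L[ℝ] C(flowTime, E) := ContinuousLinearMap.const ℝ flowTime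
  -- The zeros of `Θ` are the solutions on `[-2, 2]` of the integral equation `γ(s) = x + τ ∫₀ˢ
  -- f(γ)`.
  let Θ : (ℝ × E) × C(flowTime, E) → C(flowTime, E) :=
    fun q ↦ q.2 - c q.1.2 - q.1.1 • flowPrimitive E (N q.2)
  have hΘ : ContDiff ℝ ∞ Θ := by
    have h1 : ContDiff ℝ ∞ fun q : (ℝ × E) × C(flowTime, E) ↦ flowPrimitive E (N q.2) :=
      (flowPrimitive E).contDiff.comp (hN.comp contDiff_snd)
    have h2 : ContDiff ℝ ∞ fun q : (ℝ × E) × C(flowTime, E) ↦ c q.1.2 :=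
      c.contDiff.comp (contDiff_snd.comp contDiff_fst)
    exact (contDiff_snd.sub h2).sub ((contDiff_fst.comp contDiff_fst).smul h1)
  let u : (ℝ × E) × C(flowTime, E) := ((0, x₀), c x₀)
  have hΘu : ContDiffAt ℝ ∞ Θ u := hΘ.contDiffAt
  -- At time scale `τ = 0` the integral term disappears, so the partial derivative in `γ` is the
  -- identity.
  have hinv : (fderiv ℝ Θ u ∘L .inr ℝ (ℝ × E) C(flowTime, E)).IsInvertible := by
    have h1 : HasFDerivAt (fun γ : C(flowTime, E) ↦ Θ ((0, x₀), γ))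
        (fderiv ℝ Θ u ∘L .inr ℝ (ℝ × E) C(flowTime, E)) (c x₀) :=
      ((hΘ.differentiable (by simp)) u).hasFDerivAt.comp (c x₀) (hasFDerivAt_prodMk_right _ _)
    have h2 : HasFDerivAt (fun γ : C(flowTime, E) ↦ Θ ((0, x₀), γ))
        (ContinuousLinearMap.id ℝ C(flowTime, E)) (c x₀) := by
      have : (fun γ : C(flowTime, E) ↦ Θ ((0, x₀), γ)) = fun γ ↦ γ - c x₀ := by
        ext γ; simp [Θ]
      rw [this]
      exact (hasFDerivAt_id _).sub_const _
    rw [h1.unique h2]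
    exact ContinuousLinearMap.isInvertible_equiv (f := ContinuousLinearEquiv.refl ℝ _)
  let ψ := hΘu.implicitFunction (by simp) hinv
  have hψ : ContDiffAt ℝ ∞ ψ (0, x₀) := hΘu.contDiffAt_implicitFunction (by simp) hinv
  have hψ0 : ψ (0, x₀) = c x₀ := hΘu.implicitFunction_apply_self (by simp) hinv
  have hψe : ∀ᶠ p in 𝓝 ((0 : ℝ), x₀), Θ (p, ψ p) = Θ u :=
    hΘu.eventually_apply_implicitFunction (by simp) hinv
  have hΘ0 : Θ u = 0 := by simp [Θ, u]
  -- The right side of the integral equation, rather than `ψ p` itself, serves as the solution: it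
  -- is defined for all real `s` and visibly differentiable.
  let y : ℝ → ℝ × E → E := fun s p ↦ p.2 + p.1 • ∫ r in (0 : ℝ)..s, flowExtend (N (ψ p)) r
  have hyψ : ∀ p, Θ (p, ψ p) = 0 → ∀ s : flowTime, y s p = ψ p s := by
    intro p hp s
    have h := congrArg (fun γ : C(flowTime, E) ↦ γ s) hp
    simp only [Θ, ContinuousMap.sub_apply, ContinuousMap.smul_apply, flowPrimitive_apply,
      ContinuousMap.zero_apply] at h
    have hc : c p.2 s = p.2 := rfl
    rw [hc, sub_sub, sub_eq_zero] at h
    exact h.symm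
  refine ⟨y, ?_, ?_⟩
  · let s1 : flowTime := ⟨1, by norm_num, by norm_num⟩
    have h1 : ContDiffAt ℝ ∞ (fun p ↦ ψ p s1) (0, x₀) :=
      (ContinuousMap.evalCLM (M := E) ℝ s1).contDiff.contDiffAt.comp ((0 : ℝ), x₀) hψ
    refine h1.congr_of_eventuallyEq ?_
    filter_upwards [hψe] with p hp
    exact hyψ p (hp.trans hΘ0) s1
  · obtain ⟨δ, hδ, hball⟩ := Metric.mem_nhds_iff.1 hΩ
    have hclose : ∀ᶠ p in 𝓝 ((0 : ℝ), x₀), ψ p ∈ Metric.ball (c x₀) δ := by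
      have := hψ.continuousAt.tendsto
      rw [hψ0] at this
      exact this.eventually (Metric.ball_mem_nhds _ hδ)
    filter_upwards [hψe, hclose] with p hp hpc
    refine ⟨by simp [y], fun s hs ↦ ?_⟩
    let s' : flowTime := ⟨s, hs.1.le, hs.2.le⟩
    have hys : y s p = ψ p s' := hyψ p (hp.trans hΘ0) s'
    constructor
    · have h1 : HasDerivAt (fun s ↦ ∫ r in (0 : ℝ)..s, flowExtend (N (ψ p)) r)
          (flowExtend (N (ψ p)) s) s :=
        intervalIntegral.integral_hasDerivAt_right
          ((continuous_flowExtend _).intervalIntegrable _ _)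
          ((continuous_flowExtend _).stronglyMeasurableAtFilter _ _)
          (continuous_flowExtend _).continuousAt
      have h2 : flowExtend (N (ψ p)) s = f (y s p) := by
        rw [hys]
        exact IccExtend_of_mem _ _ s'.2
      rw [← h2]
      exact (h1.const_smul p.1).const_add p.2
    · apply hball
      rw [hys]
      rw [Metric.mem_ball] at hpc ⊢
      exact (ContinuousMap.dist_apply_le_dist s').trans_lt hpc

end LocalFlow

/-! ### Flows of smooth vector fields on manifolds. -/

section ManifoldFlow

universe u

variable {F : Type u} [NormedAddCommGroup F] [NormedSpace ℝ F] [FiniteDimensional ℝ F]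
  {H : Type*} [TopologicalSpace H] {I : ModelWithCorners ℝ F H} [I.Boundaryless]
  {X : Type*} [TopologicalSpace X] [ChartedSpace H X] [IsManifold I ∞ X]

/-- Smoothness of a vector field. -/
def SmoothField (I : ModelWithCorners ℝ F H) {X : Type*} [TopologicalSpace X] [ChartedSpace H X]
    [IsManifold I ∞ X] (v : X → F) : Prop :=
  ContMDiff I I.tangent ∞ (fun x ↦ (⟨x, v x⟩ : TangentBundle I X))

omit [FiniteDimensional ℝ F] [I.Boundaryless] in
theorem trivializationAt_tangent_snd (x₀ : X) {x : X} (hx : x ∈ (chartAt H x₀).source)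
    (w : F) :
    (trivializationAt F (TangentSpace I) x₀ ⟨x, w⟩).2 =
      (mfderiv I 𝓘(ℝ, F) (extChartAt I x₀) x : F →L[ℝ] F) w := by
  have h := TangentBundle.continuousLinearMapAt_trivializationAt (I := I) hx
  have h' := Trivialization.continuousLinearMapAt_apply_of_mem (R := ℝ)
    (e := trivializationAt F (TangentSpace I) x₀) (b := x) hx w
  exact h'.symm.trans (DFunLike.congr_fun h w)

-- Replaces sections of the tangent bundle by vector-valued functions in charts, the form in which
-- smoothness of Hamiltonian fields is checked.
omit [FiniteDimensional ℝ F] [I.Boundaryless] in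
theorem smoothField_iff {v : X → F} :
    SmoothField I v ↔ ∀ x₀ : X, ContMDiffAt I 𝓘(ℝ, F) ∞
      (fun x ↦ (mfderiv I 𝓘(ℝ, F) (extChartAt I x₀) x : F →L[ℝ] F) (v x)) x₀ := by
  refine forall_congr' fun x₀ ↦ ?_
  have h1 := contMDiffAt_section (F := F) (E := TangentSpace I) (IB := I) (n := ∞) (s := v) x₀
  refine h1.trans ?_
  have h2 : (fun x ↦ (trivializationAt F (TangentSpace I) x₀ ⟨x, v x⟩).2) =ᶠ[𝓝 x₀]
      fun x ↦ (mfderiv I 𝓘(ℝ, F) (extChartAt I x₀) x : F →L[ℝ] F) (v x) := by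
    filter_upwards [chart_source_mem_nhds H x₀] with x hx
    exact trivializationAt_tangent_snd x₀ hx (v x)
  exact h2.contMDiffAt_iff

omit [FiniteDimensional ℝ F] in
theorem SmoothField.contDiffOn_chart {v : X → F} (hv : SmoothField I v)
    (x₀ : X) : ContDiffOn ℝ ∞ (fun y ↦ (mfderiv I 𝓘(ℝ, F) (extChartAt I x₀)
      ((extChartAt I x₀).symm y) : F →L[ℝ] F) (v ((extChartAt I x₀).symm y)))
      (extChartAt I x₀).target := by
  have h1 := (Trivialization.contMDiffOn_section_baseSet_iff (F := F) (IB := I) (n := ∞) (s := v)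
    (E := TangentSpace I) (trivializationAt F (TangentSpace I) x₀)).1 hv.contMDiffOn
  have h2 := h1.comp (contMDiffOn_extChartAt_symm (n := ∞) (I := I) x₀) (fun y hy ↦ by
    have := (extChartAt I x₀).map_target hy
    rwa [extChartAt_source] at this)
  refine contMDiffOn_iff_contDiffOn.1 (h2.congr fun y hy ↦ ?_)
  have := (extChartAt I x₀).map_target hy
  rw [extChartAt_source] at this
  exact (trivializationAt_tangent_snd x₀ this _).symm

omit [FiniteDimensional ℝ F] in
theorem hasMFDerivAt_extChartAt_symm (x₀ : X) {y : F} (hy : y ∈ (extChartAt I x₀).target) :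
    HasMFDerivAt 𝓘(ℝ, F) I (extChartAt I x₀).symm y
      (mfderiv 𝓘(ℝ, F) I (extChartAt I x₀).symm y) ∧
    ∀ w : F, (mfderiv 𝓘(ℝ, F) I (extChartAt I x₀).symm y : F →L[ℝ] F)
      ((mfderiv I 𝓘(ℝ, F) (extChartAt I x₀) ((extChartAt I x₀).symm y) : F →L[ℝ] F) w) = w := by
  have h1 := mdifferentiableWithinAt_extChartAt_symm (I := I) hy
  rw [I.range_eq_univ, mdifferentiableWithinAt_univ] at h1
  refine ⟨h1.hasMFDerivAt, fun w ↦ ?_⟩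
  have h2 := mfderivWithin_extChartAt_symm_comp_mfderiv_extChartAt (I := I) hy
  rw [I.range_eq_univ, mfderivWithin_univ] at h2
  exact congrArg (fun L ↦ L w) h2

omit [FiniteDimensional ℝ F] [I.Boundaryless] in
theorem SmoothField.const_smul {v : X → F} (hv : SmoothField I v) (c : ℝ) :
    SmoothField I (c • v) :=
  ContMDiff.const_smul_section (F := F) (V := TangentSpace I) (a := c) (s := v) hv

variable [T2Space X]

/-- Smooth local flow of a smooth vector field, with the time scale as a parameter. -/
theorem SmoothField.exists_localFlow {v : X → F} (hv : SmoothField I v)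
    (x₀ : X) : ∃ γ : ℝ → ℝ × X → X,
      ContMDiffAt (𝓘(ℝ, ℝ).prod I) I ∞ (γ 1) (0, x₀) ∧
      ∀ᶠ p in 𝓝 ((0 : ℝ), x₀), γ 0 p = p.2 ∧
        IsMIntegralCurveOn (I := I) (fun s ↦ γ s p) (p.1 • v) (Ioo (-2) 2) := by
  let φ := extChartAt I x₀
  let f₀ : F → F := fun y ↦ (mfderiv I 𝓘(ℝ, F) φ (φ.symm y) : F →L[ℝ] F) (v (φ.symm y))
  have hf₀ : ContDiffOn ℝ ∞ f₀ φ.target := hv.contDiffOn_chart x₀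
  have hopen : IsOpen φ.target := isOpen_extChartAt_target x₀
  have hmem : φ x₀ ∈ φ.target := mem_extChartAt_target x₀
  obtain ⟨δ, hδ, hball⟩ := Metric.isOpen_iff.1 hopen (φ x₀) hmem
  -- The bump makes the field smooth on the whole vector space; the solutions are kept in the ball
  -- of radius `δ / 3`, where the field is unchanged.
  let χ : ContDiffBump (φ x₀) := ⟨δ / 3, δ / 2, by positivity, by linarith⟩
  let f : F → F := fun y ↦ χ y • f₀ y
  have hf : ContDiff ℝ ∞ f := by
    rw [contDiff_iff_contDiffAt]
    intro y
    by_cases hy : y ∈ φ.target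
    · exact χ.contDiffAt.smul (hf₀.contDiffAt (hopen.mem_nhds hy))
    · have : y ∉ tsupport χ := by
        rw [χ.tsupport_eq]
        intro h
        exact hy (hball (Metric.closedBall_subset_ball (by simp [χ]; linarith) h))
      have h0 : f =ᶠ[𝓝 y] fun _ ↦ 0 := by
        filter_upwards [notMem_tsupport_iff_eventuallyEq.1 this] with z hz
        simp [f, hz]
      exact contDiffAt_const.congr_of_eventuallyEq h0
  have hΩ : Metric.ball (φ x₀) (δ / 3) ∈ 𝓝 (φ x₀) := Metric.ball_mem_nhds _ (by positivity)
  obtain ⟨y, hy1, hy2⟩ := exists_smooth_localFlow f hf (φ x₀) hΩ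
  have hΩt : Metric.ball (φ x₀) (δ / 3) ⊆ φ.target :=
    (Metric.ball_subset_ball (by linarith)).trans hball
  have hff₀ : ∀ z ∈ Metric.ball (φ x₀) (δ / 3), f z = f₀ z := by
    intro z hz
    have : χ z = 1 := χ.one_of_mem_closedBall (Metric.ball_subset_closedBall hz)
    simp [f, this]
  let c : ℝ × X → ℝ × F := fun p ↦ (p.1, φ p.2)
  have hc : ContMDiffAt (𝓘(ℝ, ℝ).prod I) (𝓘(ℝ, ℝ).prod 𝓘(ℝ, F)) ∞ c (0, x₀) :=
    contMDiffAt_fst.prodMk (contMDiffAt_extChartAt.comp (0, x₀) contMDiffAt_snd)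
  have hcc : Filter.Tendsto c (𝓝 (0, x₀)) (𝓝 (0, φ x₀)) := hc.continuousAt
  have hsrc : ∀ᶠ p in 𝓝 ((0 : ℝ), x₀), p.2 ∈ φ.source :=
    continuousAt_snd.eventually (extChartAt_source_mem_nhds x₀)
  refine ⟨fun s p ↦ φ.symm (y s (c p)), ?_, ?_⟩
  · have hy1' : ContMDiffAt (𝓘(ℝ, ℝ).prod 𝓘(ℝ, F)) 𝓘(ℝ, F) ∞ (y 1) (0, φ x₀) := by
      rw [← modelWithCornersSelf_prod, chartedSpaceSelf_prod]
      exact hy1.contMDiffAt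
    have hbase : y 1 (0, φ x₀) ∈ φ.target := hΩt ((hy2.self_of_nhds).2 1 (by norm_num)).2
    have hs : ContMDiffAt 𝓘(ℝ, F) I ∞ φ.symm (y 1 (0, φ x₀)) :=
      (contMDiffOn_extChartAt_symm x₀).contMDiffAt (hopen.mem_nhds hbase)
    exact ContMDiffAt.comp (g := φ.symm) (0, x₀) hs (ContMDiffAt.comp (g := y 1) (0, x₀) hy1' hc)
  · filter_upwards [hcc.eventually hy2, hsrc] with p hp hps
    refine ⟨?_, fun s hs ↦ HasMFDerivAt.hasMFDerivWithinAt ?_⟩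
    · simp only [hp.1]
      exact φ.left_inv hps
    · obtain ⟨hd, hin⟩ := hp.2 s hs
      have ht := hΩt hin
      obtain ⟨h1, h2⟩ := hasMFDerivAt_extChartAt_symm (I := I) x₀ ht
      have hd' : HasMFDerivAt 𝓘(ℝ, ℝ) 𝓘(ℝ, F) (fun s ↦ y s (c p)) s
          ((1 : ℝ →L[ℝ] ℝ).smulRight (p.1 • f (y s (c p)))) :=
        hd.hasFDerivAt.hasMFDerivAt
      have h3 := HasMFDerivAt.comp s h1 hd'
      refine h3.congr_mfderiv ?_
      let L : F →L[ℝ] F := mfderiv 𝓘(ℝ, F) I (extChartAt I x₀).symm (y s (c p))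
      have h5 : L (f (y s (c p))) = v (φ.symm (y s (c p))) :=
        (congrArg L (hff₀ _ hin)).trans (h2 _)
      have h6 : L ((1 : ℝ) • p.1 • f (y s (c p))) = (1 : ℝ) • p.1 • v (φ.symm (y s (c p))) := by
        rw [map_smul, map_smul, h5]
      exact ContinuousLinearMap.ext_ring h6

/-- Near every point the integral curves exist for a uniform time. -/
theorem SmoothField.exists_uniform_time {v : X → F} (hv : SmoothField I v)
    (x₀ : X) : ∃ ε > 0, ∀ᶠ x in 𝓝 x₀, ∃ γ : ℝ → X, γ 0 = x ∧
      IsMIntegralCurveOn (I := I) γ v (Ioo (-ε) ε) := by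
  obtain ⟨γ, -, hγ⟩ := hv.exists_localFlow x₀
  rw [nhds_prod_eq] at hγ
  obtain ⟨pa, hpa, pb, hpb, hab⟩ := Filter.eventually_prod_iff.1 hγ
  obtain ⟨ε, hε, hball⟩ := Metric.eventually_nhds_iff.1 hpa
  refine ⟨ε / 2, by positivity, hpb.mono fun x hx ↦ ?_⟩
  have hp := hab (@hball (ε / 2) (by simp [abs_of_pos hε, hε])) hx
  have hε' : ε / 2 ≠ 0 := by positivity
  refine ⟨(fun s ↦ γ s (ε / 2, x)) ∘ (· * (ε / 2)⁻¹), by simpa using hp.1, ?_⟩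
  have h1 := hp.2.comp_mul (ε / 2)⁻¹
  have e1 : ((ε / 2)⁻¹ • (ε / 2) • v : X → F) = v := by
    rw [smul_smul, inv_mul_cancel₀ hε', one_smul]
  refine (Eq.mp (congrArg (fun w : X → F ↦ IsMIntegralCurveOn (I := I) _ w _) e1) h1).mono
    fun t ht ↦ ?_
  simp only [Set.mem_ofPred_eq, mem_Ioo] at ht ⊢
  constructor
  · rw [← div_eq_mul_inv, lt_div_iff₀ (by positivity)]; nlinarith [ht.1]
  · rw [← div_eq_mul_inv, div_lt_iff₀ (by positivity)]; nlinarith [ht.2]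

omit [FiniteDimensional ℝ F] [I.Boundaryless] [T2Space X] in
theorem SmoothField.contMDiff_one {v : X → F} (hv : SmoothField I v) :
    ContMDiff I I.tangent 1 (fun x ↦ (⟨x, v x⟩ : TangentBundle I X)) :=
  ContMDiff.of_le hv (by simp)

/-- Integral curves are complete if they exist for a uniform time outside a compact set. -/
theorem SmoothField.exists_isMIntegralCurve {v : X → F}
    (hv : SmoothField I v) {C : Set X} (hC : IsCompact C) {ε : ℝ} (hε : 0 < ε)
    (hout : ∀ x ∉ C, ∃ γ : ℝ → X, γ 0 = x ∧ IsMIntegralCurveOn (I := I) γ v (Ioo (-ε) ε)) (x : X) :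
    ∃ γ : ℝ → X, γ 0 = x ∧ IsMIntegralCurve (I := I) γ v := by
  have hunif : ∃ ε' > 0, ∀ x ∈ C, ∃ γ : ℝ → X, γ 0 = x ∧
      IsMIntegralCurveOn (I := I) γ v (Ioo (-ε') ε') := by
    refine hC.induction_on (p := fun s ↦ ∃ ε' > 0, ∀ x ∈ s, ∃ γ : ℝ → X, γ 0 = x ∧
      IsMIntegralCurveOn (I := I) γ v (Ioo (-ε') ε')) ⟨1, one_pos, by simp⟩ ?_ ?_ ?_
    · rintro s t hst ⟨e, he, h⟩
      exact ⟨e, he, fun x hx ↦ h x (hst hx)⟩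
    · rintro s t ⟨e, he, h⟩ ⟨e', he', h'⟩
      refine ⟨min e e', lt_min he he', fun x hx ↦ ?_⟩
      rcases hx with hx | hx
      · obtain ⟨γ, h0, hγ⟩ := h x hx
        exact ⟨γ, h0, hγ.mono (Ioo_subset_Ioo (by simp) (by simp))⟩
      · obtain ⟨γ, h0, hγ⟩ := h' x hx
        exact ⟨γ, h0, hγ.mono (Ioo_subset_Ioo (by simp) (by simp))⟩
    · intro x _
      obtain ⟨e, he, h⟩ := hv.exists_uniform_time x
      exact ⟨_, mem_nhdsWithin_of_mem_nhds h, e, he, fun y hy ↦ hy⟩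
  obtain ⟨e, he, h⟩ := hunif
  refine exists_isMIntegralCurve_of_isMIntegralCurveOn hv.contMDiff_one (lt_min he hε)
    (fun y ↦ ?_) x
  by_cases hy : y ∈ C
  · obtain ⟨γ, h0, hγ⟩ := h y hy
    exact ⟨γ, h0, hγ.mono (Ioo_subset_Ioo (by simp) (by simp))⟩
  · obtain ⟨γ, h0, hγ⟩ := hout y hy
    exact ⟨γ, h0, hγ.mono (Ioo_subset_Ioo (by simp) (by simp))⟩

/-- `Φ` is the (global) flow of the vector field `v`. -/
structure IsFlow (I : ModelWithCorners ℝ F H) {X : Type*} [TopologicalSpace X] [ChartedSpace H X]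
    (v : X → F) (Φ : ℝ → X → X) : Prop where
  zero : ∀ x, Φ 0 x = x
  curve : ∀ x, IsMIntegralCurve (I := I) (fun t ↦ Φ t x) v

variable {v : X → F} {Φ : ℝ → X → X}

/-- Both sides are integral curves in `s` with the same starting point. -/
theorem IsFlow.add (hv : SmoothField I v) (hΦ : IsFlow I v Φ) (s t : ℝ) (x : X) :
    Φ (s + t) x = Φ s (Φ t x) := by
  have h1 : IsMIntegralCurve (I := I) ((fun r ↦ Φ r x) ∘ (· + t)) v := (hΦ.curve x).comp_add t
  have h2 := isMIntegralCurve_Ioo_eq_of_contMDiff_boundaryless (t₀ := 0) hv.contMDiff_one h1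
    (hΦ.curve (Φ t x)) (by simp [hΦ.zero])
  exact congrFun h2 s

/-- By uniqueness, `Φ τ x` is the time-one value of the local flow of `τ • v`, which depends
smoothly on `(τ, x)` near `τ = 0`. -/
theorem IsFlow.contMDiffAt_zero (hv : SmoothField I v) (hΦ : IsFlow I v Φ) (x₀ : X) :
    ContMDiffAt (𝓘(ℝ, ℝ).prod I) I ∞ (fun p : ℝ × X ↦ Φ p.1 p.2) (0, x₀) := by
  obtain ⟨γ, hγ1, hγ⟩ := hv.exists_localFlow x₀
  refine hγ1.congr_of_eventuallyEq ?_
  filter_upwards [hγ] with p hp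
  have h1 : IsMIntegralCurve (I := I) ((fun r ↦ Φ r p.2) ∘ (· * p.1)) (p.1 • v) :=
    (hΦ.curve p.2).comp_mul p.1
  have h2 := isMIntegralCurveOn_Ioo_eqOn_of_contMDiff_boundaryless (t₀ := 0) (a := -2) (b := 2)
    (by norm_num) (hv.const_smul p.1).contMDiff_one (h1.isMIntegralCurveOn _) hp.2
    (by simp [hp.1, hΦ.zero])
  simpa using h2 (show (1 : ℝ) ∈ Ioo (-2) 2 by norm_num)

/-- Smoothness propagates from time `0`: the orbit from `x₀` up to time `T` is compact, so one small
time step `T / m` works along all of it, and `Φ t = Φ a ∘ Φ (t - a)` carries smoothness from one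
step to the next. -/
theorem IsFlow.contMDiff (hv : SmoothField I v) (hΦ : IsFlow I v Φ) :
    ContMDiff (𝓘(ℝ, ℝ).prod I) I ∞ (fun p : ℝ × X ↦ Φ p.1 p.2) := by
  -- Finite order is needed because only for finite `n` is the set of points of class `Cⁿ` known to
  -- be open.
  rw [contMDiff_infty]
  rintro n ⟨T, x₀⟩
  let good : Set (ℝ × X) := {p | ContMDiffAt (𝓘(ℝ, ℝ).prod I) I n (fun p : ℝ × X ↦ Φ p.1 p.2) p}
  have hgood : IsOpen good := isOpen_iff_mem_nhds.2 fun p hp ↦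
    (contMDiffAt_iff_contMDiffAt_nhds (by simp)).1 hp
  have hcont : Continuous fun t ↦ Φ t x₀ := (hΦ.curve x₀).continuous
  have hK : IsCompact ((fun t ↦ Φ t x₀) '' uIcc 0 T) := isCompact_uIcc.image hcont
  obtain ⟨A, B, hA, hB, h0A, hKB, hAB⟩ :=
    generalized_tube_lemma (isCompact_singleton (x := (0 : ℝ)))
    hK hgood (by
      rintro ⟨t, y⟩ ⟨ht, -⟩
      obtain rfl : t = 0 := ht
      exact ContMDiffAt.of_le (m := n) (hΦ.contMDiffAt_zero hv y) (by exact_mod_cast le_top))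
  obtain ⟨δ, hδ, hball⟩ := Metric.isOpen_iff.1 hA 0 (h0A rfl)
  obtain ⟨m, hm⟩ := exists_nat_gt (|T| / δ)
  have hm0 : (0 : ℝ) < m := lt_of_le_of_lt (by positivity) hm
  let a : ℝ := T / m
  have ha : a ∈ A := by
    apply hball
    rw [mem_ball_zero_iff, Real.norm_eq_abs, abs_div, abs_of_pos hm0, div_lt_iff₀ hm0]
    rw [div_lt_iff₀ hδ] at hm
    linarith
  have key : ∀ k : ℕ, k ≤ m → ((k * a, x₀) : ℝ × X) ∈ good := by
    intro k
    induction k with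
    | zero =>
      intro _
      have := ContMDiffAt.of_le (m := n) (hΦ.contMDiffAt_zero hv x₀) (by exact_mod_cast le_top)
      simpa [good] using this
    | succ k ih =>
      intro hk
      have h1 : ContMDiffAt (𝓘(ℝ, ℝ).prod I) I n (fun p : ℝ × X ↦ Φ p.1 p.2) (k * a, x₀) :=
        ih (by omega)
      have hmem : Φ (k * a) x₀ ∈ (fun t ↦ Φ t x₀) '' uIcc 0 T := by
        refine ⟨k * a, ?_, rfl⟩
        have hk' : (k : ℝ) / m ∈ Icc (0 : ℝ) 1 :=
          ⟨by positivity, (div_le_one hm0).2 (by exact_mod_cast (by omega : k ≤ m))⟩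
        have : (k : ℝ) * a = (k / m) * T := by simp only [a]; ring
        rw [this, mem_uIcc]
        rcases le_total 0 T with hT | hT
        · left; constructor <;> nlinarith [hk'.1, hk'.2]
        · right; constructor <;> nlinarith [hk'.1, hk'.2]
      have h2 : ((a, Φ (k * a) x₀) : ℝ × X) ∈ good := hAB ⟨ha, hKB hmem⟩
      have h3 : ContMDiffAt (𝓘(ℝ, ℝ).prod I) (𝓘(ℝ, ℝ).prod I) n
          (fun p : ℝ × X ↦ (p.1 - a, p.2)) (((k + 1 : ℕ) : ℝ) * a, x₀) :=
        (contMDiffAt_fst.sub contMDiffAt_const).prodMk contMDiffAt_snd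
      have e3 : (((k + 1 : ℕ) : ℝ) * a - a, x₀) = ((k * a, x₀) : ℝ × X) := by
        push_cast; congr 1; ring
      have h4 : ContMDiffAt (𝓘(ℝ, ℝ).prod I) I n
          (fun p : ℝ × X ↦ Φ (p.1 - a) p.2) (((k + 1 : ℕ) : ℝ) * a, x₀) :=
        ContMDiffAt.comp (g := fun p : ℝ × X ↦ Φ p.1 p.2) _ (by rw [e3]; exact h1) h3
      have h5 : ContMDiffAt (𝓘(ℝ, ℝ).prod I) (𝓘(ℝ, ℝ).prod I) n
          (fun p : ℝ × X ↦ ((a, Φ (p.1 - a) p.2) : ℝ × X)) (((k + 1 : ℕ) : ℝ) * a, x₀) :=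
        contMDiffAt_const.prodMk h4
      have e5 : (a, Φ (((k + 1 : ℕ) : ℝ) * a - a) x₀) = ((a, Φ (k * a) x₀) : ℝ × X) := by
        congr 2; push_cast; ring
      have h6 : ContMDiffAt (𝓘(ℝ, ℝ).prod I) I n
          (fun p : ℝ × X ↦ Φ a (Φ (p.1 - a) p.2)) (((k + 1 : ℕ) : ℝ) * a, x₀) :=
        ContMDiffAt.comp (g := fun p : ℝ × X ↦ Φ p.1 p.2) _ (by rw [e5]; exact h2) h5
      refine h6.congr_of_eventuallyEq (Filter.Eventually.of_forall fun p ↦ ?_)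
      change Φ p.1 p.2 = Φ a (Φ (p.1 - a) p.2)
      rw [← hΦ.add hv]
      congr 1; ring
  have := key m le_rfl
  rwa [show (m : ℝ) * a = T by simp only [a]; field_simp] at this

end ManifoldFlow

/-! ### Vector fields on products. -/

section ProductField

variable {F : Type*} [NormedAddCommGroup F] [NormedSpace ℝ F]
  {H : Type*} [TopologicalSpace H] {I : ModelWithCorners ℝ F H}
  {X : Type*} [TopologicalSpace X] [ChartedSpace H X] [IsManifold I ∞ X]
  {F' : Type*} [NormedAddCommGroup F'] [NormedSpace ℝ F']
  {H' : Type*} [TopologicalSpace H'] {I' : ModelWithCorners ℝ F' H'}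
  {Y : Type*} [TopologicalSpace Y] [ChartedSpace H' Y] [IsManifold I' ∞ Y]

theorem mfderiv_extChartAt_prod (x₀ : X) (y₀ : Y) {x : X} {y : Y}
    (hx : x ∈ (chartAt H x₀).source) (hy : y ∈ (chartAt H' y₀).source) (w : F × F') :
    (mfderiv (I.prod I') 𝓘(ℝ, F × F') (extChartAt (I.prod I') (x₀, y₀)) (x, y) :
      F × F' →L[ℝ] F × F') w =
    ((mfderiv I 𝓘(ℝ, F) (extChartAt I x₀) x : F →L[ℝ] F) w.1,
      (mfderiv I' 𝓘(ℝ, F') (extChartAt I' y₀) y : F' →L[ℝ] F') w.2) := by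
  have h1 := (mdifferentiableAt_extChartAt (I := I) hx).hasMFDerivAt
  have h2 := (mdifferentiableAt_extChartAt (I := I') hy).hasMFDerivAt
  have h3 := HasMFDerivAt.prodMap (p := (x, y)) h1 h2
  have h4 : mfderiv (I.prod I') (𝓘(ℝ, F).prod 𝓘(ℝ, F'))
      (Prod.map (extChartAt I x₀) (extChartAt I' y₀)) (x, y) = _ := h3.mfderiv
  have h5 : (extChartAt (I.prod I') (x₀, y₀) : X × Y → F × F') =
      Prod.map (extChartAt I x₀) (extChartAt I' y₀) := by
    rw [extChartAt_prod]; rfl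
  rw [h5, modelWithCornersSelf_prod, ← chartedSpaceSelf_prod]
  exact DFunLike.congr_fun h4 w

theorem smoothField_prod {w : X × Y → F × F'}
    (h1 : ∀ x₀ y₀, ContMDiffAt (I.prod I') 𝓘(ℝ, F) ∞ (fun p : X × Y ↦
      (mfderiv I 𝓘(ℝ, F) (extChartAt I x₀) p.1 : F →L[ℝ] F) (w p).1) (x₀, y₀))
    (h2 : ∀ x₀ y₀, ContMDiffAt (I.prod I') 𝓘(ℝ, F') ∞ (fun p : X × Y ↦
      (mfderiv I' 𝓘(ℝ, F') (extChartAt I' y₀) p.2 : F' →L[ℝ] F') (w p).2) (x₀, y₀)) :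
    SmoothField (I.prod I') w := by
  rw [smoothField_iff]
  rintro ⟨x₀, y₀⟩
  have h3 : ContMDiffAt (I.prod I') 𝓘(ℝ, F × F') ∞ (fun p : X × Y ↦
      ((mfderiv I 𝓘(ℝ, F) (extChartAt I x₀) p.1 : F →L[ℝ] F) (w p).1,
      (mfderiv I' 𝓘(ℝ, F') (extChartAt I' y₀) p.2 : F' →L[ℝ] F') (w p).2)) (x₀, y₀) :=
    (h1 x₀ y₀).prodMk_space (h2 x₀ y₀)
  refine h3.congr_of_eventuallyEq ?_
  have e1 : ∀ᶠ p : X × Y in 𝓝 (x₀, y₀), p.1 ∈ (chartAt H x₀).source :=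
    continuousAt_fst.eventually (chart_source_mem_nhds H x₀)
  have e2 : ∀ᶠ p : X × Y in 𝓝 (x₀, y₀), p.2 ∈ (chartAt H' y₀).source :=
    continuousAt_snd.eventually (chart_source_mem_nhds H' y₀)
  filter_upwards [e1, e2] with p hp1 hp2
  exact mfderiv_extChartAt_prod x₀ y₀ hp1 hp2 (w p)

theorem mfderiv_extChartAt_self_space (x₀ x : F) :
    (mfderiv 𝓘(ℝ, F) 𝓘(ℝ, F) (extChartAt 𝓘(ℝ, F) x₀) x : F →L[ℝ] F) =
      ContinuousLinearMap.id ℝ F := by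
  have h : (extChartAt 𝓘(ℝ, F) x₀ : F → F) = id := by
    rw [extChartAt_model_space_eq_id]; rfl
  rw [h]
  exact mfderiv_id

end ProductField

/-! ### Integrals of functions along a flow. -/

section IntegralAlongFlow

variable {F : Type*} [NormedAddCommGroup F] [NormedSpace ℝ F] [FiniteDimensional ℝ F]
  {H : Type*} [TopologicalSpace H] {I : ModelWithCorners ℝ F H} [I.Boundaryless]
  {X : Type*} [TopologicalSpace X] [ChartedSpace H X] [IsManifold I ∞ X] [T2Space X]
  {v : X → F} {Φ : ℝ → X → X}

theorem IsFlow.continuous_comp_curve {ℓ : X → ℝ} (hΦ : IsFlow I v Φ) (hℓ : Continuous ℓ) (x : X) :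
    Continuous fun t ↦ ℓ (Φ t x) :=
  hℓ.comp (hΦ.curve x).continuous

theorem IsFlow.hasDerivAt_integral {ℓ : X → ℝ} (hΦ : IsFlow I v Φ) (hℓ : Continuous ℓ) (x : X)
    (t : ℝ) : HasDerivAt (fun t ↦ ∫ r in (0 : ℝ)..t, ℓ (Φ r x)) (ℓ (Φ t x)) t :=
  intervalIntegral.integral_hasDerivAt_right
    ((hΦ.continuous_comp_curve hℓ x).intervalIntegrable _ _)
    ((hΦ.continuous_comp_curve hℓ x).stronglyMeasurableAtFilter _ _)
    (hΦ.continuous_comp_curve hℓ x).continuousAt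

/-- The integral of a smooth function along a flow is smooth in time and initial point. -/
theorem IsFlow.contMDiff_integral (hv : SmoothField I v) (hΦ : IsFlow I v Φ) {ℓ : X → ℝ}
    (hℓ : ContMDiff I 𝓘(ℝ, ℝ) ∞ ℓ) :
    ContMDiff (𝓘(ℝ, ℝ).prod I) 𝓘(ℝ, ℝ) ∞
      (fun p : ℝ × X ↦ ∫ r in (0 : ℝ)..p.1, ℓ (Φ r p.2)) := by
  -- An extra real coordinate moving with speed `ℓ` records the integral, so smoothness of flows
  -- applies and no differentiation under the integral is needed.
  let w : X × ℝ → F × ℝ := fun p ↦ (v p.1, ℓ p.1)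
  have hw : SmoothField (I.prod 𝓘(ℝ, ℝ)) w := by
    refine smoothField_prod (I := I) (X := X) (I' := 𝓘(ℝ, ℝ)) (Y := ℝ) (w := w)
      (fun x₀ y₀ ↦ ?_) (fun x₀ y₀ ↦ ?_)
    · have h : ContMDiffAt (I.prod 𝓘(ℝ, ℝ)) I ∞ (Prod.fst : X × ℝ → X) (x₀, y₀) :=
        contMDiffAt_fst
      exact ContMDiffAt.comp (x₀, y₀) (smoothField_iff.1 hv x₀) h
    · have h : ContMDiffAt (I.prod 𝓘(ℝ, ℝ)) 𝓘(ℝ, ℝ) ∞ (fun p : X × ℝ ↦ ℓ p.1) (x₀, y₀) :=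
        ContMDiffAt.comp (x₀, y₀) (hℓ x₀) contMDiffAt_fst
      refine h.congr_of_eventuallyEq (Filter.Eventually.of_forall fun p ↦ ?_)
      exact DFunLike.congr_fun (mfderiv_extChartAt_self_space y₀ p.2) (ℓ p.1)
  let Ψ : ℝ → X × ℝ → X × ℝ := fun t p ↦ (Φ t p.1, p.2 + ∫ r in (0 : ℝ)..t, ℓ (Φ r p.1))
  have hΨ : IsFlow (I.prod 𝓘(ℝ, ℝ)) w Ψ := by
    refine ⟨fun p ↦ by simp [Ψ, hΦ.zero], fun p t ↦ ?_⟩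
    have h1 := hΦ.curve p.1 t
    have h2 : HasMFDerivAt 𝓘(ℝ, ℝ) 𝓘(ℝ, ℝ) (fun t ↦ p.2 + ∫ r in (0 : ℝ)..t, ℓ (Φ r p.1)) t
        ((1 : ℝ →L[ℝ] ℝ).smulRight (ℓ (Φ t p.1))) :=
      ((hΦ.hasDerivAt_integral hℓ.continuous p.1 t).const_add p.2).hasFDerivAt.hasMFDerivAt
    exact (h1.prodMk h2).congr_mfderiv (ContinuousLinearMap.ext_ring rfl)
  have h := hΨ.contMDiff hw
  have h2 : ContMDiff (𝓘(ℝ, ℝ).prod I) (𝓘(ℝ, ℝ).prod (I.prod 𝓘(ℝ, ℝ))) ∞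
      (fun p : ℝ × X ↦ ((p.1, (p.2, (0 : ℝ))) : ℝ × (X × ℝ))) :=
    contMDiff_fst.prodMk (contMDiff_snd.prodMk contMDiff_const)
  have h3 := contMDiff_snd.comp (h.comp h2)
  refine h3.congr fun p ↦ ?_
  simp [Ψ]

end IntegralAlongFlow

/-! ### Injective immersions near compact sets. -/

section Immersion

/-- An injective linear map in finite dimension satisfies `‖v‖ ≤ K ‖L v‖`. An error of `1 / (2K)`,
in the strict derivative or in the operator norm, then leaves `‖v‖ ≤ ‖v‖ / 2`, which forces `v = 0`.
-/
theorem exists_injOn_of_injective_fderiv {F F' : Type*} [NormedAddCommGroup F] [NormedSpace ℝ F]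
    [FiniteDimensional ℝ F] [NormedAddCommGroup F'] [NormedSpace ℝ F'] {h : F → F'} {x : F}
    (hh : ContDiffAt ℝ 1 h x) (hinj : Function.Injective (fderiv ℝ h x)) :
    ∃ u ∈ 𝓝 x, InjOn h u ∧ ∀ y ∈ u, Function.Injective (fderiv ℝ h y) := by
  obtain ⟨K, hK0, hK⟩ := (fderiv ℝ h x).exists_antilipschitzWith (LinearMap.ker_eq_bot.2 hinj)
  have hlow : ∀ v, ‖v‖ ≤ K * ‖fderiv ℝ h x v‖ := fun v ↦ by
    simpa using hK.le_mul_dist v 0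
  have hK0' : (0 : ℝ) < K := by exact_mod_cast hK0
  have hKi : (0 : ℝ) < 1 / (2 * K) := by positivity
  have hstrict := hh.hasStrictFDerivAt (by simp)
  have h1 := hstrict.isLittleO.def hKi
  rw [nhds_prod_eq, Filter.eventually_prod_self_iff'] at h1
  obtain ⟨u, hu, huu⟩ := h1
  have h2 : ContinuousAt (fderiv ℝ h) x := (hh.fderiv_right (m := 0) (by simp)).continuousAt
  have h3 : ∀ᶠ y in 𝓝 x, ‖fderiv ℝ h y - fderiv ℝ h x‖ < 1 / (2 * K) := by
    have := h2.eventually (Metric.ball_mem_nhds _ hKi)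
    filter_upwards [this] with y hy
    rwa [← dist_eq_norm]
  refine ⟨u ∩ {y | ‖fderiv ℝ h y - fderiv ℝ h x‖ < 1 / (2 * K)}, Filter.inter_mem hu h3, ?_, ?_⟩
  · rintro a ⟨ha, -⟩ b ⟨hb, -⟩ hab
    have h4 := huu a ha b hb
    simp only [hab, sub_self, zero_sub, norm_neg] at h4
    have h5 := hlow (a - b)
    have h6 : ‖a - b‖ ≤ K * (1 / (2 * K) * ‖a - b‖) := h5.trans (by gcongr)
    have h7 : (K : ℝ) * (1 / (2 * K) * ‖a - b‖) = ‖a - b‖ / 2 := by field_simp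
    rw [h7] at h6
    have h8 : ‖a - b‖ = 0 := le_antisymm (by linarith) (norm_nonneg _)
    exact sub_eq_zero.1 (norm_eq_zero.1 h8)
  · rintro y ⟨-, hy⟩
    rw [injective_iff_map_eq_zero]
    intro v hv
    have h4 : ‖fderiv ℝ h x v‖ ≤ 1 / (2 * K) * ‖v‖ := by
      have h5 : fderiv ℝ h x v = -((fderiv ℝ h y - fderiv ℝ h x) v) := by simp [hv]
      rw [h5, norm_neg]
      exact ((fderiv ℝ h y - fderiv ℝ h x).le_opNorm v).trans
        (by gcongr; exact (hy : _ < _).le)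
    have h6 : ‖v‖ ≤ K * (1 / (2 * K) * ‖v‖) := (hlow v).trans (by gcongr)
    have h7 : (K : ℝ) * (1 / (2 * K) * ‖v‖) = ‖v‖ / 2 := by field_simp
    rw [h7] at h6
    exact norm_eq_zero.1 (le_antisymm (by linarith) (norm_nonneg _))

variable {F : Type*} [NormedAddCommGroup F] [NormedSpace ℝ F] [FiniteDimensional ℝ F]
  {H : Type*} [TopologicalSpace H] {I : ModelWithCorners ℝ F H} [I.Boundaryless]
  {X : Type*} [TopologicalSpace X] [ChartedSpace H X] [IsManifold I ∞ X]
  {F' : Type*} [NormedAddCommGroup F'] [NormedSpace ℝ F'] [FiniteDimensional ℝ F']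
  {H' : Type*} [TopologicalSpace H'] {I' : ModelWithCorners ℝ F' H'} [I'.Boundaryless]
  {Y : Type*} [TopologicalSpace Y] [ChartedSpace H' Y] [IsManifold I' ∞ Y]

theorem mfderiv_extChartAt_bijective (x₀ : X) {x : X} (hx : x ∈ (chartAt H x₀).source) :
    Function.Bijective (mfderiv I 𝓘(ℝ, F) (extChartAt I x₀) x : F →L[ℝ] F) := by
  rw [← extChartAt_source I] at hx
  obtain ⟨e, he⟩ := isInvertible_mfderiv_extChartAt (I := I) hx
  have h : ∀ v : F, (e : F → F) v = (mfderiv I 𝓘(ℝ, F) (extChartAt I x₀) x : F →L[ℝ] F) v :=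
    fun v ↦ DFunLike.congr_fun he v
  exact (funext h : (e : F → F) = _) ▸ e.bijective

/-- A map with injective derivative at a point is an injective immersion near that point. -/
theorem exists_injOn_of_injective_mfderiv {f : X → Y} {x₀ : X} (hf : ContMDiffAt I I' ∞ f x₀)
    (hinj : Function.Injective (mfderiv I I' f x₀)) :
    ∃ u ∈ 𝓝 x₀, InjOn f u ∧ ∀ x ∈ u, Function.Injective (mfderiv I I' f x) := by
  let φ := extChartAt I x₀
  let φ' := extChartAt I' (f x₀)
  let h : F → F' := fun y ↦ φ' (f (φ.symm y))
  have hh : ContDiffAt ℝ ∞ h (φ x₀) := by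
    have := (contMDiffAt_iff.1 hf).2
    rw [I.range_eq_univ, contDiffWithinAt_univ] at this
    exact this
  have hf1 : ContMDiffAt I I' 1 f x₀ := hf.of_le (by simp)
  have hh1 : ContDiffAt ℝ 1 h (φ x₀) := hh.of_le (by simp)
  have ev1 : ∀ᶠ x in 𝓝 x₀, x ∈ φ.source := extChartAt_source_mem_nhds x₀
  have ev2 : ∀ᶠ x in 𝓝 x₀, f x ∈ (chartAt H' (f x₀)).source :=
    hf.continuousAt.eventually (chart_source_mem_nhds H' (f x₀))
  have ev3 : ∀ᶠ x in 𝓝 x₀, ContMDiffAt I I' 1 f x :=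
    (contMDiffAt_iff_contMDiffAt_nhds (by simp)).1 hf1
  have hφc : ContinuousAt φ x₀ := continuousAt_extChartAt x₀
  have ev4 : ∀ᶠ x in 𝓝 x₀, ContDiffAt ℝ 1 h (φ x) :=
    hφc.eventually (hh1.eventually (by simp))
  -- The chain rule conjugates `mfderiv` to `fderiv ℝ h` by the bijective chart derivatives, so
  -- injectivity passes both ways.
  have rel : ∀ x, x ∈ φ.source → f x ∈ (chartAt H' (f x₀)).source → ContMDiffAt I I' 1 f x →
      ContDiffAt ℝ 1 h (φ x) → ∀ v : F,
      fderiv ℝ h (φ x) ((mfderiv I 𝓘(ℝ, F) φ x : F →L[ℝ] F) v) =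
        (mfderiv I' 𝓘(ℝ, F') φ' (f x) : F' →L[ℝ] F') ((mfderiv I I' f x : F →L[ℝ] F') v) := by
    intro x hx1 hx2 hx3 hx4 v
    have hx1' : x ∈ (chartAt H x₀).source := by rwa [← extChartAt_source I]
    have d1 := (mdifferentiableAt_extChartAt (I := I) hx1').hasMFDerivAt
    have d2 := (hx4.differentiableAt (by simp)).hasFDerivAt.hasMFDerivAt
    have d3 := (mdifferentiableAt_extChartAt (I := I') hx2).hasMFDerivAt
    have d4 := (hx3.mdifferentiableAt (by simp)).hasMFDerivAt
    have c1 := HasMFDerivAt.comp x d2 d1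
    have c2 := HasMFDerivAt.comp x d3 d4
    have heq : (h ∘ φ) =ᶠ[𝓝 x] (φ' ∘ f) := by
      filter_upwards [(isOpen_extChartAt_source x₀).mem_nhds hx1] with z hz
      change φ' (f (φ.symm (φ z))) = φ' (f z)
      rw [φ.left_inv hz]
    have c3 := hasMFDerivAt_unique c1 (c2.congr_of_eventuallyEq heq)
    exact DFunLike.congr_fun c3 v
  have hinj' : Function.Injective (fderiv ℝ h (φ x₀)) := by
    rw [injective_iff_map_eq_zero]
    intro w hw
    obtain ⟨v, rfl⟩ := (mfderiv_extChartAt_bijective (I := I) x₀ (mem_chart_source H x₀)).2 w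
    have h1 := rel x₀ (mem_extChartAt_source x₀) (mem_chart_source H' _) hf1 hh1 v
    have h2 : (mfderiv I' 𝓘(ℝ, F') φ' (f x₀) : F' →L[ℝ] F')
        ((mfderiv I I' f x₀ : F →L[ℝ] F') v) = 0 := h1.symm.trans hw
    have h3 : (mfderiv I I' f x₀ : F →L[ℝ] F') v = 0 :=
      (mfderiv_extChartAt_bijective (I := I') (f x₀) (mem_chart_source H' _)).1
        (h2.trans (map_zero _).symm)
    have h4 : v = 0 := hinj (h3.trans (map_zero (mfderiv I I' f x₀ : F →L[ℝ] F')).symm)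
    rw [h4]
    exact map_zero (mfderiv I 𝓘(ℝ, F) φ x₀ : F →L[ℝ] F)
  obtain ⟨u, hu, hui, hud⟩ := exists_injOn_of_injective_fderiv hh1 hinj'
  have ev5 : ∀ᶠ x in 𝓝 x₀, φ x ∈ u := hφc hu
  refine ⟨_, (((ev1.and ev2).and (ev3.and ev4)).and ev5), ?_, ?_⟩
  · rintro a ⟨⟨⟨ha1, ha2⟩, -⟩, ha⟩ b ⟨⟨⟨hb1, hb2⟩, -⟩, hb⟩ hab
    have : h (φ a) = h (φ b) := by
      change φ' (f (φ.symm (φ a))) = φ' (f (φ.symm (φ b)))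
      rw [φ.left_inv ha1, φ.left_inv hb1, hab]
    exact φ.injOn ha1 hb1 (hui ha hb this)
  · rintro x ⟨⟨⟨hx1, hx2⟩, hx3, hx4⟩, hx⟩
    have hx1' : x ∈ (chartAt H x₀).source := by rwa [← extChartAt_source I]
    refine (injective_iff_map_eq_zero (mfderiv I I' f x : F →L[ℝ] F')).2 fun v hv ↦ ?_
    have h1 := rel x hx1 hx2 hx3 hx4 v
    rw [hv, map_zero] at h1
    have h2 := hud _ hx (h1.trans (map_zero _).symm)
    exact (mfderiv_extChartAt_bijective (I := I) x₀ hx1').1 (h2.trans (map_zero _).symm)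

/-- Injective immersions on a compact set are injective immersions on a neighbourhood of it. -/
theorem exists_injOn_nhdsSet_of_injective_mfderiv [T2Space Y] {f : X → Y} {s : Set X}
    (hs : IsCompact s) (hf : ∀ x ∈ s, ContMDiffAt I I' ∞ f x) (hinj : InjOn f s)
    (hd : ∀ x ∈ s, Function.Injective (mfderiv I I' f x)) :
    ∃ t ∈ 𝓝ˢ s, InjOn f t ∧ ∀ x ∈ t, Function.Injective (mfderiv I I' f x) := by
  have hloc := fun x hx ↦ exists_injOn_of_injective_mfderiv (hf x hx) (hd x hx)
  obtain ⟨t, ht, hti⟩ := hinj.exists_mem_nhdsSet hs (fun x hx ↦ (hf x hx).continuousAt)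
    (fun x hx ↦ (hloc x hx).imp fun u hu ↦ ⟨hu.1, hu.2.1⟩)
  have h2 : ∀ᶠ x in 𝓝ˢ s, Function.Injective (mfderiv I I' f x) := by
    rw [eventually_nhdsSet_iff_forall]
    intro x hx
    obtain ⟨u, hu, -, hud⟩ := hloc x hx
    exact Filter.mem_of_superset hu hud
  exact ⟨t ∩ {x | Function.Injective (mfderiv I I' f x)}, Filter.inter_mem ht h2,
    hti.mono inter_subset_left, fun x hx ↦ hx.2⟩

end Immersion

/-! ### Charts, Liouville form and symplectic form of the cotangent bundle. -/

section CotangentCharts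

variable {E : Type*} [NormedAddCommGroup E] [NormedSpace ℝ E]
  {M : Type*} [TopologicalSpace M] [ChartedSpace E M] [IsManifold 𝓘(ℝ, E) ∞ M]

/-- Covectors at `q` in the coordinates of the chart at `q₀`. -/
def covectorCoord (q₀ : M) (z : CotangentBundle E M) : E →L[ℝ] ℝ :=
  (z.2 : E →L[ℝ] ℝ).comp
    ((trivializationAt E (TangentSpace 𝓘(ℝ, E)) q₀).symmL ℝ z.proj : E →L[ℝ] E)

theorem cotangent_trivializationAt_apply (q₀ : M) (z : CotangentBundle E M) :
    trivializationAt (E →L[ℝ] ℝ)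
      (fun x : M ↦ TangentSpace 𝓘(ℝ, E) x →L[ℝ] Bundle.Trivial M ℝ x) q₀ z =
      (z.proj, covectorCoord q₀ z) := by
  refine (hom_trivializationAt_apply (RingHom.id ℝ) q₀ z).trans ?_
  refine Prod.ext rfl ?_
  ext v
  exact DFunLike.congr_fun (Bundle.Trivial.continuousLinearMapAt_trivialization ℝ M ℝ z.proj) _

theorem mem_extChartAt_cotangent_source (z₀ z : CotangentBundle E M) :
    z ∈ (extChartAt (cotangentModel E) z₀).source ↔ z.proj ∈ (chartAt E z₀.proj).source := by
  rw [extChartAt_source, FiberBundle.chartedSpace_chartAt]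
  simp only [mfld_simps]
  rw [cotangent_trivializationAt_apply]
  exact ⟨fun h ↦ h.2, fun h ↦ ⟨⟨h, trivial⟩, h⟩⟩

theorem extChartAt_cotangent_apply (z₀ z : CotangentBundle E M) :
    extChartAt (cotangentModel E) z₀ z =
      (extChartAt 𝓘(ℝ, E) z₀.proj z.proj, covectorCoord z₀.proj z) := by
  rw [FiberBundle.extChartAt]
  have h := cotangent_trivializationAt_apply z₀.proj z
  exact congrArg (fun p : M × (E →L[ℝ] ℝ) ↦ (extChartAt 𝓘(ℝ, E) z₀.proj p.1, p.2)) h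

/-- Points over different base points are separated in `M`, points of one fibre in a trivialization.
Uniqueness of integral curves depends on this. -/
instance [T2Space M] : T2Space (CotangentBundle E M) := by
  refine ⟨fun z z' hne ↦ ?_⟩
  by_cases hq : z.proj = z'.proj
  · let e := trivializationAt (E →L[ℝ] ℝ)
      (fun x : M ↦ TangentSpace 𝓘(ℝ, E) x →L[ℝ] Bundle.Trivial M ℝ x) z.proj
    have h1 : z ∈ e.source := FiberBundle.mem_trivializationAt_proj_source
    have h2 : z' ∈ e.source := by
      rw [e.mem_source, ← hq, ← e.mem_source]; exact h1
    have h3 : e z ≠ e z' := fun h ↦ hne (e.injOn h1 h2 h)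
    obtain ⟨u, v, hu, hv, hzu, hzv, huv⟩ := t2_separation h3
    refine ⟨e.source ∩ e ⁻¹' u, e.source ∩ e ⁻¹' v,
      e.toOpenPartialHomeomorph.isOpen_inter_preimage hu,
      e.toOpenPartialHomeomorph.isOpen_inter_preimage hv, ⟨h1, hzu⟩, ⟨h2, hzv⟩, ?_⟩
    exact (huv.preimage e).mono inter_subset_right inter_subset_right
  · obtain ⟨u, v, hu, hv, hzu, hzv, huv⟩ := t2_separation hq
    have hc : Continuous (fun y : CotangentBundle E M ↦ y.proj) := FiberBundle.continuous_proj _ _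
    exact ⟨_, _, hu.preimage hc, hv.preimage hc, hzu, hzv, huv.preimage _⟩

/-- Finitely many charts of `M` cover it, and the charts over them cover the bundle. The resulting
σ-compactness provides smooth cutoff functions. -/
instance [FiniteDimensional ℝ E] [CompactSpace M] :
    SecondCountableTopology (CotangentBundle E M) := by
  obtain ⟨t, ht⟩ := CompactSpace.elim_nhds_subcover (fun q : M ↦ (chartAt E q).source)
    (fun q ↦ chart_source_mem_nhds E q)
  have : SecondCountableTopology (ModelProd E (E →L[ℝ] ℝ)) :=
    inferInstanceAs (SecondCountableTopology (E × (E →L[ℝ] ℝ)))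
  refine ChartedSpace.secondCountable_of_countable_cover (ModelProd E (E →L[ℝ] ℝ))
    (s := (fun q : M ↦ (⟨q, (0 : E →L[ℝ] ℝ)⟩ : CotangentBundle E M)) '' t) ?_
    (t.countable_toSet.image _)
  rw [eq_univ_iff_forall]
  intro z
  have hz : z.proj ∈ ⋃ q ∈ t, (chartAt E q).source := by rw [ht]; trivial
  simp only [mem_iUnion] at hz ⊢
  obtain ⟨q, hq, hzq⟩ := hz
  exact ⟨_, mem_image_of_mem _ hq, by
    rw [← extChartAt_source (cotangentModel E)]
    exact (mem_extChartAt_cotangent_source _ _).2 hzq⟩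

instance [FiniteDimensional ℝ E] : LocallyCompactSpace (CotangentBundle E M) :=
  Manifold.locallyCompact_of_finiteDimensional (cotangentModel E)

instance [FiniteDimensional ℝ E] [CompactSpace M] : SigmaCompactSpace (CotangentBundle E M) :=
  inferInstance

/-- The canonical symplectic form of the model space `E × E*`. -/
def stdSymplectic (a b : E × (E →L[ℝ] ℝ)) : ℝ := b.2 a.1 - a.2 b.1

theorem contMDiff_cotangent_proj :
    ContMDiff (cotangentModel E) 𝓘(ℝ, E) ∞ (fun y : CotangentBundle E M ↦ y.proj) :=
  Bundle.contMDiff_proj _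

/-- The derivative of the chart of `T*M` at `z₀`. -/
def chartDeriv (z₀ z : CotangentBundle E M) : E × (E →L[ℝ] ℝ) →L[ℝ] E × (E →L[ℝ] ℝ) :=
  mfderiv (cotangentModel E) 𝓘(ℝ, E × (E →L[ℝ] ℝ)) (extChartAt (cotangentModel E) z₀) z

/-- The derivative of the projection of `T*M`. -/
def projDeriv (z : CotangentBundle E M) : E × (E →L[ℝ] ℝ) →L[ℝ] E :=
  mfderiv (cotangentModel E) 𝓘(ℝ, E) (fun y : CotangentBundle E M ↦ y.proj) z

/-- The Liouville form is `p dq` in every chart. -/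
theorem liouville_chart {z₀ z : CotangentBundle E M}
    (hz : z ∈ (extChartAt (cotangentModel E) z₀).source) (ξ : E × (E →L[ℝ] ℝ)) :
    liouville z ξ = (extChartAt (cotangentModel E) z₀ z).2 (chartDeriv z₀ z ξ).1 := by
  have hzq := (mem_extChartAt_cotangent_source z₀ z).1 hz
  have hz' : z ∈ (chartAt (ModelProd E (E →L[ℝ] ℝ)) z₀).source := by
    rwa [← extChartAt_source (cotangentModel E)]
  have d1 := (mdifferentiableAt_extChartAt (I := cotangentModel E) hz').hasMFDerivAt
  have d2 := (mdifferentiableAt_extChartAt (I := 𝓘(ℝ, E)) hzq).hasMFDerivAt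
  have d3 := (contMDiff_cotangent_proj.mdifferentiable (by simp) z).hasMFDerivAt
  have d4 : HasMFDerivAt 𝓘(ℝ, E × (E →L[ℝ] ℝ)) 𝓘(ℝ, E) (Prod.fst : E × (E →L[ℝ] ℝ) → E)
      (extChartAt (cotangentModel E) z₀ z) (ContinuousLinearMap.fst ℝ E (E →L[ℝ] ℝ)) :=
    hasFDerivAt_fst.hasMFDerivAt
  have c1 := HasMFDerivAt.comp z d4 d1
  have c2 := HasMFDerivAt.comp z d2 d3
  have heq : (Prod.fst : E × (E →L[ℝ] ℝ) → E) ∘ (extChartAt (cotangentModel E) z₀) =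
      extChartAt 𝓘(ℝ, E) z₀.proj ∘ fun y : CotangentBundle E M ↦ y.proj := by
    funext y
    exact congrArg Prod.fst (extChartAt_cotangent_apply z₀ y)
  rw [← heq] at c2
  have c3 : (chartDeriv z₀ z ξ).1 =
      (mfderiv 𝓘(ℝ, E) 𝓘(ℝ, E) (extChartAt 𝓘(ℝ, E) z₀.proj) z.proj : E →L[ℝ] E) (projDeriv z ξ) :=
    DFunLike.congr_fun (hasMFDerivAt_unique c1 c2) ξ
  -- The fibre coordinate of a covector is its composition with the inverse of the chart derivative,
  -- which cancels against the chart derivative of the velocity.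
  have c4 : ∀ v : E, ((trivializationAt E (TangentSpace 𝓘(ℝ, E)) z₀.proj).symmL ℝ z.proj :
      E →L[ℝ] E) ((mfderiv 𝓘(ℝ, E) 𝓘(ℝ, E) (extChartAt 𝓘(ℝ, E) z₀.proj) z.proj : E →L[ℝ] E) v) =
      v := by
    intro v
    have h1 := TangentBundle.continuousLinearMapAt_trivializationAt (I := 𝓘(ℝ, E)) hzq
    have h2 := Trivialization.symmL_continuousLinearMapAt (R := ℝ)
      (trivializationAt E (TangentSpace 𝓘(ℝ, E)) z₀.proj) (b := z.proj) hzq v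
    rw [← h1]
    exact h2
  have c5 : (extChartAt (cotangentModel E) z₀ z).2 = covectorCoord z₀.proj z :=
    congrArg Prod.snd (extChartAt_cotangent_apply z₀ z)
  rw [c5, c3]
  exact (congrArg (z.2 : E →L[ℝ] ℝ) (c4 (projDeriv z ξ))).symm

/-- This is `T^* λ = λ ⟹ T^* dλ = dλ`: the invariance of `p dq` is differentiated in direction `v`
and antisymmetrized in `v, w`, which cancels the symmetric second derivative of `T`. -/
theorem pairing_antisymm_of_preserves {A P : Type*} [NormedAddCommGroup A] [NormedSpace ℝ A]
    [NormedAddCommGroup P] [NormedSpace ℝ P] (B : P →L[ℝ] A →L[ℝ] ℝ) {T : A × P → A × P} {a : A × P}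
    (hT : ContDiffAt ℝ ∞ T a)
    (h : ∀ᶠ y in 𝓝 a, ∀ w, B (T y).2 (fderiv ℝ T y w).1 = B y.2 w.1) (v w : A × P) :
    B (fderiv ℝ T a w).2 (fderiv ℝ T a v).1 - B (fderiv ℝ T a v).2 (fderiv ℝ T a w).1 =
      B w.2 v.1 - B v.2 w.1 := by
  have hd : HasFDerivAt T (fderiv ℝ T a) a := (hT.differentiableAt (by simp)).hasFDerivAt
  have hdd : HasFDerivAt (fderiv ℝ T) (fderiv ℝ (fderiv ℝ T) a) a :=
    ((hT.fderiv_right (m := ∞) (by simp)).differentiableAt (by simp)).hasFDerivAt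
  have hsymm : IsSymmSndFDerivAt ℝ T a := hT.isSymmSndFDerivAt (by
    rw [minSmoothness_of_isRCLikeNormedField]
    exact WithTop.coe_le_coe.2 (le_top : (2 : ℕ∞) ≤ ⊤))
  have key : ∀ v w, B (fderiv ℝ T a v).2 (fderiv ℝ T a w).1 +
      B (T a).2 (fderiv ℝ (fderiv ℝ T) a v w).1 = B v.2 w.1 := by
    intro v w
    have h1 : HasFDerivAt (fun y ↦ B (T y).2)
        (B.comp ((ContinuousLinearMap.snd ℝ A P).comp (fderiv ℝ T a))) a :=
      B.hasFDerivAt.comp a hd.snd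
    have h2 : HasFDerivAt (fun y ↦ (fderiv ℝ T y w).1) ((ContinuousLinearMap.fst ℝ A P).comp
        ((fderiv ℝ (fderiv ℝ T) a).flip w)) a :=
      (hdd.clm_apply (hasFDerivAt_const w a)).fst.congr_fderiv (by ext <;> simp)
    have h3 := h1.clm_apply h2
    have h4 : HasFDerivAt (fun y : A × P ↦ B y.2 w.1)
        ((B.flip w.1).comp (ContinuousLinearMap.snd ℝ A P)) a :=
      ((B.flip w.1).comp (ContinuousLinearMap.snd ℝ A P)).hasFDerivAt
    have h5 := DFunLike.congr_fun (h3.unique (h4.congr_of_eventuallyEq (h.mono fun y hy ↦ hy w))) v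
    simp at h5
    rw [← h5, add_comm]
  have k1 := key v w
  have k2 := key w v
  rw [hsymm w v] at k2
  linarith

theorem chartDeriv_self (z : CotangentBundle E M) :
    chartDeriv z z = ContinuousLinearMap.id ℝ (E × (E →L[ℝ] ℝ)) :=
  mfderiv_extChartAt_self

/-- The chart transition between the preferred chart at `z` and the chart at `z₀`. -/
theorem chartDeriv_transition (z₀ z : CotangentBundle E M) {y : CotangentBundle E M}
    (hy : y ∈ (extChartAt (cotangentModel E) z₀).source)
    (hyz : y ∈ (extChartAt (cotangentModel E) z).source) :
    ContDiffAt ℝ ∞ (extChartAt (cotangentModel E) z₀ ∘ (extChartAt (cotangentModel E) z).symm)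
      (extChartAt (cotangentModel E) z y) ∧ ∀ w,
    fderiv ℝ (extChartAt (cotangentModel E) z₀ ∘ (extChartAt (cotangentModel E) z).symm)
      (extChartAt (cotangentModel E) z y) (chartDeriv z y w) = chartDeriv z₀ y w := by
  let φ := extChartAt (cotangentModel E) z
  let φ₀ := extChartAt (cotangentModel E) z₀
  have hy' : y ∈ (chartAt (ModelProd E (E →L[ℝ] ℝ)) z₀).source := by
    rwa [← extChartAt_source (cotangentModel E)]
  have hyz' : y ∈ (chartAt (ModelProd E (E →L[ℝ] ℝ)) z).source := by
    rwa [← extChartAt_source (cotangentModel E)]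
  have hsm : ContDiffAt ℝ ∞ (φ₀ ∘ φ.symm) (φ y) := by
    have h1 : ContMDiffAt 𝓘(ℝ, E × (E →L[ℝ] ℝ)) (cotangentModel E) ∞ φ.symm (φ y) :=
      (contMDiffOn_extChartAt_symm z).contMDiffAt
        ((isOpen_extChartAt_target z).mem_nhds (φ.map_source hyz))
    have h2 : ContMDiffAt (cotangentModel E) 𝓘(ℝ, E × (E →L[ℝ] ℝ)) ∞ φ₀ (φ.symm (φ y)) := by
      rw [φ.left_inv hyz]
      exact contMDiffAt_extChartAt' hy'
    exact contMDiffAt_iff_contDiffAt.1 (h2.comp (φ y) h1)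
  refine ⟨hsm, fun w ↦ ?_⟩
  have d1 := (mdifferentiableAt_extChartAt (I := cotangentModel E) hyz').hasMFDerivAt
  have d2 := (hsm.differentiableAt (by simp)).hasFDerivAt.hasMFDerivAt
  have d3 := (mdifferentiableAt_extChartAt (I := cotangentModel E) hy').hasMFDerivAt
  have c1 := HasMFDerivAt.comp y d2 d1
  have heq : φ₀ =ᶠ[𝓝 y] (φ₀ ∘ φ.symm) ∘ φ := by
    filter_upwards [(isOpen_extChartAt_source z).mem_nhds hyz] with x hx
    change φ₀ x = φ₀ (φ.symm (φ x))
    rw [φ.left_inv hx]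
  exact DFunLike.congr_fun (hasMFDerivAt_unique (c1.congr_of_eventuallyEq heq) d3) w

theorem chartDeriv_bijective [FiniteDimensional ℝ E] {z₀ z : CotangentBundle E M}
    (hz : z ∈ (extChartAt (cotangentModel E) z₀).source) :
    Function.Bijective (chartDeriv z₀ z) := by
  rw [extChartAt_source] at hz
  exact mfderiv_extChartAt_bijective (I := cotangentModel E) z₀ hz

/-- The canonical symplectic form is the standard one in every chart. -/
theorem symplecticForm_chart [FiniteDimensional ℝ E] {z₀ z : CotangentBundle E M}
    (hz : z ∈ (extChartAt (cotangentModel E) z₀).source) (X ξ : E × (E →L[ℝ] ℝ)) :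
    stdSymplectic (chartDeriv z₀ z X) (chartDeriv z₀ z ξ) = symplecticForm z X ξ := by
  let φ := extChartAt (cotangentModel E) z
  let φ₀ := extChartAt (cotangentModel E) z₀
  have hzz : z ∈ φ.source := mem_extChartAt_source z
  obtain ⟨hsm, hder⟩ := chartDeriv_transition z₀ z hz hzz
  have hder' : ∀ w, fderiv ℝ (φ₀ ∘ φ.symm) (φ z) w = chartDeriv z₀ z w := fun w ↦ by
    have := hder w
    rwa [chartDeriv_self] at this
  -- Both sides are the Liouville form at `φ.symm y`, read in two charts; hence chart transitions
  -- preserve `p dq`.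
  have hpres : ∀ᶠ y in 𝓝 (φ z), ∀ w : E × (E →L[ℝ] ℝ), (ContinuousLinearMap.id ℝ (E →L[ℝ] ℝ))
      ((φ₀ ∘ φ.symm) y).2 (fderiv ℝ (φ₀ ∘ φ.symm) y w).1 =
      (ContinuousLinearMap.id ℝ (E →L[ℝ] ℝ)) y.2 w.1 := by
    have h1 : ∀ᶠ y in 𝓝 (φ z), φ.symm y ∈ φ₀.source := by
      refine (continuousAt_extChartAt_symm z).eventually ?_
      have : φ.symm (φ z) = z := φ.left_inv hzz
      rw [this]
      exact (isOpen_extChartAt_source z₀).mem_nhds hz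
    filter_upwards [h1, extChartAt_target_mem_nhds z] with y hy hyt w
    have hys := φ.map_target hyt
    obtain ⟨v, rfl⟩ := (chartDeriv_bijective hys).2 w
    have h2 := (chartDeriv_transition z₀ z hy hys).2 v
    have h3 := liouville_chart hy v
    have h4 := liouville_chart hys v
    have h5 : φ (φ.symm y) = y := φ.right_inv hyt
    change extChartAt (cotangentModel E) z (φ.symm y) = y at h5
    rw [h5] at h2 h4
    exact (congrArg (fun u : E × (E →L[ℝ] ℝ) ↦ (φ₀ (φ.symm y)).2 u.1) h2).trans (h3.symm.trans h4)
  have h := pairing_antisymm_of_preserves (ContinuousLinearMap.id ℝ (E →L[ℝ] ℝ)) hsm hpres X ξ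
  rw [hder', hder'] at h
  exact h

end CotangentCharts

/-! ### Linear symplectic algebra of `E × E*`. -/

section LinearSymplectic

variable {E : Type*} [NormedAddCommGroup E] [NormedSpace ℝ E] [FiniteDimensional ℝ E]

theorem finrank_covector : Module.finrank ℝ (E →L[ℝ] ℝ) = Module.finrank ℝ E := by
  rw [← (LinearMap.toContinuousLinearMap (𝕜 := ℝ) (E := E) (F' := ℝ)).finrank_eq,
    Subspace.dual_finrank_eq]

theorem inclusionInDoubleDual_bijective :
    Function.Bijective (NormedSpace.inclusionInDoubleDual ℝ E) := by
  have hinj : Function.Injective (NormedSpace.inclusionInDoubleDual ℝ E) :=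
    (NormedSpace.inclusionInDoubleDualLi ℝ (E := E)).injective
  refine ⟨hinj, ?_⟩
  have hdim : Module.finrank ℝ E = Module.finrank ℝ ((E →L[ℝ] ℝ) →L[ℝ] ℝ) := by
    rw [finrank_covector, finrank_covector]
  exact (LinearMap.injective_iff_surjective_of_finrank_eq_finrank
    (f := (NormedSpace.inclusionInDoubleDual ℝ E).toLinearMap) hdim).1 hinj

variable (E) in
/-- The vector representing a linear form on covectors. -/
def bidualInv : ((E →L[ℝ] ℝ) →L[ℝ] ℝ) →L[ℝ] E :=
  LinearMap.toContinuousLinearMap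
    (LinearEquiv.ofBijective (NormedSpace.inclusionInDoubleDual ℝ E).toLinearMap
      inclusionInDoubleDual_bijective).symm.toLinearMap

theorem apply_bidualInv (α : (E →L[ℝ] ℝ) →L[ℝ] ℝ) (β : E →L[ℝ] ℝ) : β (bidualInv E α) = α β := by
  have h := (LinearEquiv.ofBijective (NormedSpace.inclusionInDoubleDual ℝ E).toLinearMap
      inclusionInDoubleDual_bijective).apply_symm_apply α
  exact DFunLike.congr_fun h β

variable (E) in
/-- The Hamiltonian vector `(∂_p α, - ∂_q α)` of a linear form `α`. -/
def hamLift : (E × (E →L[ℝ] ℝ) →L[ℝ] ℝ) →L[ℝ] E × (E →L[ℝ] ℝ) :=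
  ((bidualInv E).comp
    ((ContinuousLinearMap.compL ℝ (E →L[ℝ] ℝ) (E × (E →L[ℝ] ℝ)) ℝ).flip
      (ContinuousLinearMap.inr ℝ E (E →L[ℝ] ℝ)))).prod
    (-((ContinuousLinearMap.compL ℝ E (E × (E →L[ℝ] ℝ)) ℝ).flip
      (ContinuousLinearMap.inl ℝ E (E →L[ℝ] ℝ))))

theorem hamLift_fst (α : E × (E →L[ℝ] ℝ) →L[ℝ] ℝ) (β : E →L[ℝ] ℝ) :
    β (hamLift E α).1 = α (0, β) :=
  apply_bidualInv _ β

theorem hamLift_snd (α : E × (E →L[ℝ] ℝ) →L[ℝ] ℝ) (v : E) :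
    (hamLift E α).2 v = -α (v, 0) := rfl

theorem stdSymplectic_hamLift (α : E × (E →L[ℝ] ℝ) →L[ℝ] ℝ) (b : E × (E →L[ℝ] ℝ)) :
    stdSymplectic (hamLift E α) b = α b := by
  unfold stdSymplectic
  rw [hamLift_fst, hamLift_snd, sub_neg_eq_add, ← map_add]
  simp

/-- Nondegeneracy: purely vertical and purely horizontal test vectors recover the two components. -/
theorem stdSymplectic_injective {a a' : E × (E →L[ℝ] ℝ)}
    (h : ∀ b, stdSymplectic a b = stdSymplectic a' b) : a = a' := by
  have h1 : ∀ β : E →L[ℝ] ℝ, β a.1 = β a'.1 := fun β ↦ by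
    simpa [stdSymplectic] using h (0, β)
  have h2 : ∀ v : E, a.2 v = a'.2 v := fun v ↦ by
    simpa [stdSymplectic] using h (v, 0)
  refine Prod.ext ?_ (ContinuousLinearMap.ext h2)
  exact inclusionInDoubleDual_bijective.1 (ContinuousLinearMap.ext h1)

end LinearSymplectic

/-! ### The variation of the action in coordinates. -/

section ExactnessCalculus

theorem hasDerivAt_fderiv_comp {D V : Type*} [NormedAddCommGroup D] [NormedSpace ℝ D]
    [NormedAddCommGroup V] [NormedSpace ℝ V] {f : D → V} {c : ℝ → D} {c' : D} {t : ℝ}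
    (hf : ContDiffAt ℝ ∞ f (c t)) (hc : HasDerivAt c c' t) (w : D) :
    HasDerivAt (fun t ↦ fderiv ℝ f (c t) w) (fderiv ℝ (fderiv ℝ f) (c t) c' w) t := by
  have h1 : HasFDerivAt (fderiv ℝ f) (fderiv ℝ (fderiv ℝ f) (c t)) (c t) :=
    ((hf.fderiv_right (m := ∞) (by simp)).differentiableAt (by simp)).hasFDerivAt
  have h2 : HasDerivAt (fun t ↦ fderiv ℝ f (c t)) (fderiv ℝ (fderiv ℝ f) (c t) c') t :=
    h1.comp_hasDerivAt t hc
  refine (h2.clm_apply (hasDerivAt_const t w)).congr_deriv ?_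
  rw [map_zero, add_zero]

theorem fderiv_fderiv_comm {D V : Type*} [NormedAddCommGroup D] [NormedSpace ℝ D]
    [NormedAddCommGroup V] [NormedSpace ℝ V] {f : D → V} {x : D} (hf : ContDiffAt ℝ ∞ f x)
    (v w : D) : fderiv ℝ (fderiv ℝ f) x v w = fderiv ℝ (fderiv ℝ f) x w v :=
  hf.isSymmSndFDerivAt (by
    rw [minSmoothness_of_isRCLikeNormedField]
    exact WithTop.coe_le_coe.2 (le_top : (2 : ℕ∞) ≤ ⊤)) v w

theorem hasDerivAt_pairing {A P : Type*} [NormedAddCommGroup A] [NormedSpace ℝ A]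
    [NormedAddCommGroup P] [NormedSpace ℝ P] (B : P →L[ℝ] A →L[ℝ] ℝ) {p : ℝ → P} {p' : P}
    {a : ℝ → A} {a' : A} {t : ℝ} (hp : HasDerivAt p p' t) (ha : HasDerivAt a a' t) :
    HasDerivAt (fun t ↦ B (p t) (a t)) (B p' (a t) + B (p t) a') t := by
  have h1 : HasDerivAt (fun t ↦ B (p t)) (B p') t := B.hasFDerivAt.comp_hasDerivAt t hp
  exact h1.clm_apply ha

/-- Pointwise computation behind the exactness of Hamiltonian flows: `(q, p)` is a family of
Hamiltonian curves `r ↦ (q (r, σ), p (r, σ))` with energies `κ` and actions `S`. -/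
theorem hasDerivAt_action_form {A P : Type*} [NormedAddCommGroup A] [NormedSpace ℝ A]
    [NormedAddCommGroup P] [NormedSpace ℝ P] (B : P →L[ℝ] A →L[ℝ] ℝ) {q : ℝ × ℝ → A}
    {p : ℝ × ℝ → P} {S : ℝ × ℝ → ℝ} {κ : ℝ → ℝ} {r₀ : ℝ} (hq : ContDiffAt ℝ ∞ q (r₀, 0))
    (hp : ContDiffAt ℝ ∞ p (r₀, 0)) (hS : ContDiffAt ℝ ∞ S (r₀, 0))
    (hSr : ∀ᶠ σ in 𝓝 (0 : ℝ), fderiv ℝ S (r₀, σ) (1, 0) =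
      B (p (r₀, σ)) (fderiv ℝ q (r₀, σ) (1, 0)) - κ σ)
    (hκ : HasDerivAt κ (B (fderiv ℝ p (r₀, 0) (0, 1)) (fderiv ℝ q (r₀, 0) (1, 0)) -
      B (fderiv ℝ p (r₀, 0) (1, 0)) (fderiv ℝ q (r₀, 0) (0, 1))) 0) :
    HasDerivAt (fun r ↦ B (p (r, 0)) (fderiv ℝ q (r, 0) (0, 1)) - fderiv ℝ S (r, 0) (0, 1))
      0 r₀ := by
  have dp : HasFDerivAt p (fderiv ℝ p (r₀, 0)) (r₀, 0) :=
    (hp.differentiableAt (by simp)).hasFDerivAt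
  have cr : HasDerivAt (fun r : ℝ ↦ ((r, 0) : ℝ × ℝ)) (1, 0) r₀ :=
    (hasDerivAt_id r₀).prodMk (hasDerivAt_const _ _)
  have cσ : HasDerivAt (fun σ : ℝ ↦ ((r₀, σ) : ℝ × ℝ)) (0, 1) 0 :=
    (hasDerivAt_const _ _).prodMk (hasDerivAt_id 0)
  have e1 : HasDerivAt (fun r ↦ p (r, 0)) (fderiv ℝ p (r₀, 0) (1, 0)) r₀ :=
    dp.comp_hasDerivAt r₀ cr
  have e2 := hasDerivAt_fderiv_comp (c := fun r : ℝ ↦ ((r, 0) : ℝ × ℝ)) hq cr (0, 1)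
  have e3 := hasDerivAt_fderiv_comp (c := fun r : ℝ ↦ ((r, 0) : ℝ × ℝ)) hS cr (0, 1)
  have f1 : HasDerivAt (fun σ ↦ p (r₀, σ)) (fderiv ℝ p (r₀, 0) (0, 1)) 0 :=
    HasFDerivAt.comp_hasDerivAt (f := fun σ : ℝ ↦ ((r₀, σ) : ℝ × ℝ)) 0 dp cσ
  have f2 := hasDerivAt_fderiv_comp (c := fun σ : ℝ ↦ ((r₀, σ) : ℝ × ℝ)) hq cσ (1, 0)
  have f3 := hasDerivAt_fderiv_comp (c := fun σ : ℝ ↦ ((r₀, σ) : ℝ × ℝ)) hS cσ (1, 0)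
  -- Differentiating `∂ᵣS = p ∂ᵣq - κ` in `σ` and inserting `κ' = ∂σp ∂ᵣq - ∂ᵣp ∂σq` leaves `∂σ∂ᵣS =
  -- p ∂σ∂ᵣq + ∂ᵣp ∂σq`. This is `∂ᵣ(p ∂σq)` once mixed derivatives are exchanged.
  have g1 := (hasDerivAt_pairing B f1 f2).sub hκ
  have g2 := f3.unique (g1.congr_of_eventuallyEq hSr)
  refine ((hasDerivAt_pairing B e1 e2).sub e3).congr_deriv ?_
  rw [fderiv_fderiv_comm hq (1, 0) (0, 1), fderiv_fderiv_comm hS (1, 0) (0, 1), g2]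
  ring

end ExactnessCalculus

/-! ### Hamiltonian vector fields. -/

section HamiltonianField

variable {E : Type*} [NormedAddCommGroup E] [NormedSpace ℝ E] [FiniteDimensional ℝ E]
  {M : Type*} [TopologicalSpace M] [ChartedSpace E M] [IsManifold 𝓘(ℝ, E) ∞ M]

/-- The differential of a function on `T*M`. -/
def cotangentDiff (H : CotangentBundle E M → ℝ) (z : CotangentBundle E M) :
    E × (E →L[ℝ] ℝ) →L[ℝ] ℝ :=
  mfderiv (cotangentModel E) 𝓘(ℝ, ℝ) H z

/-- The Hamiltonian vector field of a function on `T*M`. -/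
def hamField (H : CotangentBundle E M → ℝ) (z : CotangentBundle E M) : E × (E →L[ℝ] ℝ) :=
  hamLift E (cotangentDiff H z)

theorem symplecticForm_eq_iff (H : CotangentBundle E M → ℝ) (z : CotangentBundle E M)
    (X : E × (E →L[ℝ] ℝ)) :
    (∀ ξ : CotangentTangent z, symplecticForm z X ξ =
      mfderiv (cotangentModel E) 𝓘(ℝ, ℝ) H z ξ) ↔ X = hamField H z := by
  constructor
  · intro h
    exact stdSymplectic_injective fun b ↦ (h b).trans (stdSymplectic_hamLift _ b).symm
  · rintro rfl ξ
    exact stdSymplectic_hamLift (cotangentDiff H z) ξ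

/-- By nondegeneracy the velocity in the definition is forced to be `hamField`, so Hamilton's
equations become an ordinary differential equation. -/
theorem isHamiltonianCurveOn_iff {H : ℝ → CotangentBundle E M → ℝ} {γ : ℝ → CotangentBundle E M}
    {s : Set ℝ} : IsHamiltonianCurveOn H γ s ↔ ∀ t ∈ s, HasMFDerivWithinAt 𝓘(ℝ, ℝ)
      (cotangentModel E) γ s t ((1 : ℝ →L[ℝ] ℝ).smulRight (hamField (H t) (γ t))) := by
  refine forall₂_congr fun t _ ↦ ⟨?_, fun h ↦ ⟨_, h, (symplecticForm_eq_iff _ _ _).2 rfl⟩⟩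
  rintro ⟨X, h1, h2⟩
  rw [← (symplecticForm_eq_iff (H t) (γ t) X).1 h2]
  exact h1

theorem cotangentDiff_chart {H : CotangentBundle E M → ℝ} {z₀ z : CotangentBundle E M}
    (hH : MDifferentiableAt (cotangentModel E) 𝓘(ℝ, ℝ) H z)
    (hz : z ∈ (extChartAt (cotangentModel E) z₀).source) (ξ : E × (E →L[ℝ] ℝ)) :
    fderiv ℝ (H ∘ (extChartAt (cotangentModel E) z₀).symm) (extChartAt (cotangentModel E) z₀ z)
      (chartDeriv z₀ z ξ) = cotangentDiff H z ξ := by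
  let φ := extChartAt (cotangentModel E) z₀
  have hz' : z ∈ (chartAt (ModelProd E (E →L[ℝ] ℝ)) z₀).source := by
    rwa [← extChartAt_source (cotangentModel E)]
  have h1 : MDifferentiableAt 𝓘(ℝ, E × (E →L[ℝ] ℝ)) 𝓘(ℝ, ℝ) (H ∘ φ.symm) (φ z) := by
    refine MDifferentiableAt.comp (φ z) ?_
      (hasMFDerivAt_extChartAt_symm (I := cotangentModel E) z₀
        (φ.map_source hz)).1.mdifferentiableAt
    rw [φ.left_inv hz]; exact hH
  have d1 := (mdifferentiableAt_extChartAt (I := cotangentModel E) hz').hasMFDerivAt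
  have d2 := (mdifferentiableAt_iff_differentiableAt.1 h1).hasFDerivAt.hasMFDerivAt
  have c1 := HasMFDerivAt.comp z d2 d1
  have heq : H =ᶠ[𝓝 z] (H ∘ φ.symm) ∘ φ := by
    filter_upwards [(isOpen_extChartAt_source z₀).mem_nhds hz] with x hx
    change H x = H (φ.symm (φ x))
    rw [φ.left_inv hx]
  exact DFunLike.congr_fun (hasMFDerivAt_unique (c1.congr_of_eventuallyEq heq) hH.hasMFDerivAt) ξ

/-- Since the symplectic form is standard in every chart, Hamilton's equations keep their form in a
fixed chart near a point; smoothness of the field is read off from this. -/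
theorem hamField_chart {H : CotangentBundle E M → ℝ} {z₀ z : CotangentBundle E M}
    (hH : MDifferentiableAt (cotangentModel E) 𝓘(ℝ, ℝ) H z)
    (hz : z ∈ (extChartAt (cotangentModel E) z₀).source) :
    chartDeriv z₀ z (hamField H z) = hamLift E (fderiv ℝ
      (H ∘ (extChartAt (cotangentModel E) z₀).symm) (extChartAt (cotangentModel E) z₀ z)) := by
  refine stdSymplectic_injective fun b ↦ ?_
  obtain ⟨ξ, rfl⟩ := (chartDeriv_bijective hz).2 b
  rw [symplecticForm_chart hz, stdSymplectic_hamLift, cotangentDiff_chart hH hz]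
  exact stdSymplectic_hamLift _ ξ

end HamiltonianField

/-! ### Time-dependent Hamiltonians as autonomous fields on `ℝ × T*M`. -/

section SuspendedField

variable {E : Type*} [NormedAddCommGroup E] [NormedSpace ℝ E] [FiniteDimensional ℝ E]
  {M : Type*} [TopologicalSpace M] [ChartedSpace E M] [IsManifold 𝓘(ℝ, E) ∞ M]

variable (E) in
/-- The model of `ℝ × T*M`. -/
abbrev suspModel : ModelWithCorners ℝ (ℝ × (E × (E →L[ℝ] ℝ)))
    (ModelProd ℝ (ModelProd E (E →L[ℝ] ℝ))) :=
  𝓘(ℝ, ℝ).prod (cotangentModel E)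

/-- The autonomous vector field on `ℝ × T*M` of a time-dependent Hamiltonian. -/
def suspField (K : ℝ → CotangentBundle E M → ℝ) (p : ℝ × CotangentBundle E M) :
    ℝ × (E × (E →L[ℝ] ℝ)) :=
  (1, hamField (K p.1) p.2)

/-- Smoothness of a time-dependent Hamiltonian. -/
def SmoothHamiltonian (K : ℝ → CotangentBundle E M → ℝ) : Prop :=
  ContMDiff (suspModel E) 𝓘(ℝ, ℝ) ∞ (fun p : ℝ × CotangentBundle E M ↦ K p.1 p.2)

variable {K : ℝ → CotangentBundle E M → ℝ}

theorem SmoothHamiltonian.contMDiff (hK : SmoothHamiltonian K) (t : ℝ) :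
    ContMDiff (cotangentModel E) 𝓘(ℝ, ℝ) ∞ (K t) :=
  hK.comp (contMDiff_const.prodMk contMDiff_id)

theorem SmoothHamiltonian.mdifferentiableAt (hK : SmoothHamiltonian K) (t : ℝ)
    (z : CotangentBundle E M) : MDifferentiableAt (cotangentModel E) 𝓘(ℝ, ℝ) (K t) z :=
  (hK.contMDiff t).mdifferentiable (by simp) z

/-- In the chart at `z₀` the field is a fixed linear map applied to the spatial differential of a
function smooth jointly in time and position. -/
theorem SmoothHamiltonian.contMDiffAt_hamField (hK : SmoothHamiltonian K) (t₀ : ℝ)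
    (z₀ : CotangentBundle E M) : ContMDiffAt (suspModel E) 𝓘(ℝ, E × (E →L[ℝ] ℝ)) ∞
      (fun p : ℝ × CotangentBundle E M ↦ chartDeriv z₀ p.2 (hamField (K p.1) p.2)) (t₀, z₀) := by
  let φ := extChartAt (cotangentModel E) z₀
  let k : ℝ × (E × (E →L[ℝ] ℝ)) → ℝ := fun p ↦ K p.1 (φ.symm p.2)
  have hφt : φ z₀ ∈ φ.target := mem_extChartAt_target z₀
  have hk : ∀ t, ∀ y ∈ φ.target, ContDiffAt ℝ ∞ k (t, y) := by
    intro t y hy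
    have h1 : ContMDiffAt 𝓘(ℝ, E × (E →L[ℝ] ℝ)) (cotangentModel E) ∞ φ.symm y :=
      (contMDiffOn_extChartAt_symm z₀).contMDiffAt ((isOpen_extChartAt_target z₀).mem_nhds hy)
    have h2 : ContMDiffAt 𝓘(ℝ, ℝ × (E × (E →L[ℝ] ℝ))) (suspModel E) ∞
        (fun p : ℝ × (E × (E →L[ℝ] ℝ)) ↦ (p.1, φ.symm p.2)) (t, y) := by
      refine ContMDiffAt.prodMk (contDiff_fst.contMDiff _) ?_
      exact ContMDiffAt.comp (t, y) (g := φ.symm) (f := Prod.snd) h1 (contDiff_snd.contMDiff _)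
    exact contMDiffAt_iff_contDiffAt.1 (ContMDiffAt.comp (t, y)
      (g := fun p : ℝ × CotangentBundle E M ↦ K p.1 p.2) (hK _) h2)
  have h3 : ContDiffAt ℝ ∞ (fun p : ℝ × (E × (E →L[ℝ] ℝ)) ↦ hamLift E ((fderiv ℝ k p).comp
      (ContinuousLinearMap.inr ℝ ℝ (E × (E →L[ℝ] ℝ))))) (t₀, φ z₀) := by
    have h4 : ContDiffAt ℝ ∞ (fderiv ℝ k) (t₀, φ z₀) := (hk t₀ _ hφt).fderiv_right (by simp)
    exact (hamLift E).contDiff.contDiffAt.comp _ (h4.clm_comp contDiffAt_const)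
  have h5 : ContMDiffAt (suspModel E) 𝓘(ℝ, ℝ × (E × (E →L[ℝ] ℝ))) ∞
      (fun p : ℝ × CotangentBundle E M ↦ ((p.1, φ p.2) : ℝ × (E × (E →L[ℝ] ℝ)))) (t₀, z₀) :=
    contMDiffAt_fst.prodMk_space (ContMDiffAt.comp (t₀, z₀) (g := φ) contMDiffAt_extChartAt
      contMDiffAt_snd)
  have h6 := ContMDiffAt.comp (t₀, z₀) h3.contMDiffAt h5
  refine h6.congr_of_eventuallyEq ?_
  have ev : ∀ᶠ p : ℝ × CotangentBundle E M in 𝓝 (t₀, z₀), p.2 ∈ φ.source :=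
    continuousAt_snd.eventually (extChartAt_source_mem_nhds z₀)
  filter_upwards [ev] with p hp
  rw [hamField_chart (hK.mdifferentiableAt p.1 p.2) hp]
  have h7 : HasFDerivAt (K p.1 ∘ φ.symm) ((fderiv ℝ k (p.1, φ p.2)).comp
      (ContinuousLinearMap.inr ℝ ℝ (E × (E →L[ℝ] ℝ)))) (φ p.2) :=
    (((hk p.1 (φ p.2) (φ.map_source hp)).differentiableAt (by simp)).hasFDerivAt).comp (φ p.2)
      (hasFDerivAt_prodMk_right p.1 (φ p.2))
  rw [h7.fderiv]
  rfl

theorem SmoothHamiltonian.smoothField (hK : SmoothHamiltonian K) :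
    SmoothField (suspModel E) (suspField K) := by
  refine smoothField_prod (I := 𝓘(ℝ, ℝ)) (X := ℝ) (I' := cotangentModel E)
    (Y := CotangentBundle E M) (w := suspField K) (fun t₀ z₀ ↦ ?_) (fun t₀ z₀ ↦ ?_)
  · have h : ContMDiffAt (suspModel E) 𝓘(ℝ, ℝ) ∞ (fun _ : ℝ × CotangentBundle E M ↦ (1 : ℝ))
        (t₀, z₀) := contMDiffAt_const
    refine h.congr_of_eventuallyEq (Filter.Eventually.of_forall fun p ↦ ?_)
    exact DFunLike.congr_fun (mfderiv_extChartAt_self_space t₀ p.1) (1 : ℝ)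
  · exact hK.contMDiffAt_hamField t₀ z₀

/-- The Lagrangian `p q' - K` of a time-dependent Hamiltonian, as a function on `ℝ × T*M`. -/
def lagrangian (K : ℝ → CotangentBundle E M → ℝ) (p : ℝ × CotangentBundle E M) : ℝ :=
  liouville p.2 (hamField (K p.1) p.2) - K p.1 p.2

theorem SmoothHamiltonian.contMDiff_lagrangian (hK : SmoothHamiltonian K) :
    ContMDiff (suspModel E) 𝓘(ℝ, ℝ) ∞ (lagrangian K) := by
  rintro ⟨t₀, z₀⟩
  let φ := extChartAt (cotangentModel E) z₀
  have h1 : ContMDiffAt (suspModel E) 𝓘(ℝ, E × (E →L[ℝ] ℝ)) ∞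
      (fun p : ℝ × CotangentBundle E M ↦ φ p.2) (t₀, z₀) :=
    ContMDiffAt.comp (t₀, z₀) (g := φ) contMDiffAt_extChartAt contMDiffAt_snd
  have h2 : ContMDiffAt (suspModel E) 𝓘(ℝ, ℝ) ∞ (fun p : ℝ × CotangentBundle E M ↦
      (φ p.2).2 (chartDeriv z₀ p.2 (hamField (K p.1) p.2)).1) (t₀, z₀) :=
    (contDiff_snd.contMDiff.contMDiffAt.comp _ h1).clm_apply
      (contDiff_fst.contMDiff.contMDiffAt.comp _ (hK.contMDiffAt_hamField t₀ z₀))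
  refine (h2.sub (hK (t₀, z₀))).congr_of_eventuallyEq ?_
  have ev : ∀ᶠ p : ℝ × CotangentBundle E M in 𝓝 (t₀, z₀), p.2 ∈ φ.source :=
    continuousAt_snd.eventually (extChartAt_source_mem_nhds z₀)
  filter_upwards [ev] with p hp
  unfold lagrangian
  rw [liouville_chart hp]

variable [T2Space M] {Φ : ℝ → ℝ × CotangentBundle E M → ℝ × CotangentBundle E M}

theorem suspFlow_fst (hΦ : IsFlow (suspModel E) (suspField K) Φ) (r : ℝ)
    (p : ℝ × CotangentBundle E M) : (Φ r p).1 = p.1 + r := by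
  have h : ∀ t, HasDerivAt (fun t ↦ (Φ t p).1 - t) 0 t := by
    intro t
    have h1 := hΦ.curve p t
    have h2 : HasMFDerivAt (suspModel E) 𝓘(ℝ, ℝ) (Prod.fst : ℝ × CotangentBundle E M → ℝ) (Φ t p)
      (ContinuousLinearMap.fst ℝ ℝ (E × (E →L[ℝ] ℝ))) := hasMFDerivAt_fst (Φ t p)
    have h3 := (HasMFDerivAt.comp t h2 h1).hasFDerivAt
    have h4 : HasDerivAt (fun t ↦ (Φ t p).1) 1 t := by
      rw [hasDerivAt_iff_hasFDerivAt]
      refine h3.congr_fderiv (ContinuousLinearMap.ext_ring ?_)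
      change ((1 : ℝ) • (1 : ℝ)) = (1 : ℝ) • (1 : ℝ)
      rfl
    exact (h4.sub (hasDerivAt_id t)).congr_deriv (sub_self 1)
  have h5 := is_const_of_deriv_eq_zero (fun t ↦ (h t).differentiableAt) (fun t ↦ (h t).deriv) r 0
  simp only [hΦ.zero, sub_zero] at h5
  linarith

theorem suspFlow_snd_hasMFDerivAt (hΦ : IsFlow (suspModel E) (suspField K) Φ)
    (p : ℝ × CotangentBundle E M) (r : ℝ) :
    HasMFDerivAt 𝓘(ℝ, ℝ) (cotangentModel E) (fun r ↦ (Φ r p).2) r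
      ((1 : ℝ →L[ℝ] ℝ).smulRight (hamField (K (p.1 + r)) (Φ r p).2)) := by
  have h1 := hΦ.curve p r
  have h2 : HasMFDerivAt (suspModel E) (cotangentModel E)
      (Prod.snd : ℝ × CotangentBundle E M → CotangentBundle E M) (Φ r p)
      (ContinuousLinearMap.snd ℝ ℝ (E × (E →L[ℝ] ℝ))) := hasMFDerivAt_snd (Φ r p)
  refine (HasMFDerivAt.comp r h2 h1).congr_mfderiv (ContinuousLinearMap.ext_ring ?_)
  rw [← suspFlow_fst hΦ]
  rfl

theorem contMDiff_suspFlow_snd (hK : SmoothHamiltonian K)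
    (hΦ : IsFlow (suspModel E) (suspField K) Φ) :
    ContMDiff (𝓘(ℝ, ℝ).prod (suspModel E)) (cotangentModel E) ∞
      (fun p : ℝ × (ℝ × CotangentBundle E M) ↦ (Φ p.1 p.2).2) :=
  contMDiff_snd.comp (hΦ.contMDiff hK.smoothField)

end SuspendedField

/-! ### Hamiltonian flows are exact symplectic. -/

section Exactness

variable {E : Type*} [NormedAddCommGroup E] [NormedSpace ℝ E] [FiniteDimensional ℝ E]
  {M : Type*} [TopologicalSpace M] [ChartedSpace E M] [IsManifold 𝓘(ℝ, E) ∞ M]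

/-- Realizes a tangent vector by a curve, so that exactness can be tested on two-parameter families
`(r, σ)` of points. -/
theorem exists_curve_with_velocity (z : CotangentBundle E M) (ξ : E × (E →L[ℝ] ℝ)) :
    ∃ c : ℝ → CotangentBundle E M, c 0 = z ∧ ContMDiffAt 𝓘(ℝ, ℝ) (cotangentModel E) ∞ c 0 ∧
      HasMFDerivAt 𝓘(ℝ, ℝ) (cotangentModel E) c 0 ((1 : ℝ →L[ℝ] ℝ).smulRight ξ) := by
  let φ := extChartAt (cotangentModel E) z
  let l : ℝ → E × (E →L[ℝ] ℝ) := fun σ ↦ φ z + σ • ξ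
  have hl : ContDiff ℝ ∞ l := contDiff_const.add (contDiff_id.smul contDiff_const)
  have hl0 : l 0 = φ z := by simp [l]
  have hl' : HasDerivAt l ξ 0 := by
    simpa [l] using ((hasDerivAt_id (0 : ℝ)).smul_const ξ).const_add (φ z)
  have ht : φ z ∈ φ.target := mem_extChartAt_target z
  have hs : φ.symm (φ z) = z := φ.left_inv (mem_extChartAt_source z)
  have h1 : ContMDiffAt 𝓘(ℝ, E × (E →L[ℝ] ℝ)) (cotangentModel E) ∞ φ.symm (l 0) := by
    rw [hl0]
    exact (contMDiffOn_extChartAt_symm z).contMDiffAt ((isOpen_extChartAt_target z).mem_nhds ht)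
  refine ⟨φ.symm ∘ l, by rw [Function.comp_apply, hl0, hs],
    h1.comp (0 : ℝ) hl.contMDiff.contMDiffAt, ?_⟩
  obtain ⟨d1, d2⟩ := hasMFDerivAt_extChartAt_symm (I := cotangentModel E) z ht
  rw [← hl0] at d1
  refine (HasMFDerivAt.comp (0 : ℝ) d1 hl'.hasFDerivAt.hasMFDerivAt).congr_mfderiv
    (ContinuousLinearMap.ext_ring ?_)
  have d3 : (mfderiv 𝓘(ℝ, E × (E →L[ℝ] ℝ)) (cotangentModel E) φ.symm (φ z) :
      E × (E →L[ℝ] ℝ) →L[ℝ] E × (E →L[ℝ] ℝ)) ξ = ξ := by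
    have h2 := d2 ξ
    have h3 : (mfderiv (cotangentModel E) 𝓘(ℝ, E × (E →L[ℝ] ℝ)) φ (φ.symm (φ z)) :
        E × (E →L[ℝ] ℝ) →L[ℝ] E × (E →L[ℝ] ℝ)) ξ = ξ := by
      rw [hs]
      exact DFunLike.congr_fun (chartDeriv_self z) ξ
    exact (congrArg _ h3).symm.trans h2
  have d4 : (mfderiv 𝓘(ℝ, E × (E →L[ℝ] ℝ)) (cotangentModel E) φ.symm (l 0) :
      E × (E →L[ℝ] ℝ) →L[ℝ] E × (E →L[ℝ] ℝ)) ((1 : ℝ) • ξ) = (1 : ℝ) • ξ := by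
    rw [hl0, one_smul]
    exact d3
  exact d4

theorem hasDerivAt_chart_comp {z₀ : CotangentBundle E M} {α : ℝ → CotangentBundle E M} {t : ℝ}
    {X : E × (E →L[ℝ] ℝ)} (hz : α t ∈ (extChartAt (cotangentModel E) z₀).source)
    (hα : HasMFDerivAt 𝓘(ℝ, ℝ) (cotangentModel E) α t ((1 : ℝ →L[ℝ] ℝ).smulRight X)) :
    HasDerivAt (fun t ↦ extChartAt (cotangentModel E) z₀ (α t)) (chartDeriv z₀ (α t) X) t := by
  rw [extChartAt_source] at hz
  have d1 := (mdifferentiableAt_extChartAt (I := cotangentModel E) hz).hasMFDerivAt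
  have h := (HasMFDerivAt.comp t d1 hα).hasFDerivAt
  rw [hasDerivAt_iff_hasFDerivAt]
  refine h.congr_fderiv (ContinuousLinearMap.ext_ring ?_)
  have h2 : chartDeriv z₀ (α t) ((1 : ℝ) • X) = (1 : ℝ) • chartDeriv z₀ (α t) X := map_smul _ _ _
  exact h2

theorem hasDerivAt_comp_of_hasMFDerivAt {f : CotangentBundle E M → ℝ} {α : ℝ → CotangentBundle E M}
    {t : ℝ} {X : E × (E →L[ℝ] ℝ)} (hf : MDifferentiableAt (cotangentModel E) 𝓘(ℝ, ℝ) f (α t))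
    (hα : HasMFDerivAt 𝓘(ℝ, ℝ) (cotangentModel E) α t ((1 : ℝ →L[ℝ] ℝ).smulRight X)) :
    HasDerivAt (fun t ↦ f (α t)) (cotangentDiff f (α t) X) t := by
  have h := (HasMFDerivAt.comp t hf.hasMFDerivAt hα).hasFDerivAt
  rw [hasDerivAt_iff_hasFDerivAt]
  refine h.congr_fderiv (ContinuousLinearMap.ext_ring ?_)
  have h2 : cotangentDiff f (α t) ((1 : ℝ) • X) = (1 : ℝ) • cotangentDiff f (α t) X :=
    map_smul _ _ _
  exact h2

variable [T2Space M] {K : ℝ → CotangentBundle E M → ℝ}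
  {Φ : ℝ → ℝ × CotangentBundle E M → ℝ × CotangentBundle E M}

/-- The action of the flow lines of a time-dependent Hamiltonian. -/
def actionIntegral (K : ℝ → CotangentBundle E M → ℝ)
    (Φ : ℝ → ℝ × CotangentBundle E M → ℝ × CotangentBundle E M) (s r : ℝ)
    (z : CotangentBundle E M) : ℝ :=
  ∫ r' in (0 : ℝ)..r, lagrangian K (Φ r' (s, z))

theorem contMDiff_actionIntegral (hK : SmoothHamiltonian K)
    (hΦ : IsFlow (suspModel E) (suspField K) Φ) (s : ℝ) :
    ContMDiff (suspModel E) 𝓘(ℝ, ℝ) ∞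
      (fun p : ℝ × CotangentBundle E M ↦ actionIntegral K Φ s p.1 p.2) :=
  (hΦ.contMDiff_integral hK.smoothField hK.contMDiff_lagrangian).comp
    (contMDiff_fst.prodMk (contMDiff_const.prodMk contMDiff_snd))

/-- The derivative of a map between cotangent bundles. -/
def cotangentMapDeriv (f : CotangentBundle E M → CotangentBundle E M) (z : CotangentBundle E M) :
    E × (E →L[ℝ] ℝ) →L[ℝ] E × (E →L[ℝ] ℝ) :=
  mfderiv (cotangentModel E) (cotangentModel E) f z

theorem hasMFDerivAt_comp_curve {f : CotangentBundle E M → CotangentBundle E M}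
    {α : ℝ → CotangentBundle E M} {t : ℝ} {X : E × (E →L[ℝ] ℝ)}
    (hf : MDifferentiableAt (cotangentModel E) (cotangentModel E) f (α t))
    (hα : HasMFDerivAt 𝓘(ℝ, ℝ) (cotangentModel E) α t ((1 : ℝ →L[ℝ] ℝ).smulRight X)) :
    HasMFDerivAt 𝓘(ℝ, ℝ) (cotangentModel E) (fun t ↦ f (α t)) t
      ((1 : ℝ →L[ℝ] ℝ).smulRight (cotangentMapDeriv f (α t) X)) := by
  refine (HasMFDerivAt.comp t hf.hasMFDerivAt hα).congr_mfderiv (ContinuousLinearMap.ext_ring ?_)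
  have h2 : cotangentMapDeriv f (α t) ((1 : ℝ) • X) = (1 : ℝ) • cotangentMapDeriv f (α t) X :=
    map_smul _ _ _
  exact h2

theorem contMDiffAt_real_prod {F : Type*} [NormedAddCommGroup F] [NormedSpace ℝ F]
    {H : Type*} [TopologicalSpace H] {I : ModelWithCorners ℝ F H}
    {X : Type*} [TopologicalSpace X] [ChartedSpace H X] {f : ℝ × ℝ → X} {p : ℝ × ℝ} :
    ContMDiffAt (𝓘(ℝ, ℝ).prod 𝓘(ℝ, ℝ)) I ∞ f p ↔ ContMDiffAt 𝓘(ℝ, ℝ × ℝ) I ∞ f p := by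
  rw [← modelWithCornersSelf_prod, chartedSpaceSelf_prod]

/-- The partial maps of a two-parameter family in a chart. -/
theorem fderiv_partial {V : Type*} [NormedAddCommGroup V] [NormedSpace ℝ V] {u : ℝ × ℝ → V}
    {r σ : ℝ} (hu : DifferentiableAt ℝ u (r, σ)) :
    (∀ {v : V}, HasDerivAt (fun r ↦ u (r, σ)) v r → fderiv ℝ u (r, σ) (1, 0) = v) ∧
    (∀ {v : V}, HasDerivAt (fun σ ↦ u (r, σ)) v σ → fderiv ℝ u (r, σ) (0, 1) = v) := by
  have cr : HasDerivAt (fun r : ℝ ↦ ((r, σ) : ℝ × ℝ)) (1, 0) r :=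
    (hasDerivAt_id r).prodMk (hasDerivAt_const _ _)
  have cσ : HasDerivAt (fun σ : ℝ ↦ ((r, σ) : ℝ × ℝ)) (0, 1) σ :=
    (hasDerivAt_const _ _).prodMk (hasDerivAt_id σ)
  exact ⟨fun h ↦ (hu.hasFDerivAt.comp_hasDerivAt r cr).unique h,
    fun h ↦ (HasFDerivAt.comp_hasDerivAt (f := fun σ : ℝ ↦ ((r, σ) : ℝ × ℝ)) σ
      hu.hasFDerivAt cσ).unique h⟩

set_option maxHeartbeats 1000000 in
/-- Flows of time-dependent Hamiltonians are exact symplectic. -/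
theorem suspFlow_exact (hK : SmoothHamiltonian K) (hΦ : IsFlow (suspModel E) (suspField K) Φ)
    (s r : ℝ) (z : CotangentBundle E M) (ξ : E × (E →L[ℝ] ℝ)) :
    liouville (Φ r (s, z)).2 (cotangentMapDeriv (fun z ↦ (Φ r (s, z)).2) z ξ) - liouville z ξ =
      cotangentDiff (actionIntegral K Φ s r) z ξ := by
  obtain ⟨c, hc0, hc, hc'⟩ := exists_curve_with_velocity z ξ
  have hZ : ∀ r, ContMDiff (cotangentModel E) (cotangentModel E) ∞
      (fun z : CotangentBundle E M ↦ (Φ r (s, z)).2) := fun r ↦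
    (contMDiff_suspFlow_snd hK hΦ).comp
      (contMDiff_const.prodMk (contMDiff_const.prodMk contMDiff_id))
  have hS : ∀ r, ContMDiff (cotangentModel E) 𝓘(ℝ, ℝ) ∞ (actionIntegral K Φ s r) := fun r ↦
    (contMDiff_actionIntegral hK hΦ s).comp (contMDiff_const.prodMk contMDiff_id)
  let A : ℝ × ℝ → CotangentBundle E M := fun p ↦ (Φ p.1 (s, c p.2)).2
  let S : ℝ × ℝ → ℝ := fun p ↦ actionIntegral K Φ s p.1 (c p.2)
  let Y : ℝ → E × (E →L[ℝ] ℝ) := fun r ↦ cotangentMapDeriv (fun z ↦ (Φ r (s, z)).2) z ξ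
  have hA0 : ∀ r, A (r, 0) = (Φ r (s, z)).2 := fun r ↦ by simp only [A, hc0]
  have hAc : ∀ r, ContMDiffAt 𝓘(ℝ, ℝ × ℝ) (cotangentModel E) ∞ A (r, 0) := by
    intro r
    rw [← contMDiffAt_real_prod]
    have h1 : ContMDiffAt (𝓘(ℝ, ℝ).prod 𝓘(ℝ, ℝ)) (cotangentModel E) ∞ (fun p : ℝ × ℝ ↦ c p.2)
        (r, 0) := ContMDiffAt.comp (r, (0 : ℝ)) (g := c) hc contMDiffAt_snd
    have h2 : ContMDiffAt (𝓘(ℝ, ℝ).prod 𝓘(ℝ, ℝ)) (suspModel E) ∞ (fun p : ℝ × ℝ ↦ (s, c p.2))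
        (r, 0) := (contMDiffAt_const (c := s)).prodMk h1
    have h3 : ContMDiffAt (𝓘(ℝ, ℝ).prod 𝓘(ℝ, ℝ)) (𝓘(ℝ, ℝ).prod (suspModel E)) ∞
        (fun p : ℝ × ℝ ↦ (p.1, (s, c p.2))) (r, 0) := contMDiffAt_fst.prodMk h2
    exact ContMDiffAt.comp (r, (0 : ℝ))
      (g := fun p : ℝ × (ℝ × CotangentBundle E M) ↦ (Φ p.1 p.2).2)
      (contMDiff_suspFlow_snd hK hΦ _) h3
  have hSc : ∀ r, ContDiffAt ℝ ∞ S (r, 0) := by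
    intro r
    rw [← contMDiffAt_iff_contDiffAt, ← contMDiffAt_real_prod]
    have h1 : ContMDiffAt (𝓘(ℝ, ℝ).prod 𝓘(ℝ, ℝ)) (cotangentModel E) ∞ (fun p : ℝ × ℝ ↦ c p.2)
        (r, 0) := ContMDiffAt.comp (r, (0 : ℝ)) (g := c) hc contMDiffAt_snd
    have h2 : ContMDiffAt (𝓘(ℝ, ℝ).prod 𝓘(ℝ, ℝ)) (suspModel E) ∞ (fun p : ℝ × ℝ ↦ (p.1, c p.2))
        (r, 0) := contMDiffAt_fst.prodMk h1
    exact ContMDiffAt.comp (r, (0 : ℝ))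
      (g := fun p : ℝ × CotangentBundle E M ↦ actionIntegral K Φ s p.1 p.2)
      (contMDiff_actionIntegral hK hΦ s _) h2
  -- velocities of the two families of curves
  have velr : ∀ r σ, HasMFDerivAt 𝓘(ℝ, ℝ) (cotangentModel E) (fun r ↦ A (r, σ)) r
      ((1 : ℝ →L[ℝ] ℝ).smulRight (hamField (K (s + r)) (A (r, σ)))) := fun r σ ↦
    suspFlow_snd_hasMFDerivAt hΦ (s, c σ) r
  have velσ : ∀ r, HasMFDerivAt 𝓘(ℝ, ℝ) (cotangentModel E) (fun σ ↦ A (r, σ)) 0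
      ((1 : ℝ →L[ℝ] ℝ).smulRight (Y r)) := by
    intro r
    have h := hasMFDerivAt_comp_curve (f := fun z ↦ (Φ r (s, z)).2) (α := c)
      ((hZ r).mdifferentiable (by simp) _) hc'
    simp only [Y]
    rw [hc0] at h
    exact h
  have dSr : ∀ r σ, HasDerivAt (fun r ↦ S (r, σ)) (lagrangian K (s + r, A (r, σ))) r := by
    intro r σ
    have h := hΦ.hasDerivAt_integral hK.contMDiff_lagrangian.continuous (s, c σ) r
    have e : Φ r (s, c σ) = (s + r, A (r, σ)) := Prod.ext (suspFlow_fst hΦ r (s, c σ)) rfl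
    rw [e] at h
    exact h
  have dSσ : ∀ r, HasDerivAt (fun σ ↦ S (r, σ)) (cotangentDiff (actionIntegral K Φ s r) z ξ) 0 := by
    intro r
    have h := hasDerivAt_comp_of_hasMFDerivAt (α := c) ((hS r).mdifferentiable (by simp) _) hc'
    rw [hc0] at h
    exact h
  -- The defect of exactness is constant in `r`. Near each `r₀` this is computed in the chart at `A
  -- (r₀, 0)`; the defect at `r = 0` is `λ(ξ)`.
  have key : ∀ r₀, HasDerivAt (fun r ↦ liouville (A (r, 0)) (Y r) -
      cotangentDiff (actionIntegral K Φ s r) z ξ) 0 r₀ := by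
    intro r₀
    let z₀ := A (r₀, 0)
    let φ := extChartAt (cotangentModel E) z₀
    let u : ℝ × ℝ → E × (E →L[ℝ] ℝ) := fun p ↦ φ (A p)
    have hu : ContDiffAt ℝ ∞ u (r₀, 0) := contMDiffAt_iff_contDiffAt.1
      (ContMDiffAt.comp (r₀, (0 : ℝ)) (g := φ) contMDiffAt_extChartAt (hAc r₀))
    have hq : ContDiffAt ℝ ∞ (fun p ↦ (u p).1) (r₀, 0) := hu.fst
    have hp : ContDiffAt ℝ ∞ (fun p ↦ (u p).2) (r₀, 0) := hu.snd
    have evA : ∀ᶠ p in 𝓝 ((r₀, 0) : ℝ × ℝ), A p ∈ φ.source :=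
      (hAc r₀).continuousAt.eventually (extChartAt_source_mem_nhds z₀)
    have evq : ∀ᶠ p in 𝓝 ((r₀, 0) : ℝ × ℝ), DifferentiableAt ℝ (fun p ↦ (u p).1) p :=
      ((hq.of_le (m := 1) (by simp)).eventually (by simp)).mono fun p h ↦
        h.differentiableAt (by simp)
    have evS : ∀ᶠ p in 𝓝 ((r₀, 0) : ℝ × ℝ), DifferentiableAt ℝ S p :=
      (((hSc r₀).of_le (m := 1) (by simp)).eventually (by simp)).mono fun p h ↦
        h.differentiableAt (by simp)
    have ev := evA.and (evq.and evS)
    have cr : Filter.Tendsto (fun r : ℝ ↦ ((r, 0) : ℝ × ℝ)) (𝓝 r₀) (𝓝 (r₀, 0)) :=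
      (Continuous.prodMk_left (0 : ℝ)).continuousAt
    have cσ : Filter.Tendsto (fun σ : ℝ ↦ ((r₀, σ) : ℝ × ℝ)) (𝓝 0) (𝓝 (r₀, 0)) :=
      (Continuous.prodMk_right r₀).continuousAt
    have ur : ∀ r σ, A (r, σ) ∈ φ.source → HasDerivAt (fun r ↦ u (r, σ))
        (chartDeriv z₀ (A (r, σ)) (hamField (K (s + r)) (A (r, σ)))) r := fun r σ h ↦
      hasDerivAt_chart_comp (α := fun r ↦ A (r, σ)) h (velr r σ)
    have uσ : ∀ r, A (r, 0) ∈ φ.source → HasDerivAt (fun σ ↦ u (r, σ))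
        (chartDeriv z₀ (A (r, 0)) (Y r)) 0 := fun r h ↦
      hasDerivAt_chart_comp (α := fun σ ↦ A (r, σ)) h (velσ r)
    have h0 : A (r₀, 0) ∈ φ.source := mem_extChartAt_source z₀
    let κ : ℝ → ℝ := fun σ ↦ K (s + r₀) (A (r₀, σ))
    have main := hasDerivAt_action_form (ContinuousLinearMap.id ℝ (E →L[ℝ] ℝ))
      (q := fun p ↦ (u p).1) (p := fun p ↦ (u p).2) (S := S) (κ := κ) hq hp (hSc r₀) ?_ ?_
    · refine main.congr_of_eventuallyEq ?_
      filter_upwards [cr.eventually ev] with r hr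
      obtain ⟨h1, h2, h3⟩ := hr
      have e1 := (fderiv_partial h2).2 (uσ r h1).fst
      have e2 := (fderiv_partial h3).2 (dSσ r)
      change _ = (u (r, 0)).2 (fderiv ℝ (fun p ↦ (u p).1) (r, 0) (0, 1)) - _
      rw [e1, e2, liouville_chart h1]
    · filter_upwards [cσ.eventually ev] with σ hσ
      obtain ⟨h1, h2, h3⟩ := hσ
      have e1 := (fderiv_partial h2).1 (ur r₀ σ h1).fst
      have e2 := (fderiv_partial h3).1 (dSr r₀ σ)
      change _ = (u (r₀, σ)).2 (fderiv ℝ (fun p ↦ (u p).1) (r₀, σ) (1, 0)) - _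
      rw [e1, e2]
      unfold lagrangian
      rw [liouville_chart h1]
    -- The energy varies by `dK(Y) = ω(X_K, Y)`, which in the chart is the expression required of
    -- `κ'`.
    · have e1 := (fderiv_partial (hq.differentiableAt (by simp))).1 (ur r₀ 0 h0).fst
      have e2 := (fderiv_partial (hq.differentiableAt (by simp))).2 (uσ r₀ h0).fst
      have e3 := (fderiv_partial (hp.differentiableAt (by simp))).1 (ur r₀ 0 h0).snd
      have e4 := (fderiv_partial (hp.differentiableAt (by simp))).2 (uσ r₀ h0).snd
      rw [e1, e2, e3, e4]
      have h1 := hasDerivAt_comp_of_hasMFDerivAt (f := K (s + r₀)) (α := fun σ ↦ A (r₀, σ))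
        (hK.mdifferentiableAt _ _) (velσ r₀)
      refine h1.congr_deriv ?_
      have h2 := symplecticForm_chart h0 (hamField (K (s + r₀)) (A (r₀, 0))) (Y r₀)
      have h3 := stdSymplectic_hamLift (cotangentDiff (K (s + r₀)) (A (r₀, 0))) (Y r₀)
      exact h3.symm.trans h2.symm
  have hconst := is_const_of_deriv_eq_zero (fun r ↦ (key r).differentiableAt)
    (fun r ↦ (key r).deriv) r 0
  have hY0 : Y 0 = ξ := by
    have : (fun z : CotangentBundle E M ↦ (Φ 0 (s, z)).2) = id := by
      funext z; simp [hΦ.zero]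
    simp only [Y, this]
    exact DFunLike.congr_fun (mfderiv_id (I := cotangentModel E) (x := z)) ξ
  have hS0 : cotangentDiff (actionIntegral K Φ s 0) z ξ = 0 := by
    have : actionIntegral K Φ s 0 = fun _ ↦ 0 := by
      funext z; simp [actionIntegral]
    rw [this]
    exact DFunLike.congr_fun (mfderiv_const (I := cotangentModel E) (x := z)) ξ
  have hl : ∀ w w' : CotangentBundle E M, ∀ X : E × (E →L[ℝ] ℝ), w = w' →
      liouville w X = liouville w' X := fun w w' X h ↦ by subst h; rfl
  have h1 : liouville (A (r, 0)) (Y r) = liouville (Φ r (s, z)).2 (Y r) := hl _ _ _ (hA0 r)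
  have h2 : liouville (A (0, 0)) (Y 0) = liouville z (Y 0) :=
    hl _ _ _ ((hA0 0).trans (by rw [hΦ.zero]))
  have h3 : liouville z (Y 0) = liouville z ξ := congrArg _ hY0
  have h4 : liouville (A (r, 0)) (Y r) - cotangentDiff (actionIntegral K Φ s r) z ξ =
    liouville (A (0, 0)) (Y 0) - cotangentDiff (actionIntegral K Φ s 0) z ξ := hconst
  have h5 : liouville (Φ r (s, z)).2 (Y r) - liouville z ξ =
      cotangentDiff (actionIntegral K Φ s r) z ξ := by
    linarith
  exact h5

end Exactness

/-! ### Dual norm, kinetic energy and fibrewise scaling. -/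

section KineticEnergy

variable {E : Type*} [NormedAddCommGroup E] [NormedSpace ℝ E]
  {M : Type*} [TopologicalSpace M] [ChartedSpace E M] [IsManifold 𝓘(ℝ, E) ∞ M]

variable (E) in
/-- The inverse of the derivative of the chart at `q₀`. -/
def tangentCoordSymm (q₀ q : M) : E →L[ℝ] E :=
  (trivializationAt E (TangentSpace 𝓘(ℝ, E)) q₀).symmL ℝ q

theorem tangentCoordSymm_bijective {q₀ q : M} (hq : q ∈ (chartAt E q₀).source) :
    Function.Bijective (tangentCoordSymm E q₀ q) := by
  let e := trivializationAt E (TangentSpace 𝓘(ℝ, E)) q₀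
  have hqe : q ∈ e.baseSet := hq
  exact Function.bijective_iff_has_inverse.2 ⟨e.continuousLinearMapAt ℝ q,
    fun v ↦ e.continuousLinearMapAt_symmL (R := ℝ) hqe v,
    fun v ↦ e.symmL_continuousLinearMapAt (R := ℝ) hqe v⟩

theorem contMDiffAt_covectorCoord (z₀ : CotangentBundle E M) :
    ContMDiffAt (cotangentModel E) 𝓘(ℝ, E →L[ℝ] ℝ) ∞ (covectorCoord z₀.proj) z₀ := by
  have h : ContMDiffAt (cotangentModel E) 𝓘(ℝ, E × (E →L[ℝ] ℝ)) ∞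
      (extChartAt (cotangentModel E) z₀) z₀ := contMDiffAt_extChartAt
  have h2 := ContMDiffAt.comp z₀ (g := Prod.snd) contDiff_snd.contMDiff.contMDiffAt h
  refine h2.congr_of_eventuallyEq (Filter.Eventually.of_forall fun z ↦ ?_)
  exact (congrArg Prod.snd (extChartAt_cotangent_apply z₀ z)).symm

variable [FiniteDimensional ℝ E]

/-- The scalar product of the tangent space at `q`. -/
def innerForm (g : Metric E M) (q : M) : E →L[ℝ] E →L[ℝ] ℝ := g.inner q

/-- A metric in the coordinates of the chart at `q₀`. -/
def metricCoord (g : Metric E M) (q₀ q : M) : E →L[ℝ] E →L[ℝ] ℝ :=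
  (innerForm g q).bilinearComp (tangentCoordSymm E q₀ q) (tangentCoordSymm E q₀ q)

theorem contMDiffAt_metricCoord (g : Metric E M) (q₀ : M) :
    ContMDiffAt 𝓘(ℝ, E) 𝓘(ℝ, E →L[ℝ] E →L[ℝ] ℝ) ∞ (metricCoord g q₀) q₀ := by
  have h := ((contMDiffAt_hom_bundle _).1 (g.contMDiff q₀)).2
  refine h.congr_of_eventuallyEq ?_
  filter_upwards [chart_source_mem_nhds E q₀] with q hq
  ext v w
  have h1 := inCoordinates_apply_eq₂ (𝕜 := ℝ) (F₁ := E) (F₂ := E) (F₃ := ℝ)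
    (E₁ := fun x : M ↦ TangentSpace 𝓘(ℝ, E) x) (E₂ := fun x : M ↦ TangentSpace 𝓘(ℝ, E) x)
    (E₃ := fun x ↦ Bundle.Trivial M ℝ x) (x₀ := q₀) (x := q) (ϕ := g.inner q) (v := v) (w := w)
    hq hq trivial
  refine Eq.trans ?_ h1.symm
  have h2 : ∀ c : ℝ,
      (trivializationAt ℝ (fun x ↦ Bundle.Trivial M ℝ x) q₀).linearMapAt ℝ q c = c :=
    fun c ↦ DFunLike.congr_fun (Bundle.Trivial.continuousLinearMapAt_trivialization ℝ M ℝ q) c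
  have h3 : ∀ v : E, (trivializationAt E (TangentSpace 𝓘(ℝ, E)) q₀).symm q v =
    tangentCoordSymm E q₀ q v := fun v ↦ (Trivialization.symmL_apply (R := ℝ) _ hq v).symm
  rw [h3, h3]
  exact (h2 _).symm

theorem metricCoord_pos (g : Metric E M) {q₀ q : M} (hq : q ∈ (chartAt E q₀).source) {v : E}
    (hv : v ≠ 0) : 0 < metricCoord g q₀ q v v := by
  refine g.pos q _ fun h ↦ hv ?_
  exact (tangentCoordSymm_bijective hq).1 (h.trans (map_zero (tangentCoordSymm E q₀ q)).symm)

/-- A metric in the coordinates of the chart at `q₀`, as an isomorphism. -/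
def metricCoordEquiv (g : Metric E M) {q₀ q : M} (hq : q ∈ (chartAt E q₀).source) :
    E ≃L[ℝ] (E →L[ℝ] ℝ) :=
  (LinearEquiv.ofInjectiveOfFinrankEq (metricCoord g q₀ q).toLinearMap
    (by
      refine (injective_iff_map_eq_zero (metricCoord g q₀ q)).2 fun v hv ↦ ?_
      by_contra hne
      have h := metricCoord_pos g hq hne
      rw [hv] at h
      exact lt_irrefl _ h) finrank_covector.symm).toContinuousLinearEquiv

theorem coe_metricCoordEquiv (g : Metric E M) {q₀ q : M} (hq : q ∈ (chartAt E q₀).source) :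
    (metricCoordEquiv g hq : E →L[ℝ] E →L[ℝ] ℝ) = metricCoord g q₀ q := by
  ext v w; rfl

theorem inner_sharp (g : Metric E M) (z : CotangentBundle E M) :
    g.inner z.proj (sharp g z) = z.2 :=
  (Equiv.ofBijective (g.inner z.proj) (inner_bijective g z.proj)).apply_symm_apply z.2

theorem eq_sharp (g : Metric E M) (z : CotangentBundle E M) {v : E}
    (h : innerForm g z.proj v = z.2) : v = sharp g z :=
  (inner_bijective g z.proj).1 (h.trans (inner_sharp g z).symm)

theorem covector_sharp_nonneg (g : Metric E M) (z : CotangentBundle E M) :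
    0 ≤ z.2 (sharp g z) := by
  have h := DFunLike.congr_fun (inner_sharp g z) (sharp g z)
  rw [← h]
  by_cases h0 : sharp g z = 0
  · rw [h0]; simp
  · exact (g.pos _ _ h0).le

theorem covectorNorm_sq (g : Metric E M) (z : CotangentBundle E M) :
    covectorNorm g z ^ 2 = z.2 (sharp g z) :=
  Real.sq_sqrt (covector_sharp_nonneg g z)

theorem covectorNorm_nonneg (g : Metric E M) (z : CotangentBundle E M) : 0 ≤ covectorNorm g z :=
  Real.sqrt_nonneg _

/-- The dual norm uses the inverse matrix of the metric. Written with `ContinuousLinearMap.inverse`,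
which is smooth at invertible maps, this exhibits the kinetic energy as a smooth function. -/
theorem covectorNorm_sq_chart (g : Metric E M) {q₀ : M} {z : CotangentBundle E M}
    (hz : z.proj ∈ (chartAt E q₀).source) : covectorNorm g z ^ 2 =
      covectorCoord q₀ z ((metricCoord g q₀ z.proj).inverse (covectorCoord q₀ z)) := by
  let u : E := (metricCoordEquiv g hz).symm (covectorCoord q₀ z)
  have hu : metricCoord g q₀ z.proj u = covectorCoord q₀ z := by
    rw [← coe_metricCoordEquiv g hz]
    exact (metricCoordEquiv g hz).apply_symm_apply _
  have h1 : tangentCoordSymm E q₀ z.proj u = sharp g z := by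
    refine eq_sharp g z (ContinuousLinearMap.ext fun w ↦ ?_)
    obtain ⟨w', rfl⟩ := (tangentCoordSymm_bijective hz).2 w
    exact DFunLike.congr_fun hu w'
  rw [covectorNorm_sq, ← coe_metricCoordEquiv g hz, ContinuousLinearMap.inverse_equiv]
  exact (congrArg (z.2 : E →L[ℝ] ℝ) h1).symm

theorem covectorNorm_eq_zero_iff (g : Metric E M) (z : CotangentBundle E M) :
    covectorNorm g z = 0 ↔ z ∈ zeroSection E M := by
  have h := inner_sharp g z
  constructor
  · intro h0
    by_contra hne
    have h1 : sharp g z ≠ 0 := by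
      intro h2
      rw [h2, map_zero] at h
      exact hne h.symm
    have h3 := g.pos _ _ h1
    rw [h, ← covectorNorm_sq, h0] at h3
    simp at h3
  · intro h0
    have h2 : (z.2 : E →L[ℝ] ℝ) = 0 := h0
    have h3 : covectorNorm g z ^ 2 = 0 := by
      rw [covectorNorm_sq]
      exact DFunLike.congr_fun h2 (sharp g z)
    simpa using h3

theorem contMDiff_kineticEnergy (g : Metric E M) :
    ContMDiff (cotangentModel E) 𝓘(ℝ, ℝ) ∞ (kineticEnergy g) := by
  intro z₀
  have h1 := contMDiffAt_covectorCoord z₀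
  have h2 : ContMDiffAt (cotangentModel E) 𝓘(ℝ, E →L[ℝ] E →L[ℝ] ℝ) ∞
      (fun z ↦ metricCoord g z₀.proj z.proj) z₀ :=
    ContMDiffAt.comp z₀ (g := metricCoord g z₀.proj) (contMDiffAt_metricCoord g z₀.proj)
      contMDiff_cotangent_proj.contMDiffAt
  have h3 : ContDiffAt ℝ ∞ (ContinuousLinearMap.inverse : (E →L[ℝ] E →L[ℝ] ℝ) → _)
      (metricCoord g z₀.proj z₀.proj) := by
    rw [← coe_metricCoordEquiv g (mem_chart_source E z₀.proj)]
    exact contDiffAt_map_inverse _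
  have h4 := ContMDiffAt.comp z₀ (g := ContinuousLinearMap.inverse) h3.contMDiffAt h2
  have h5 := h1.clm_apply (h4.clm_apply h1)
  have h6 : ContMDiffAt (cotangentModel E) 𝓘(ℝ, ℝ) ∞ (fun z ↦ (1 / 2 : ℝ) *
      covectorCoord z₀.proj z ((metricCoord g z₀.proj z.proj).inverse (covectorCoord z₀.proj z)))
      z₀ := contMDiffAt_const.mul h5
  refine h6.congr_of_eventuallyEq ?_
  filter_upwards [(isOpen_extChartAt_source z₀).mem_nhds
    (mem_extChartAt_source (I := cotangentModel E) z₀)] with z hz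
  unfold kineticEnergy
  rw [covectorNorm_sq_chart g ((mem_extChartAt_cotangent_source _ _).1 hz)]
  ring

theorem covectorNorm_eq_sqrt (g : Metric E M) (z : CotangentBundle E M) :
    covectorNorm g z = √(2 * kineticEnergy g z) := by
  unfold kineticEnergy
  rw [mul_div_cancel₀ _ (two_ne_zero), Real.sqrt_sq (covectorNorm_nonneg g z)]

theorem continuous_covectorNorm (g : Metric E M) : Continuous (covectorNorm g) := by
  have h := (contMDiff_kineticEnergy g).continuous
  have h2 : covectorNorm g = fun z ↦ √(2 * kineticEnergy g z) :=
    funext (covectorNorm_eq_sqrt g)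
  rw [h2]
  fun_prop

/-- Multiplication by `s` in the fibres. -/
def fiberScale (s : ℝ) (z : CotangentBundle E M) : CotangentBundle E M :=
  ⟨z.proj, (s • (z.2 : E →L[ℝ] ℝ) : E →L[ℝ] ℝ)⟩

theorem fiberScale_fiberScale (s t : ℝ) (z : CotangentBundle E M) :
    fiberScale s (fiberScale t z) = fiberScale (s * t) z := by
  unfold fiberScale
  congr 1
  exact smul_smul s t (z.2 : E →L[ℝ] ℝ)

theorem fiberScale_one (z : CotangentBundle E M) : fiberScale 1 z = z := by
  unfold fiberScale
  exact congrArg (TotalSpace.mk z.proj) (one_smul ℝ (z.2 : E →L[ℝ] ℝ))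

theorem covectorCoord_fiberScale (q₀ : M) (s : ℝ) (z : CotangentBundle E M) :
    covectorCoord q₀ (fiberScale s z) = s • covectorCoord q₀ z := by
  ext v; rfl

theorem covectorNorm_fiberScale (g : Metric E M) (s : ℝ) (z : CotangentBundle E M) :
    covectorNorm g (fiberScale s z) = |s| * covectorNorm g z := by
  have h1 := covectorNorm_sq_chart g (z := fiberScale s z) (mem_chart_source E z.proj)
  have h2 := covectorNorm_sq_chart g (z := z) (mem_chart_source E z.proj)
  rw [covectorCoord_fiberScale] at h1
  have h3 : covectorNorm g (fiberScale s z) ^ 2 = (|s| * covectorNorm g z) ^ 2 := by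
    rw [h1, mul_pow, sq_abs, h2]
    change (s • covectorCoord z.proj z) ((metricCoord g z.proj z.proj).inverse _) = _
    simp
    ring
  exact (sq_eq_sq₀ (covectorNorm_nonneg _ _)
    (mul_nonneg (abs_nonneg s) (covectorNorm_nonneg _ _))).1 h3

theorem kineticEnergy_fiberScale (g : Metric E M) (s : ℝ) (z : CotangentBundle E M) :
    kineticEnergy g (fiberScale s z) = s ^ 2 * kineticEnergy g z := by
  unfold kineticEnergy
  rw [covectorNorm_fiberScale, mul_pow, sq_abs]
  ring

theorem contMDiff_fiberScale : ContMDiff (suspModel E) (cotangentModel E) ∞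
    (fun p : ℝ × CotangentBundle E M ↦ fiberScale p.1 p.2) := by
  rintro ⟨s₀, z₀⟩
  refine contMDiffAt_totalSpace.2 ⟨?_, ?_⟩
  · exact contMDiff_cotangent_proj.comp contMDiff_snd _
  · have h1 : ContMDiffAt (suspModel E) 𝓘(ℝ, E →L[ℝ] ℝ) ∞
        (fun p : ℝ × CotangentBundle E M ↦ p.1 • covectorCoord z₀.proj p.2) (s₀, z₀) :=
      contMDiffAt_fst.smul (ContMDiffAt.comp (s₀, z₀) (g := covectorCoord z₀.proj)
        (contMDiffAt_covectorCoord z₀) contMDiffAt_snd)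
    refine h1.congr_of_eventuallyEq (Filter.Eventually.of_forall fun p ↦ ?_)
    exact (congrArg Prod.snd (cotangent_trivializationAt_apply z₀.proj (fiberScale p.1 p.2))).trans
      (covectorCoord_fiberScale z₀.proj p.1 p.2)

/-- Over a compact piece of a chart the dual norm has a minimum `m > 0` on the coordinate unit
sphere, so by homogeneity `‖p‖ ≤ C` confines coordinates to the ball of radius `C / m`. Finitely
many pieces cover `M`. -/
theorem isCompact_covectorNorm_le [CompactSpace M] (g : Metric E M) (C : ℝ) :
    IsCompact {z : CotangentBundle E M | covectorNorm g z ≤ C} := by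
  have hloc : ∀ q₀ : M, ∃ K ∈ 𝓝 q₀, ∃ L : Set (CotangentBundle E M), IsCompact L ∧
      ∀ z, z.proj ∈ K → covectorNorm g z ≤ C → z ∈ L := by
    intro q₀
    have : LocallyCompactSpace M := Manifold.locallyCompact_of_finiteDimensional 𝓘(ℝ, E)
    obtain ⟨K, hK, hKs, hKc⟩ := local_compact_nhds (chart_source_mem_nhds E q₀)
    let e := trivializationAt (E →L[ℝ] ℝ)
      (fun x : M ↦ TangentSpace 𝓘(ℝ, E) x →L[ℝ] Bundle.Trivial M ℝ x) q₀
    have hebase : ∀ q, q ∈ (chartAt E q₀).source → q ∈ e.baseSet := fun q hq ↦ ⟨hq, trivial⟩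
    have hsymm : ∀ q ∈ K, ∀ p, e (e.toOpenPartialHomeomorph.symm (q, p)) = (q, p) := fun q hq p ↦
      e.apply_symm_apply (e.mem_target.2 (hebase q (hKs hq)))
    have hcont : ∀ B : Set (E →L[ℝ] ℝ), ContinuousOn e.toOpenPartialHomeomorph.symm (K ×ˢ B) :=
      fun B ↦ e.continuousOn_invFun.mono fun p hp ↦ e.mem_target.2 (hebase _ (hKs hp.1))
    have hS : IsCompact (K ×ˢ Metric.sphere (0 : E →L[ℝ] ℝ) 1) :=
      hKc.prod (isCompact_sphere 0 1)
    obtain ⟨m, hm, hmle⟩ := hS.exists_forall_le' (f := fun p ↦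
      covectorNorm g (e.toOpenPartialHomeomorph.symm p)) (a := 0)
      ((continuous_covectorNorm g).comp_continuousOn (hcont _)) (by
        rintro ⟨q, p⟩ ⟨hq, hp⟩
        refine lt_of_le_of_ne (covectorNorm_nonneg _ _) fun h0 ↦ ?_
        have h1 := (covectorNorm_eq_zero_iff g _).1 h0.symm
        have h2 := hsymm q hq p
        rw [cotangent_trivializationAt_apply] at h2
        have h3 : p = 0 := by
          refine (congrArg Prod.snd h2).symm.trans ?_
          ext v
          exact DFunLike.congr_fun (h1 : _ = (0 : E →L[ℝ] ℝ)) _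
        simp [h3] at hp)
    refine ⟨K, hK, e.toOpenPartialHomeomorph.symm '' (K ×ˢ Metric.closedBall 0 (C / m)),
      (hKc.prod (isCompact_closedBall _ _)).image_of_continuousOn (hcont _), fun z hz hzC ↦ ?_⟩
    have hzs : z ∈ e.source := e.mem_source.2 (hebase _ (hKs hz))
    refine ⟨e z, ?_, e.toOpenPartialHomeomorph.left_inv hzs⟩
    rw [cotangent_trivializationAt_apply]
    refine ⟨hz, ?_⟩
    rw [mem_closedBall_zero_iff]
    set c := covectorCoord q₀ z with hc
    by_cases hc0 : c = 0
    · rw [hc0, norm_zero]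
      exact div_nonneg ((covectorNorm_nonneg g z).trans hzC) hm.le
    · have hn : 0 < ‖c‖ := norm_pos_iff.2 hc0
      have h1 := hmle (z.proj, ‖c‖⁻¹ • c) ⟨hz, by
        rw [mem_sphere_zero_iff_norm, norm_smul, norm_inv, norm_norm, inv_mul_cancel₀ hn.ne']⟩
      have h2 : e.toOpenPartialHomeomorph.symm (z.proj, ‖c‖⁻¹ • c) = fiberScale ‖c‖⁻¹ z := by
        have h3 : e (fiberScale ‖c‖⁻¹ z) = (z.proj, ‖c‖⁻¹ • c) := by
          rw [cotangent_trivializationAt_apply, covectorCoord_fiberScale]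
          rfl
        rw [← h3]
        exact e.toOpenPartialHomeomorph.left_inv (e.mem_source.2 (hebase _ (hKs hz)))
      simp only [h2] at h1
      rw [covectorNorm_fiberScale, abs_of_pos (inv_pos.2 hn), ← div_eq_inv_mul,
        le_div_iff₀ hn] at h1
      rw [le_div_iff₀ hm]
      linarith
  choose K hK L hL hKL using hloc
  obtain ⟨t, ht⟩ := CompactSpace.elim_nhds_subcover K hK
  refine (t.isCompact_biUnion fun q _ ↦ hL q).of_isClosed_subset
    (isClosed_le (continuous_covectorNorm g) continuous_const) fun z hz ↦ ?_
  have h1 : z.proj ∈ ⋃ q ∈ t, K q := by rw [ht]; trivial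
  simp only [mem_iUnion] at h1 ⊢
  obtain ⟨q, hq, hzq⟩ := h1
  exact ⟨q, hq, hKL q z hzq hz⟩

end KineticEnergy

/-! ### Conservation of energy and completeness. -/

section AutonomousHamiltonian

variable {E : Type*} [NormedAddCommGroup E] [NormedSpace ℝ E] [FiniteDimensional ℝ E]
  {M : Type*} [TopologicalSpace M] [ChartedSpace E M] [IsManifold 𝓘(ℝ, E) ∞ M]
  {H : CotangentBundle E M → ℝ}

theorem smoothHamiltonian_const (hH : ContMDiff (cotangentModel E) 𝓘(ℝ, ℝ) ∞ H) :
    SmoothHamiltonian (fun _ : ℝ ↦ H) :=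
  hH.comp contMDiff_snd

theorem smoothField_hamField (hH : ContMDiff (cotangentModel E) 𝓘(ℝ, ℝ) ∞ H) :
    SmoothField (cotangentModel E) (hamField H) := by
  refine smoothField_iff.2 fun z₀ ↦ ?_
  exact ContMDiffAt.comp z₀ (f := fun z : CotangentBundle E M ↦ ((0 : ℝ), z))
    ((smoothHamiltonian_const hH).contMDiffAt_hamField 0 z₀)
    (contMDiffAt_const.prodMk contMDiffAt_id)

theorem SmoothField.smul {F : Type*} [NormedAddCommGroup F] [NormedSpace ℝ F]
    [FiniteDimensional ℝ F] {B : Type*} [TopologicalSpace B] {I : ModelWithCorners ℝ F B}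
    [I.Boundaryless] {X : Type*} [TopologicalSpace X] [ChartedSpace B X] [IsManifold I ∞ X]
    {v : X → F} (hv : SmoothField I v) {χ : X → ℝ} (hχ : ContMDiff I 𝓘(ℝ, ℝ) ∞ χ) :
    SmoothField I (fun x ↦ χ x • v x) := by
  refine smoothField_iff.2 fun x₀ ↦ ?_
  refine ((hχ x₀).smul (smoothField_iff.1 hv x₀)).congr_of_eventuallyEq
    (Filter.Eventually.of_forall fun x ↦ ?_)
  exact map_smul (mfderiv I 𝓘(ℝ, F) (extChartAt I x₀) x : F →L[ℝ] F) (χ x) (v x)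

theorem cotangentDiff_hamField (H : CotangentBundle E M → ℝ) (z : CotangentBundle E M) :
    cotangentDiff H z (hamField H z) = 0 := by
  have h := stdSymplectic_hamLift (cotangentDiff H z) (hamField H z)
  rw [← h]
  unfold stdSymplectic hamField
  ring

/-- A Hamiltonian is constant along reparametrizations of its integral curves. -/
theorem energy_const (hH : ContMDiff (cotangentModel E) 𝓘(ℝ, ℝ) ∞ H)
    {γ : ℝ → CotangentBundle E M} {a : ℝ → ℝ} (hγ : ∀ t, HasMFDerivAt 𝓘(ℝ, ℝ) (cotangentModel E)
      γ t ((1 : ℝ →L[ℝ] ℝ).smulRight (a t • hamField H (γ t)))) (t : ℝ) : H (γ t) = H (γ 0) := by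
  have h : ∀ t, HasDerivAt (fun t ↦ H (γ t)) 0 t := fun t ↦ by
    have h1 := hasDerivAt_comp_of_hasMFDerivAt (hH.mdifferentiable (by simp) (γ t)) (hγ t)
    rwa [map_smul, cotangentDiff_hamField, smul_zero] at h1
  exact is_const_of_deriv_eq_zero (fun r ↦ (h r).differentiableAt) (fun r ↦ (h r).deriv) t 0

variable [T2Space M]

/-- Autonomous Hamiltonians with compact sublevel sets have complete flows. -/
theorem exists_isMIntegralCurve_hamField (hH : ContMDiff (cotangentModel E) 𝓘(ℝ, ℝ) ∞ H)
    (hc : ∀ c, IsCompact {z | H z ≤ c}) (z : CotangentBundle E M) :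
    ∃ γ : ℝ → CotangentBundle E M, γ 0 = z ∧
      IsMIntegralCurve (I := cotangentModel E) γ (hamField H) := by
  -- The field is switched off where `H ≥ H z + 2`, hence is complete. Its curves still conserve
  -- `H`, so the one through `z` stays where `χ = 1` and solves the original equation.
  let χ : CotangentBundle E M → ℝ := fun y ↦ Real.smoothTransition (H z + 2 - H y)
  have hχ : ContMDiff (cotangentModel E) 𝓘(ℝ, ℝ) ∞ χ :=
    Real.smoothTransition.contDiff.contMDiff.comp (contMDiff_const.sub hH)
  obtain ⟨γ, h0, hγ⟩ := ((smoothField_hamField hH).smul hχ).exists_isMIntegralCurve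
    (hc (H z + 2)) one_pos (fun y hy ↦ by
      have hy' : H z + 2 < H y := not_le.1 hy
      have h1 : χ y • hamField H y = 0 := by
        have : χ y = 0 := Real.smoothTransition.zero_of_nonpos (by linarith)
        rw [this, zero_smul]
      exact ⟨fun _ ↦ y, rfl, (isMIntegralCurve_const (I := cotangentModel E)
        (v := fun y ↦ χ y • hamField H y) h1).isMIntegralCurveOn _⟩) z
  refine ⟨γ, h0, fun t ↦ ?_⟩
  have h1 := hγ t
  have h2 : χ (γ t) = 1 := by
    have h3 := energy_const (a := fun t ↦ χ (γ t)) hH hγ t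
    rw [h0] at h3
    exact Real.smoothTransition.one_of_one_le (by rw [h3]; linarith)
  have h4 : χ (γ t) • hamField H (γ t) = hamField H (γ t) := by rw [h2, one_smul]
  exact h1.congr_mfderiv (congrArg (fun w : E × (E →L[ℝ] ℝ) ↦ (1 : ℝ →L[ℝ] ℝ).smulRight w) h4)

theorem isHamiltonianCurveOn_univ_iff {γ : ℝ → CotangentBundle E M} :
    IsHamiltonianCurveOn (fun _ ↦ H) γ univ ↔
      IsMIntegralCurve (I := cotangentModel E) γ (hamField H) := by
  rw [isHamiltonianCurveOn_iff]
  exact ⟨fun h t ↦ hasMFDerivWithinAt_univ.1 (h t trivial),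
    fun h t _ ↦ hasMFDerivWithinAt_univ.2 (h t)⟩

end AutonomousHamiltonian

/-! ### Exact symplectic maps. -/

section ExactMaps

variable {E : Type*} [NormedAddCommGroup E] [NormedSpace ℝ E] [FiniteDimensional ℝ E]
  {M : Type*} [TopologicalSpace M] [ChartedSpace E M] [IsManifold 𝓘(ℝ, E) ∞ M]

/-- Smooth maps `F` of `T*M` with `F^* λ - λ` exact. -/
def IsExactMap (F : CotangentBundle E M → CotangentBundle E M) : Prop :=
  ContMDiff (cotangentModel E) (cotangentModel E) ∞ F ∧ ∃ S : CotangentBundle E M → ℝ,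
    ContMDiff (cotangentModel E) 𝓘(ℝ, ℝ) ∞ S ∧ ∀ z, ∀ ξ : E × (E →L[ℝ] ℝ),
      liouville (F z) (cotangentMapDeriv F z ξ) - liouville z ξ =
        cotangentDiff S z ξ

/-- Pulling back by `G` gives `(F ∘ G)^* λ - λ = G^*(dS) + dT`, so the primitive is `S ∘ G + T`. -/
theorem IsExactMap.comp {F G : CotangentBundle E M → CotangentBundle E M} (hF : IsExactMap F)
    (hG : IsExactMap G) : IsExactMap (fun z ↦ F (G z)) := by
  obtain ⟨hFs, S, hS, hFS⟩ := hF
  obtain ⟨hGs, T, hT, hGT⟩ := hG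
  refine ⟨hFs.comp hGs, fun z ↦ S (G z) + T z, (hS.comp hGs).add hT, fun z ξ ↦ ?_⟩
  have d1 := (hFs.mdifferentiable (by simp) (G z)).hasMFDerivAt
  have d2 := (hGs.mdifferentiable (by simp) z).hasMFDerivAt
  have d3 := (hS.mdifferentiable (by simp) (G z)).hasMFDerivAt
  have d4 := (hT.mdifferentiable (by simp) z).hasMFDerivAt
  have c3 : HasMFDerivAt (cotangentModel E) 𝓘(ℝ, ℝ) (fun z ↦ S (G z)) z
      ((cotangentDiff S (G z)).comp (cotangentMapDeriv G z)) := HasMFDerivAt.comp z d3 d2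
  have e1 : cotangentMapDeriv (fun z ↦ F (G z)) z ξ =
      cotangentMapDeriv F (G z) (cotangentMapDeriv G z ξ) :=
    DFunLike.congr_fun (HasMFDerivAt.comp z d1 d2).mfderiv ξ
  have e2 : cotangentDiff (fun z ↦ S (G z) + T z) z ξ =
      cotangentDiff S (G z) (cotangentMapDeriv G z ξ) + cotangentDiff T z ξ :=
    DFunLike.congr_fun (HasMFDerivAt.add c3 d4).mfderiv ξ
  have e3 := hFS (G z) (cotangentMapDeriv G z ξ)
  have e4 := hGT z ξ
  have e5 : liouville (F (G z)) (cotangentMapDeriv (fun z ↦ F (G z)) z ξ) =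
    liouville (F (G z)) (cotangentMapDeriv F (G z) (cotangentMapDeriv G z ξ)) := congrArg _ e1
  rw [e2, ← e3, ← e4]
  have e6 : liouville (F (G z)) (cotangentMapDeriv (fun z ↦ F (G z)) z ξ) - liouville z ξ =
    liouville (F (G z)) (cotangentMapDeriv F (G z) (cotangentMapDeriv G z ξ)) -
      liouville (G z) (cotangentMapDeriv G z ξ) +
        (liouville (G z) (cotangentMapDeriv G z ξ) - liouville z ξ) := by linarith
  exact e6

variable [T2Space M] {K : ℝ → CotangentBundle E M → ℝ}
  {Φ : ℝ → ℝ × CotangentBundle E M → ℝ × CotangentBundle E M}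

theorem isExactMap_suspFlow (hK : SmoothHamiltonian K)
    (hΦ : IsFlow (suspModel E) (suspField K) Φ) (s r : ℝ) :
    IsExactMap (fun z ↦ (Φ r (s, z)).2) :=
  ⟨(contMDiff_suspFlow_snd hK hΦ).comp
      (contMDiff_const.prodMk (contMDiff_const.prodMk contMDiff_id)),
    actionIntegral K Φ s r,
    (contMDiff_actionIntegral hK hΦ s).comp (contMDiff_const.prodMk contMDiff_id),
    suspFlow_exact hK hΦ s r⟩

end ExactMaps

/-! ### The geodesic flow. -/

section GeodesicFlow

variable {E : Type*} [NormedAddCommGroup E] [NormedSpace ℝ E] [FiniteDimensional ℝ E]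
  {M : Type*} [TopologicalSpace M] [ChartedSpace E M] [IsManifold 𝓘(ℝ, E) ∞ M]
  [T2Space M] [CompactSpace M]

theorem isCompact_kineticEnergy_le (g : Metric E M) (c : ℝ) :
    IsCompact {z : CotangentBundle E M | kineticEnergy g z ≤ c} := by
  refine (isCompact_covectorNorm_le g √(2 * c)).of_isClosed_subset
    (isClosed_le (contMDiff_kineticEnergy g).continuous continuous_const) fun z hz ↦ ?_
  have h : kineticEnergy g z ≤ c := hz
  change covectorNorm g z ≤ _
  rw [covectorNorm_eq_sqrt]
  exact Real.sqrt_le_sqrt (by linarith)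

/-- Compactness of the energy sublevels makes every solution complete, so the definition by choice
never falls into its default case. -/
theorem isFlow_geodesicFlow (g : Metric E M) :
    IsFlow (cotangentModel E) (hamField (kineticEnergy g)) (geodesicFlow g) := by
  have h : ∀ z, ∃ γ : ℝ → CotangentBundle E M,
      γ 0 = z ∧ IsHamiltonianCurveOn (fun _ ↦ kineticEnergy g) γ univ := fun z ↦ by
    obtain ⟨γ, h0, hγ⟩ := exists_isMIntegralCurve_hamField (contMDiff_kineticEnergy g)
      (isCompact_kineticEnergy_le g) z
    exact ⟨γ, h0, isHamiltonianCurveOn_univ_iff.2 hγ⟩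
  have h2 : ∀ t z, geodesicFlow g t z = Classical.choose (h z) t := fun t z ↦ dif_pos (h z)
  refine ⟨fun z ↦ (h2 0 z).trans (Classical.choose_spec (h z)).1, fun z ↦ ?_⟩
  have h3 := isHamiltonianCurveOn_univ_iff.1 (Classical.choose_spec (h z)).2
  have h4 : (fun t ↦ geodesicFlow g t z) = Classical.choose (h z) := funext fun t ↦ h2 t z
  rw [h4]
  exact h3

theorem geodesicFlow_zero (g : Metric E M) (z : CotangentBundle E M) : geodesicFlow g 0 z = z :=
  (isFlow_geodesicFlow g).zero z

theorem geodesicFlow_add (g : Metric E M) (s t : ℝ) (z : CotangentBundle E M) :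
    geodesicFlow g (s + t) z = geodesicFlow g s (geodesicFlow g t z) :=
  (isFlow_geodesicFlow g).add (smoothField_hamField (contMDiff_kineticEnergy g)) s t z

theorem geodesicFlow_neg_apply (g : Metric E M) (t : ℝ) (z : CotangentBundle E M) :
    geodesicFlow g (-t) (geodesicFlow g t z) = z := by
  rw [← geodesicFlow_add, neg_add_cancel, geodesicFlow_zero]

theorem geodesicFlow_apply_neg (g : Metric E M) (t : ℝ) (z : CotangentBundle E M) :
    geodesicFlow g t (geodesicFlow g (-t) z) = z := by
  rw [← geodesicFlow_add, add_neg_cancel, geodesicFlow_zero]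

theorem contMDiff_geodesicFlow (g : Metric E M) :
    ContMDiff (suspModel E) (cotangentModel E) ∞
      (fun p : ℝ × CotangentBundle E M ↦ geodesicFlow g p.1 p.2) :=
  (isFlow_geodesicFlow g).contMDiff (smoothField_hamField (contMDiff_kineticEnergy g))

theorem contMDiff_geodesicFlow_time (g : Metric E M) (t : ℝ) :
    ContMDiff (cotangentModel E) (cotangentModel E) ∞ (geodesicFlow g t) :=
  (contMDiff_geodesicFlow g).comp (contMDiff_const.prodMk contMDiff_id)

theorem covectorNorm_geodesicFlow (g : Metric E M) (t : ℝ) (z : CotangentBundle E M) :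
    covectorNorm g (geodesicFlow g t z) = covectorNorm g z := by
  have h := energy_const (a := fun _ ↦ 1) (γ := fun t ↦ geodesicFlow g t z)
    (contMDiff_kineticEnergy g) (fun t ↦ by
      rw [one_smul]
      exact (isFlow_geodesicFlow g).curve z t) t
  rw [covectorNorm_eq_sqrt, covectorNorm_eq_sqrt, h, geodesicFlow_zero]

/-- Puts the geodesic flow into the time-dependent setting, where exactness has been proved. -/
theorem isFlow_susp_geodesicFlow (g : Metric E M) :
    IsFlow (suspModel E) (suspField fun _ ↦ kineticEnergy g)
      (fun r p ↦ (p.1 + r, geodesicFlow g r p.2)) := by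
  refine ⟨fun p ↦ by rw [add_zero, geodesicFlow_zero], fun p t ↦ ?_⟩
  have h1 := (isFlow_geodesicFlow g).curve p.2 t
  have h2 : HasMFDerivAt 𝓘(ℝ, ℝ) 𝓘(ℝ, ℝ) (fun r ↦ p.1 + r) t (1 : ℝ →L[ℝ] ℝ) :=
    ((hasFDerivAt_id t).const_add p.1).hasMFDerivAt
  refine (h2.prodMk h1).congr_mfderiv (ContinuousLinearMap.ext_ring ?_)
  change ((1 : ℝ), (1 : ℝ) • hamField (kineticEnergy g) _) =
    (1 : ℝ) • suspField (fun _ ↦ kineticEnergy g) _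
  rw [one_smul, one_smul]
  rfl

theorem isExactMap_geodesicFlow (g : Metric E M) (t : ℝ) : IsExactMap (geodesicFlow g t) :=
  isExactMap_suspFlow (smoothHamiltonian_const (contMDiff_kineticEnergy g))
    (isFlow_susp_geodesicFlow g) 0 t

end GeodesicFlow

/-! ### The derivative of `(q, p) ↦ (q, Q)`. -/

section TwistDerivative

variable {E : Type*} [NormedAddCommGroup E] [NormedSpace ℝ E]
  {M : Type*} [TopologicalSpace M] [ChartedSpace E M] [IsManifold 𝓘(ℝ, E) ∞ M]

theorem projDeriv_apply (z : CotangentBundle E M) (ξ : E × (E →L[ℝ] ℝ)) :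
    projDeriv z ξ = ξ.1 := by
  have d1 : HasMFDerivAt (cotangentModel E) 𝓘(ℝ, E × (E →L[ℝ] ℝ))
      (extChartAt (cotangentModel E) z) z (chartDeriv z z) :=
    (mdifferentiableAt_extChartAt (I := cotangentModel E) (mem_chart_source _ z)).hasMFDerivAt
  have d2 : HasMFDerivAt 𝓘(ℝ, E) 𝓘(ℝ, E) (extChartAt 𝓘(ℝ, E) z.proj) z.proj
      (ContinuousLinearMap.id ℝ E) := by
    refine (mdifferentiableAt_extChartAt (I := 𝓘(ℝ, E))
      (mem_chart_source _ z.proj)).hasMFDerivAt.congr_mfderiv ?_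
    exact mfderiv_extChartAt_self
  have d3 : HasMFDerivAt (cotangentModel E) 𝓘(ℝ, E) (fun y : CotangentBundle E M ↦ y.proj) z
    (projDeriv z) := (contMDiff_cotangent_proj.mdifferentiable (by simp) z).hasMFDerivAt
  have d4 : HasMFDerivAt 𝓘(ℝ, E × (E →L[ℝ] ℝ)) 𝓘(ℝ, E) (Prod.fst : E × (E →L[ℝ] ℝ) → E)
      (extChartAt (cotangentModel E) z z) (ContinuousLinearMap.fst ℝ E (E →L[ℝ] ℝ)) :=
    hasFDerivAt_fst.hasMFDerivAt
  have c1 := HasMFDerivAt.comp z d4 d1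
  have c2 := HasMFDerivAt.comp z d2 d3
  have heq : (Prod.fst : E × (E →L[ℝ] ℝ) → E) ∘ (extChartAt (cotangentModel E) z) =
      extChartAt 𝓘(ℝ, E) z.proj ∘ fun y : CotangentBundle E M ↦ y.proj := by
    funext y
    exact congrArg Prod.fst (extChartAt_cotangent_apply z y)
  rw [← heq] at c2
  have c3 : (chartDeriv z z ξ).1 = projDeriv z ξ :=
    DFunLike.congr_fun (hasMFDerivAt_unique c1 c2) ξ
  rw [← c3, chartDeriv_self]
  rfl

theorem contMDiff_twistMap {F : CotangentBundle E M → CotangentBundle E M}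
    (hF : ContMDiff (cotangentModel E) (cotangentModel E) ∞ F) :
    ContMDiff (cotangentModel E) (𝓘(ℝ, E).prod 𝓘(ℝ, E)) ∞ (twistMap F) :=
  contMDiff_cotangent_proj.prodMk (contMDiff_cotangent_proj.comp hF)

/-- The derivative of `(q, p) ↦ (q, Q)`. -/
def twistDeriv (F : CotangentBundle E M → CotangentBundle E M) (z : CotangentBundle E M) :
    E × (E →L[ℝ] ℝ) →L[ℝ] E × E :=
  mfderiv (cotangentModel E) (𝓘(ℝ, E).prod 𝓘(ℝ, E)) (twistMap F) z

theorem hasMFDerivAt_proj (z : CotangentBundle E M) :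
    HasMFDerivAt (cotangentModel E) 𝓘(ℝ, E) (fun y : CotangentBundle E M ↦ y.proj) z
      (ContinuousLinearMap.fst ℝ E (E →L[ℝ] ℝ)) :=
  ((contMDiff_cotangent_proj.mdifferentiable (by simp) z).hasMFDerivAt).congr_mfderiv
    (ContinuousLinearMap.ext (projDeriv_apply z))

theorem twistDeriv_apply {F : CotangentBundle E M → CotangentBundle E M}
    {z : CotangentBundle E M}
    (hF : MDifferentiableAt (cotangentModel E) (cotangentModel E) F z) (ξ : E × (E →L[ℝ] ℝ)) :
    twistDeriv F z ξ = (ξ.1, (cotangentMapDeriv F z ξ).1) := by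
  have d1 := HasMFDerivAt.comp z (hasMFDerivAt_proj (F z)) hF.hasMFDerivAt
  exact DFunLike.congr_fun ((hasMFDerivAt_proj z).prodMk d1).mfderiv ξ

/-- The first component of the derivative is the horizontal part of `ξ`, so the immersion condition
concerns vertical vectors only: `∂Q/∂p` is injective. -/
theorem injective_twistDeriv_iff {F : CotangentBundle E M → CotangentBundle E M}
    {z : CotangentBundle E M}
    (hF : MDifferentiableAt (cotangentModel E) (cotangentModel E) F z) :
    Function.Injective (twistDeriv F z) ↔
      ∀ β : E →L[ℝ] ℝ, (cotangentMapDeriv F z (0, β)).1 = 0 → β = 0 := by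
  rw [injective_iff_map_eq_zero]
  constructor
  · intro h β hβ
    exact congrArg Prod.snd (h (0, β) ((twistDeriv_apply hF _).trans (by rw [hβ]; rfl)))
  · rintro h ⟨v, β⟩ hv
    rw [twistDeriv_apply hF] at hv
    have h1 : v = 0 := congrArg Prod.fst hv
    subst h1
    rw [h β (congrArg Prod.snd hv)]
    rfl

theorem covectorCoord_self (z : CotangentBundle E M) : covectorCoord z.proj z = z.2 := by
  ext v
  have h := DFunLike.congr_fun (TangentBundle.continuousLinearMapAt_trivializationAt (I := 𝓘(ℝ, E))
    (mem_chart_source E z.proj)) v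
  have h2 : (mfderiv 𝓘(ℝ, E) 𝓘(ℝ, E) (extChartAt 𝓘(ℝ, E) z.proj) z.proj : E →L[ℝ] E) v = v :=
    DFunLike.congr_fun (mfderiv_extChartAt_self (I := 𝓘(ℝ, E)) (x := z.proj)) v
  have h3 := Trivialization.symmL_continuousLinearMapAt (R := ℝ)
      (trivializationAt E (TangentSpace 𝓘(ℝ, E)) z.proj) (b := z.proj)
      (mem_chart_source E z.proj) v
  have h4 : tangentCoordSymm E z.proj z.proj v = v :=
    (congrArg (tangentCoordSymm E z.proj z.proj) (h.trans h2)).symm.trans h3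
  exact congrArg (z.2 : E →L[ℝ] ℝ) h4

theorem extChartAt_fiberScale [FiniteDimensional ℝ E] (s : ℝ) (z y : CotangentBundle E M) :
    extChartAt (cotangentModel E) (fiberScale s z) y = extChartAt (cotangentModel E) z y :=
  (extChartAt_cotangent_apply _ _).trans (extChartAt_cotangent_apply z y).symm

theorem extChartAt_apply_fiberScale [FiniteDimensional ℝ E] (s : ℝ) (z y : CotangentBundle E M) :
    extChartAt (cotangentModel E) z (fiberScale s y) =
      ((extChartAt (cotangentModel E) z y).1, s • (extChartAt (cotangentModel E) z y).2) := by
  rw [extChartAt_cotangent_apply, extChartAt_cotangent_apply, covectorCoord_fiberScale]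
  rfl

end TwistDerivative

/-! ### Homogeneity of the geodesic flow and positivity of the injectivity radius. -/

section Scaling

variable {E : Type*} [NormedAddCommGroup E] [NormedSpace ℝ E] [FiniteDimensional ℝ E]
  {M : Type*} [TopologicalSpace M] [ChartedSpace E M] [IsManifold 𝓘(ℝ, E) ∞ M]

theorem mdifferentiableAt_fiberScale (s : ℝ) (z : CotangentBundle E M) :
    MDifferentiableAt (cotangentModel E) (cotangentModel E) (fiberScale s) z :=
  (contMDiff_fiberScale.comp (contMDiff_const (c := s) |>.prodMk contMDiff_id)).mdifferentiable
    (by simp) z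

theorem cotangentMapDeriv_fiberScale (s : ℝ) (z : CotangentBundle E M) (ξ : E × (E →L[ℝ] ℝ)) :
    cotangentMapDeriv (fiberScale s) z ξ = (ξ.1, s • ξ.2) := by
  have d1 := (mdifferentiableAt_fiberScale s z).hasMFDerivAt
  have d2 : HasMFDerivAt (cotangentModel E) 𝓘(ℝ, E × (E →L[ℝ] ℝ))
      (extChartAt (cotangentModel E) (fiberScale s z)) (fiberScale s z)
      (chartDeriv (fiberScale s z) (fiberScale s z)) :=
    (mdifferentiableAt_extChartAt (I := cotangentModel E) (mem_chart_source _ _)).hasMFDerivAt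
  have d3 : HasMFDerivAt (cotangentModel E) 𝓘(ℝ, E × (E →L[ℝ] ℝ))
      (extChartAt (cotangentModel E) z) z (chartDeriv z z) :=
    (mdifferentiableAt_extChartAt (I := cotangentModel E) (mem_chart_source _ z)).hasMFDerivAt
  let L : E × (E →L[ℝ] ℝ) →L[ℝ] E × (E →L[ℝ] ℝ) :=
    (ContinuousLinearMap.id ℝ E).prodMap (s • ContinuousLinearMap.id ℝ (E →L[ℝ] ℝ))
  have d4 : HasMFDerivAt 𝓘(ℝ, E × (E →L[ℝ] ℝ)) 𝓘(ℝ, E × (E →L[ℝ] ℝ)) L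
    (extChartAt (cotangentModel E) z z) L := L.hasFDerivAt.hasMFDerivAt
  have c1 := HasMFDerivAt.comp z d2 d1
  have c2 := HasMFDerivAt.comp z d4 d3
  have heq : extChartAt (cotangentModel E) (fiberScale s z) ∘ fiberScale s =
      L ∘ extChartAt (cotangentModel E) z := by
    funext y
    exact (extChartAt_fiberScale s z _).trans (extChartAt_apply_fiberScale s z y)
  rw [heq] at c1
  have h : chartDeriv (fiberScale s z) (fiberScale s z) (cotangentMapDeriv (fiberScale s) z ξ) =
    L (chartDeriv z z ξ) := DFunLike.congr_fun (hasMFDerivAt_unique c1 c2) ξ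
  rw [chartDeriv_self, chartDeriv_self] at h
  exact h

theorem hasMFDerivAt_fiberScale_curve (z : CotangentBundle E M) (σ : ℝ) :
    HasMFDerivAt 𝓘(ℝ, ℝ) (cotangentModel E) (fun σ ↦ fiberScale σ z) σ
      ((1 : ℝ →L[ℝ] ℝ).smulRight ((0, covectorCoord z.proj z) : E × (E →L[ℝ] ℝ))) := by
  have d1 : MDifferentiableAt 𝓘(ℝ, ℝ) (cotangentModel E) (fun σ ↦ fiberScale σ z) σ :=
    ((contMDiff_fiberScale (E := E) (M := M)).comp
      (contMDiff_id.prodMk (contMDiff_const (c := z)))).mdifferentiable (by simp) σ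
  let X : E × (E →L[ℝ] ℝ) := (mfderiv 𝓘(ℝ, ℝ) (cotangentModel E) (fun σ ↦ fiberScale σ z) σ :
    ℝ →L[ℝ] E × (E →L[ℝ] ℝ)) 1
  have d2 : HasMFDerivAt 𝓘(ℝ, ℝ) (cotangentModel E) (fun σ ↦ fiberScale σ z) σ
      ((1 : ℝ →L[ℝ] ℝ).smulRight X) :=
    d1.hasMFDerivAt.congr_mfderiv (ContinuousLinearMap.ext_ring (one_smul ℝ X).symm)
  have d3 := hasDerivAt_chart_comp (z₀ := fiberScale σ z) (α := fun σ ↦ fiberScale σ z)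
    (mem_extChartAt_source _) d2
  rw [chartDeriv_self] at d3
  have d4 : HasDerivAt (fun t ↦ extChartAt (cotangentModel E) (fiberScale σ z) (fiberScale t z))
      ((0, covectorCoord z.proj z) : E × (E →L[ℝ] ℝ)) σ := by
    have h : (fun t ↦ extChartAt (cotangentModel E) (fiberScale σ z) (fiberScale t z)) = fun t ↦
        (((extChartAt (cotangentModel E) z z).1, t • covectorCoord z.proj z) :
          E × (E →L[ℝ] ℝ)) := by
      funext t
      refine ((extChartAt_fiberScale σ z _).trans (extChartAt_apply_fiberScale t z z)).trans ?_
      rw [extChartAt_cotangent_apply]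
    rw [h]
    have h2 : HasDerivAt (fun t : ℝ ↦ t • covectorCoord z.proj z)
        (covectorCoord z.proj z) σ := by
      simpa using (hasDerivAt_id σ).smul_const (covectorCoord z.proj z)
    exact (hasDerivAt_const σ _).prodMk h2
  have h : X = (0, covectorCoord z.proj z) := d3.unique d4
  rw [← h]
  exact d2

/-- Scaling by `s` multiplies the symplectic form by `s` and the energy by `s ^ 2`; the quotient is
the factor `s`. Invertibility of the scaling is where `s ≠ 0` enters. -/
theorem hamField_kineticEnergy_fiberScale (g : Metric E M) {s : ℝ} (hs : s ≠ 0)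
    (z : CotangentBundle E M) : hamField (kineticEnergy g) (fiberScale s z) =
      s • cotangentMapDeriv (fiberScale s) z (hamField (kineticEnergy g) z) := by
  refine stdSymplectic_injective fun b ↦ ?_
  have hsmooth := (contMDiff_kineticEnergy g).mdifferentiable (by simp)
  have h1 : ∀ ξ, cotangentDiff (kineticEnergy g) (fiberScale s z)
      (cotangentMapDeriv (fiberScale s) z ξ) = s ^ 2 * cotangentDiff (kineticEnergy g) z ξ := by
    intro ξ
    have d1 := HasMFDerivAt.comp z (hsmooth (fiberScale s z)).hasMFDerivAt
      (mdifferentiableAt_fiberScale s z).hasMFDerivAt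
    have d2 : HasMFDerivAt (cotangentModel E) 𝓘(ℝ, ℝ) (fun y ↦ s ^ 2 * kineticEnergy g y) z
      (s ^ 2 • cotangentDiff (kineticEnergy g) z) :=
      HasMFDerivAt.const_smul (hsmooth z).hasMFDerivAt (s ^ 2)
    have heq : kineticEnergy g ∘ fiberScale s = fun y ↦ s ^ 2 * kineticEnergy g y :=
      funext (kineticEnergy_fiberScale g s)
    rw [heq] at d1
    exact DFunLike.congr_fun (hasMFDerivAt_unique d1 d2) ξ
  have h2 : cotangentMapDeriv (fiberScale s) z (b.1, s⁻¹ • b.2) = b := by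
    rw [cotangentMapDeriv_fiberScale]
    simp [smul_smul, mul_inv_cancel₀ hs]
  have h3 := h1 (b.1, s⁻¹ • b.2)
  have h4 := stdSymplectic_hamLift (cotangentDiff (kineticEnergy g) z) (b.1, s⁻¹ • b.2)
  rw [h2, ← h4] at h3
  refine (stdSymplectic_hamLift (cotangentDiff (kineticEnergy g) (fiberScale s z)) b).trans
    (h3.trans ?_)
  rw [cotangentMapDeriv_fiberScale]
  simp only [stdSymplectic, hamField, Prod.smul_mk, smul_apply, smul_eq_mul,
    map_smul]
  field_simp

variable [T2Space M] [CompactSpace M]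

/-- For `s ≠ 0` both sides are integral curves in `t` with the same start; `s = 0` follows by
continuity. -/
theorem geodesicFlow_fiberScale (g : Metric E M) (t s : ℝ) (z : CotangentBundle E M) :
    geodesicFlow g t (fiberScale s z) = fiberScale s (geodesicFlow g (t * s) z) := by
  have hs : ∀ s : ℝ, s ≠ 0 → geodesicFlow g t (fiberScale s z) =
      fiberScale s (geodesicFlow g (t * s) z) := by
    intro s hs
    have h1 : IsMIntegralCurve (I := cotangentModel E) (fun t ↦ fiberScale s
        (geodesicFlow g (t * s) z)) (hamField (kineticEnergy g)) := by
      intro t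
      have h2 := ((isFlow_geodesicFlow g).curve z).comp_mul s t
      have h3 := hasMFDerivAt_comp_curve (α := fun t ↦ geodesicFlow g (t * s) z)
        (mdifferentiableAt_fiberScale s _) h2
      refine h3.congr_mfderiv (ContinuousLinearMap.ext_ring ?_)
      have h4 := hamField_kineticEnergy_fiberScale g hs (geodesicFlow g (t * s) z)
      have h5 : cotangentMapDeriv (fiberScale s) (geodesicFlow g (t * s) z)
        (s • hamField (kineticEnergy g) (geodesicFlow g (t * s) z)) =
          hamField (kineticEnergy g) (fiberScale s (geodesicFlow g (t * s) z)) := by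
        rw [h4, map_smul]
      exact congrArg (fun w ↦ (1 : ℝ) • w) h5
    have h6 := isMIntegralCurve_Ioo_eq_of_contMDiff_boundaryless (t₀ := 0)
      (smoothField_hamField (contMDiff_kineticEnergy g)).contMDiff_one
      ((isFlow_geodesicFlow g).curve (fiberScale s z)) h1 (by
        simp only [zero_mul, geodesicFlow_zero])
    exact congrFun h6 t
  have hf := contMDiff_fiberScale (E := E) (M := M)
  have hcont1 : Continuous fun s : ℝ ↦ geodesicFlow g t (fiberScale s z) :=
    (contMDiff_geodesicFlow_time g t).continuous.comp
      (hf.continuous.comp (Continuous.prodMk_left z))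
  have hcont2 : Continuous fun s : ℝ ↦ fiberScale s (geodesicFlow g (t * s) z) :=
    hf.continuous.comp (continuous_id.prodMk
      ((contMDiff_geodesicFlow g).continuous.comp
        ((continuous_const.mul continuous_id).prodMk continuous_const)))
  exact congrFun (Continuous.ext_on (dense_compl_singleton (0 : ℝ)) hcont1 hcont2
    fun s h ↦ hs s h) s

theorem fiberScale_zero_eq {z z₀ : CotangentBundle E M} (hz₀ : z₀ ∈ zeroSection E M)
    (h : z.proj = z₀.proj) : fiberScale 0 z = z₀ := by
  obtain ⟨q, p⟩ := z
  obtain ⟨q₀, p₀⟩ := z₀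
  have h' : q = q₀ := h
  subst h'
  have h2 : p₀ = 0 := hz₀
  rw [h2]
  exact congrArg (TotalSpace.mk q) (zero_smul ℝ (p : E →L[ℝ] ℝ))

/-- The exponential map is an immersion along the zero section. -/
theorem injective_twistDeriv_geodesicFlow_zeroSection (g : Metric E M) {z₀ : CotangentBundle E M}
    (hz₀ : z₀ ∈ zeroSection E M) : Function.Injective (twistDeriv (geodesicFlow g 1) z₀) := by
  have hsm : ∀ z, MDifferentiableAt (cotangentModel E) (cotangentModel E) (geodesicFlow g 1) z :=
    (contMDiff_geodesicFlow_time g 1).mdifferentiable (by simp)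
  rw [injective_twistDeriv_iff (hsm z₀)]
  intro β hβ
  let z : CotangentBundle E M := ⟨z₀.proj, β⟩
  have hz : fiberScale 0 z = z₀ := fiberScale_zero_eq hz₀ rfl
  have hcurve : ∀ σ, HasMFDerivAt 𝓘(ℝ, ℝ) (cotangentModel E) (fun σ ↦ fiberScale σ z) σ
      ((1 : ℝ →L[ℝ] ℝ).smulRight ((0, β) : E × (E →L[ℝ] ℝ))) := fun σ ↦
    (hasMFDerivAt_fiberScale_curve z σ).congr_mfderiv (congrArg (fun c : E →L[ℝ] ℝ ↦
      (1 : ℝ →L[ℝ] ℝ).smulRight ((0, c) : E × (E →L[ℝ] ℝ))) (covectorCoord_self z))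
  -- the velocity of the geodesic of `z`
  have d1 : HasMFDerivAt 𝓘(ℝ, ℝ) (cotangentModel E)
      (fun σ ↦ geodesicFlow g 1 (fiberScale σ z)) 0
      ((1 : ℝ →L[ℝ] ℝ).smulRight (cotangentMapDeriv (geodesicFlow g 1) z₀ (0, β))) := by
    have h := hasMFDerivAt_comp_curve (hsm _) (hcurve 0)
    rw [hz] at h
    exact h
  have d2 := HasMFDerivAt.comp (0 : ℝ) (hasMFDerivAt_proj _) d1
  have d3 := HasMFDerivAt.comp (0 : ℝ) (hasMFDerivAt_proj _) ((isFlow_geodesicFlow g).curve z 0)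
  -- By homogeneity `σ ↦ π(h₀¹(σ z))` is the geodesic of `z`, so the derivative at `z₀` in direction
  -- `β` has horizontal part equal to the initial velocity of that geodesic. It pairs with `β` to
  -- `‖β‖²`.
  have heq : (fun y : CotangentBundle E M ↦ y.proj) ∘ (fun σ ↦ geodesicFlow g 1 (fiberScale σ z)) =
      (fun y : CotangentBundle E M ↦ y.proj) ∘ fun t ↦ geodesicFlow g t z := by
    funext σ
    change (geodesicFlow g 1 (fiberScale σ z)).proj = _
    rw [geodesicFlow_fiberScale, one_mul]
    rfl
  rw [heq] at d2
  have h1 : (1 : ℝ) • (cotangentMapDeriv (geodesicFlow g 1) z₀ (0, β)).1 =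
      (1 : ℝ) • (hamField (kineticEnergy g) (geodesicFlow g 0 z)).1 :=
    DFunLike.congr_fun (hasMFDerivAt_unique d2 d3) (1 : ℝ)
  rw [hβ, smul_zero, one_smul, geodesicFlow_zero] at h1
  -- Euler's identity
  have h2 : β (hamField (kineticEnergy g) z).1 = cotangentDiff (kineticEnergy g) z (0, β) :=
    hamLift_fst _ β
  have d4 := hasDerivAt_comp_of_hasMFDerivAt (f := kineticEnergy g) (α := fun σ ↦ fiberScale σ z)
    ((contMDiff_kineticEnergy g).mdifferentiable (by simp) _) (hcurve 1)
  have d5 : HasDerivAt (fun σ : ℝ ↦ kineticEnergy g (fiberScale σ z)) (2 * kineticEnergy g z)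
      1 := by
    have h : (fun σ : ℝ ↦ kineticEnergy g (fiberScale σ z)) =
        fun σ ↦ σ ^ 2 * kineticEnergy g z := funext fun σ ↦ kineticEnergy_fiberScale g σ z
    rw [h]
    simpa using (hasDerivAt_pow 2 (1 : ℝ)).mul_const (kineticEnergy g z)
  have h3 := d4.unique d5
  rw [fiberScale_one] at h3
  have h4 : cotangentDiff (kineticEnergy g) z (0, β) = 2 * kineticEnergy g z := h3
  rw [← h2, ← h1, map_zero] at h4
  have h5 : covectorNorm g z = 0 := by
    rw [covectorNorm_eq_sqrt, ← h4, Real.sqrt_zero]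
  exact (covectorNorm_eq_zero_iff g z).1 h5

/-- On the compact part of `{‖p‖ ≤ 1}` outside the interior of `t` the norm has a positive lower
bound, as its zeros form the zero section. -/
theorem exists_pos_covectorNorm_lt_subset (g : Metric E M) {t : Set (CotangentBundle E M)}
    (ht : t ∈ 𝓝ˢ (zeroSection E M)) : ∃ r > 0, ∀ z, covectorNorm g z < r → z ∈ t := by
  have hK : IsCompact ({z : CotangentBundle E M | covectorNorm g z ≤ 1} \ interior t) :=
    (isCompact_covectorNorm_le g 1).diff isOpen_interior
  obtain ⟨m, hm, hle⟩ := hK.exists_forall_le' (a := 0) (continuous_covectorNorm g).continuousOn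
    (fun z hz ↦ lt_of_le_of_ne (covectorNorm_nonneg g z) fun h ↦ hz.2
      (subset_interior_iff_mem_nhdsSet.2 ht ((covectorNorm_eq_zero_iff g z).1 h.symm)))
  refine ⟨min m 1, lt_min hm one_pos, fun z hz ↦ ?_⟩
  by_contra hzt
  exact absurd (hle z ⟨(hz.trans_le (min_le_right _ _)).le, fun h ↦ hzt (interior_subset h)⟩)
    (not_le.2 (hz.trans_le (min_le_left _ _)))

theorem isCompact_zeroSection (g : Metric E M) : IsCompact (zeroSection E M) := by
  have h : zeroSection E M = {z | covectorNorm g z ≤ 0} := by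
    ext z
    rw [← covectorNorm_eq_zero_iff g]
    exact ⟨fun h ↦ h.le, fun h ↦ le_antisymm h (covectorNorm_nonneg g z)⟩
  rw [h]
  exact isCompact_covectorNorm_le g 0

/-- The injectivity radius of a compact manifold is positive. -/
theorem exists_injOn_twistMap_geodesicFlow (g : Metric E M) : ∃ r > 0,
    InjOn (twistMap (geodesicFlow g 1)) {z | covectorNorm g z < r} ∧
    ∀ z, covectorNorm g z < r → Function.Injective (twistDeriv (geodesicFlow g 1) z) := by
  obtain ⟨t, ht, hinj, himm⟩ := exists_injOn_nhdsSet_of_injective_mfderiv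
    (isCompact_zeroSection g) (fun z _ ↦ contMDiff_twistMap (contMDiff_geodesicFlow_time g 1) z) (by
      intro z hz z' hz' h
      have h1 : z.proj = z'.proj := congrArg Prod.fst h
      rw [← fiberScale_zero_eq hz' h1, fiberScale_zero_eq hz rfl])
    (fun z hz ↦ injective_twistDeriv_geodesicFlow_zeroSection g hz)
  obtain ⟨r, hr, hrt⟩ := exists_pos_covectorNorm_lt_subset g ht
  exact ⟨r, hr, hinj.mono fun z hz ↦ hrt z hz, fun z hz ↦ himm z (hrt z hz)⟩

end Scaling

/-! ### Cutting off a Hamiltonian in space and reparametrizing time. -/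

section Cutoff

variable {E : Type*} [NormedAddCommGroup E] [NormedSpace ℝ E] [FiniteDimensional ℝ E]
  {M : Type*} [TopologicalSpace M] [ChartedSpace E M] [IsManifold 𝓘(ℝ, E) ∞ M]
  {H : ℝ → CotangentBundle E M → ℝ} {W : Set (CotangentBundle E M)}

/-- The Hamiltonian `H`, cut off in space and reparametrized in time by the smooth transition
function, whose derivative vanishes outside of the unit interval. -/
def cutoffHamiltonian (χ : CotangentBundle E M → ℝ) (H : ℝ → CotangentBundle E M → ℝ) (t : ℝ)
    (z : CotangentBundle E M) : ℝ :=
  deriv Real.smoothTransition t * (χ z * H (Real.smoothTransition t) z)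

theorem smoothTransition_mem_Icc (t : ℝ) : Real.smoothTransition t ∈ Icc (0 : ℝ) 1 :=
  ⟨Real.smoothTransition.nonneg t, Real.smoothTransition.le_one t⟩

theorem contDiff_deriv_smoothTransition : ContDiff ℝ ∞ (deriv Real.smoothTransition) :=
  ((contDiff_succ_iff_deriv (n := ∞) (f := Real.smoothTransition)).1
    (Real.smoothTransition.contDiff (n := ⊤))).2.2

theorem deriv_smoothTransition_eq_zero {t : ℝ} (ht : t ∉ Icc (0 : ℝ) 1) :
    deriv Real.smoothTransition t = 0 := by
  rcases not_and_or.1 ht with h | h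
  · have : Real.smoothTransition =ᶠ[𝓝 t] fun _ ↦ 0 := by
      filter_upwards [Iio_mem_nhds (not_le.1 h)] with s hs
      exact Real.smoothTransition.zero_of_nonpos hs.le
    rw [this.deriv_eq, deriv_const]
  · have : Real.smoothTransition =ᶠ[𝓝 t] fun _ ↦ 1 := by
      filter_upwards [Ioi_mem_nhds (not_le.1 h)] with s hs
      exact Real.smoothTransition.one_of_one_le hs.le
    rw [this.deriv_eq, deriv_const]

/-- `Real.smoothTransition` sends all of `ℝ` into `[0, 1]`, so smoothness of `H` on the closed time
interval is enough for smoothness at every time. -/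
theorem smoothHamiltonian_cutoff [T2Space M] (hW : IsOpen W)
    (hH : ContMDiffOn (suspModel E) 𝓘(ℝ, ℝ) ∞
      (fun x : ℝ × CotangentBundle E M ↦ H x.1 x.2) (Icc (0 : ℝ) 1 ×ˢ W))
    {χ : CotangentBundle E M → ℝ} (hχ : ContMDiff (cotangentModel E) 𝓘(ℝ, ℝ) ∞ χ)
    {L : Set (CotangentBundle E M)} (hL : IsCompact L) (hLW : L ⊆ W) (hχL : ∀ z ∉ L, χ z = 0) :
    SmoothHamiltonian (cutoffHamiltonian χ H) := by
  rintro ⟨t, z⟩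
  by_cases hz : z ∈ L
  · have h1 : ContMDiffOn (suspModel E) 𝓘(ℝ, ℝ) ∞
        (fun x : ℝ × CotangentBundle E M ↦ H (Real.smoothTransition x.1) x.2) (univ ×ˢ W) := by
      refine hH.comp (f := fun x : ℝ × CotangentBundle E M ↦ (Real.smoothTransition x.1, x.2))
        (ContMDiff.contMDiffOn ?_) fun x hx ↦ ⟨smoothTransition_mem_Icc x.1, hx.2⟩
      exact (Real.smoothTransition.contDiff.contMDiff.comp contMDiff_fst).prodMk contMDiff_snd
    have h2 := h1.contMDiffAt ((isOpen_univ.prod hW).mem_nhds ⟨trivial, hLW hz⟩ :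
      univ ×ˢ W ∈ 𝓝 (t, z))
    have h3 : ContMDiff (suspModel E) 𝓘(ℝ, ℝ) ∞
        (fun x : ℝ × CotangentBundle E M ↦ deriv Real.smoothTransition x.1) :=
      contDiff_deriv_smoothTransition.contMDiff.comp contMDiff_fst
    exact (h3 (t, z)).mul ((hχ.comp contMDiff_snd (t, z)).mul h2)
  · have h : (fun p : ℝ × CotangentBundle E M ↦ cutoffHamiltonian χ H p.1 p.2) =ᶠ[𝓝 (t, z)]
        fun _ ↦ 0 := by
      filter_upwards [continuousAt_snd.eventually (hL.isClosed.isOpen_compl.mem_nhds hz)] with p hp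
      unfold cutoffHamiltonian
      rw [hχL _ hp, zero_mul, mul_zero]
    exact contMDiffAt_const.congr_of_eventuallyEq h

theorem hamField_eq_zero {K : CotangentBundle E M → ℝ} {z : CotangentBundle E M}
    (h : K =ᶠ[𝓝 z] fun _ ↦ 0) : hamField K z = 0 := by
  have h1 : cotangentDiff K z = 0 :=
    h.mfderiv_eq.trans (mfderiv_const (I := cotangentModel E) (x := z))
  unfold hamField
  rw [h1, map_zero]

theorem mdifferentiableAt_of_contMDiffOn_time (hW : IsOpen W)
    (hH : ContMDiffOn (suspModel E) 𝓘(ℝ, ℝ) ∞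
      (fun x : ℝ × CotangentBundle E M ↦ H x.1 x.2) (Icc (0 : ℝ) 1 ×ˢ W)) {t : ℝ}
    (ht : t ∈ Icc (0 : ℝ) 1) {z : CotangentBundle E M} (hz : z ∈ W) :
    MDifferentiableAt (cotangentModel E) 𝓘(ℝ, ℝ) (H t) z := by
  have h : ContMDiffOn (cotangentModel E) 𝓘(ℝ, ℝ) ∞ (H t) W :=
    hH.comp (f := fun z : CotangentBundle E M ↦ (t, z))
      (contMDiff_const.prodMk contMDiff_id).contMDiffOn fun z hz ↦ ⟨ht, hz⟩
  exact (h.contMDiffAt (hW.mem_nhds hz)).mdifferentiableAt (by simp)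

theorem hamField_cutoffHamiltonian {χ : CotangentBundle E M → ℝ} {t : ℝ} {z : CotangentBundle E M}
    (hHz : MDifferentiableAt (cotangentModel E) 𝓘(ℝ, ℝ) (H (Real.smoothTransition t)) z)
    (hχ : ∀ᶠ y in 𝓝 z, χ y = 1) : hamField (cutoffHamiltonian χ H t) z =
      deriv Real.smoothTransition t • hamField (H (Real.smoothTransition t)) z := by
  have h1 : cutoffHamiltonian χ H t =ᶠ[𝓝 z]
      fun y ↦ deriv Real.smoothTransition t * H (Real.smoothTransition t) y := by
    filter_upwards [hχ] with y hy
    unfold cutoffHamiltonian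
    rw [hy, one_mul]
  have h2 : HasMFDerivAt (cotangentModel E) 𝓘(ℝ, ℝ)
      (fun y ↦ deriv Real.smoothTransition t * H (Real.smoothTransition t) y) z
      (deriv Real.smoothTransition t • cotangentDiff (H (Real.smoothTransition t)) z) :=
    HasMFDerivAt.const_smul hHz.hasMFDerivAt _
  have h3 : cotangentDiff (cutoffHamiltonian χ H t) z =
      deriv Real.smoothTransition t • cotangentDiff (H (Real.smoothTransition t)) z :=
    (h2.congr_of_eventuallyEq h1).mfderiv
  unfold hamField
  rw [h3, map_smul]

/-- `c` is a solution, at the times in `s`, of the equations of motion of `H`, reparametrized by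
the smooth transition function. -/
def IsReparametrizedCurveOn (H : ℝ → CotangentBundle E M → ℝ) (c : ℝ → CotangentBundle E M)
    (s : Set ℝ) : Prop :=
  ∀ t ∈ s, HasMFDerivAt 𝓘(ℝ, ℝ) (cotangentModel E) c t ((1 : ℝ →L[ℝ] ℝ).smulRight
    (deriv Real.smoothTransition t • hamField (H (Real.smoothTransition t)) (c t)))

/-- The curve has only one-sided derivatives at times `0` and `1`. The new time never leaves `[0,
1]`, so the chain rule within that interval yields genuine derivatives on `ℝ`. -/
theorem IsHamiltonianCurveOn.reparametrize {γ : ℝ → CotangentBundle E M}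
    (hγ : IsHamiltonianCurveOn H γ (Icc 0 1)) :
    IsReparametrizedCurveOn H (fun t ↦ γ (Real.smoothTransition t)) univ := by
  intro t _
  have h1 := isHamiltonianCurveOn_iff.1 hγ _ (smoothTransition_mem_Icc t)
  have h2 : HasDerivAt Real.smoothTransition (deriv Real.smoothTransition t) t :=
    ((Real.smoothTransition.contDiff (n := 1)).differentiable (by simp) t).hasDerivAt
  have h3 : HasMFDerivWithinAt 𝓘(ℝ, ℝ) 𝓘(ℝ, ℝ) Real.smoothTransition univ t
      (ContinuousLinearMap.toSpanSingleton ℝ (deriv Real.smoothTransition t)) :=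
    h2.hasFDerivAt.hasMFDerivAt.hasMFDerivWithinAt
  have h4 := hasMFDerivWithinAt_univ.1
    (HasMFDerivWithinAt.comp t h1 h3 fun s _ ↦ smoothTransition_mem_Icc s)
  refine h4.congr_mfderiv (ContinuousLinearMap.ext_ring ?_)
  have h5 : ∀ (a : ℝ) (X : E × (E →L[ℝ] ℝ)), ((1 : ℝ) * a) • X = (1 : ℝ) • a • X := fun a X ↦ by
    rw [one_mul, one_smul]
  exact h5 _ _

theorem IsReparametrizedCurveOn.isMIntegralCurveOn {c : ℝ → CotangentBundle E M} {s : Set ℝ}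
    (hc : IsReparametrizedCurveOn H c s) (hW : IsOpen W)
    (hH : ContMDiffOn (suspModel E) 𝓘(ℝ, ℝ) ∞
      (fun x : ℝ × CotangentBundle E M ↦ H x.1 x.2) (Icc (0 : ℝ) 1 ×ˢ W))
    {χ : CotangentBundle E M → ℝ} (hcW : ∀ t ∈ s, c t ∈ W)
    (hχ : ∀ t ∈ s, ∀ᶠ y in 𝓝 (c t), χ y = 1) {t : ℝ} (ht : t ∈ s) :
    HasMFDerivAt 𝓘(ℝ, ℝ) (suspModel E) (fun t ↦ (t, c t)) t
      ((1 : ℝ →L[ℝ] ℝ).smulRight (suspField (cutoffHamiltonian χ H) (t, c t))) := by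
  have h1 := (hasMFDerivAt_id (I := 𝓘(ℝ, ℝ)) t).prodMk (hc t ht)
  refine h1.congr_mfderiv (ContinuousLinearMap.ext_ring ?_)
  have h2 := hamField_cutoffHamiltonian (H := H) (χ := χ) (t := t)
    (mdifferentiableAt_of_contMDiffOn_time hW hH (smoothTransition_mem_Icc t) (hcW t ht)) (hχ t ht)
  have h3 : ∀ X Y : E × (E →L[ℝ] ℝ), Y = X →
      (((1 : ℝ), (1 : ℝ) • X) : ℝ × (E × (E →L[ℝ] ℝ))) = (1 : ℝ) • ((1 : ℝ), Y) := by
    rintro X _ rfl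
    simp
  exact h3 _ _ h2

variable [T2Space M]

/-- The field is `(1, 0)` unless the time lies in `[0, 1]` and the point in `L`. From a start
outside `Icc (-1) 2 ×ˢ L` the curve therefore keeps `z` fixed for at least unit time, which gives
completeness. -/
theorem exists_flow_cutoffHamiltonian {χ : CotangentBundle E M → ℝ}
    (hK : SmoothHamiltonian (cutoffHamiltonian χ H)) {L : Set (CotangentBundle E M)}
    (hL : IsCompact L) (hχL : ∀ z ∉ L, χ z = 0) :
    ∃ Φ, IsFlow (suspModel E) (suspField (cutoffHamiltonian χ H)) Φ ∧
      ∀ r s, ∀ z ∉ L, Φ r (s, z) = (s + r, z) := by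
  have hstat : ∀ s z, (z ∈ L → s ∉ Icc (0 : ℝ) 1) →
      suspField (cutoffHamiltonian χ H) (s, z) = (1, 0) := by
    intro s z h
    refine Prod.ext rfl (hamField_eq_zero ?_)
    by_cases hz : z ∈ L
    · refine Filter.Eventually.of_forall fun y ↦ ?_
      unfold cutoffHamiltonian
      rw [deriv_smoothTransition_eq_zero (h hz), zero_mul]
    · filter_upwards [hL.isClosed.isOpen_compl.mem_nhds hz] with y hy
      unfold cutoffHamiltonian
      rw [hχL y hy, zero_mul, mul_zero]
  have hcurve : ∀ (s : ℝ) (z : CotangentBundle E M) (r : ℝ),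
      (z ∈ L → s + r ∉ Icc (0 : ℝ) 1) →
      HasMFDerivAt 𝓘(ℝ, ℝ) (suspModel E) (fun r ↦ (s + r, z)) r ((1 : ℝ →L[ℝ] ℝ).smulRight
        (suspField (cutoffHamiltonian χ H) (s + r, z))) := by
    intro s z r h
    have h1 : HasMFDerivAt 𝓘(ℝ, ℝ) 𝓘(ℝ, ℝ) (fun r ↦ s + r) r (1 : ℝ →L[ℝ] ℝ) :=
      ((hasFDerivAt_id r).const_add s).hasMFDerivAt
    have h2 := hasMFDerivAt_const (I := 𝓘(ℝ, ℝ)) (I' := cotangentModel E) z r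
    refine (h1.prodMk h2).congr_mfderiv (ContinuousLinearMap.ext_ring ?_)
    have h3 : ∀ Y : ℝ × (E × (E →L[ℝ] ℝ)), Y = (1, 0) →
        (((1 : ℝ), (0 : E × (E →L[ℝ] ℝ))) : ℝ × (E × (E →L[ℝ] ℝ))) = (1 : ℝ) • Y := by
      rintro _ rfl
      simp
    exact h3 _ (hstat _ _ h)
  have hex := hK.smoothField.exists_isMIntegralCurve
    (C := Icc (-1 : ℝ) 2 ×ˢ L) (isCompact_Icc.prod hL) one_pos (by
      rintro ⟨s, z⟩ hsz
      refine ⟨fun r ↦ (s + r, z), by simp only [add_zero],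
        fun r hr ↦ (hcurve s z r ?_).hasMFDerivWithinAt⟩
      intro hz hsr
      exact hsz ⟨⟨by linarith [hsr.1, hr.2], by linarith [hsr.2, hr.1]⟩, hz⟩)
  choose γ hγ0 hγ using hex
  have hΦ : IsFlow (suspModel E) (suspField (cutoffHamiltonian χ H)) (fun r p ↦ γ p r) :=
    ⟨hγ0, hγ⟩
  refine ⟨_, hΦ, fun r s z hz ↦ ?_⟩
  have h1 := isMIntegralCurve_Ioo_eq_of_contMDiff_boundaryless (t₀ := 0)
    hK.smoothField.contMDiff_one (hΦ.curve (s, z))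
    (γ' := fun r ↦ (s + r, z)) (fun r ↦ hcurve s z r fun h ↦ absurd h hz) (by
      simp only [add_zero, hγ0])
  exact congrFun h1 r

variable [CompactSpace M]

theorem exists_cutoff {A O : Set (CotangentBundle E M)} (hA : IsCompact A) (hO : IsOpen O)
    (hAO : A ⊆ O) : ∃ χ : CotangentBundle E M → ℝ, ∃ L : Set (CotangentBundle E M),
      ContMDiff (cotangentModel E) 𝓘(ℝ, ℝ) ∞ χ ∧ IsCompact L ∧ L ⊆ O ∧ (∀ z ∉ L, χ z = 0) ∧
      ∀ᶠ z in 𝓝ˢ A, χ z = 1 := by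
  obtain ⟨L, hL, hAL, hLO⟩ := exists_compact_between hA hO hAO
  obtain ⟨f, hf1, hf0, -⟩ := exists_contMDiffMap_one_nhds_of_subset_interior (n := ⊤)
    (cotangentModel E) hA.isClosed hAL
  exact ⟨f, L, f.contMDiff, hL, hLO, hf0, hf1⟩

/-- Both curves trace compact subsets of `W`. With a cutoff equal to one near both, they become
integral curves of one global smooth field, whose uniqueness theorem applies. -/
theorem IsReparametrizedCurveOn.eqOn {c₁ c₂ : ℝ → CotangentBundle E M} (hW : IsOpen W)
    (hH : ContMDiffOn (suspModel E) 𝓘(ℝ, ℝ) ∞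
      (fun x : ℝ × CotangentBundle E M ↦ H x.1 x.2) (Icc (0 : ℝ) 1 ×ˢ W))
    (h₁ : IsReparametrizedCurveOn H c₁ (Icc (-1) 2))
    (h₂ : IsReparametrizedCurveOn H c₂ (Icc (-1) 2))
    (hc₁ : ∀ t ∈ Icc (-1 : ℝ) 2, c₁ t ∈ W) (hc₂ : ∀ t ∈ Icc (-1 : ℝ) 2, c₂ t ∈ W)
    (h0 : c₁ 0 = c₂ 0) : EqOn c₁ c₂ (Ioo (-1) 2) := by
  have hcomp : ∀ {c : ℝ → CotangentBundle E M}, IsReparametrizedCurveOn H c (Icc (-1) 2) →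
      IsCompact (c '' Icc (-1) 2) := fun h ↦
    isCompact_Icc.image_of_continuousOn fun t ht ↦ (h t ht).continuousAt.continuousWithinAt
  obtain ⟨χ, L, hχ, hL, hLW, hχL, hχ1⟩ := exists_cutoff ((hcomp h₁).union (hcomp h₂)) hW (by
    rintro _ (⟨t, ht, rfl⟩ | ⟨t, ht, rfl⟩)
    exacts [hc₁ t ht, hc₂ t ht])
  have hK := smoothHamiltonian_cutoff hW hH hχ hL hLW hχL
  have hχ1' := eventually_nhdsSet_iff_forall.1 hχ1
  have h3 := isMIntegralCurveOn_Ioo_eqOn_of_contMDiff_boundaryless (I := suspModel E)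
    (a := -1) (b := 2) (γ := fun t ↦ (t, c₁ t)) (γ' := fun t ↦ (t, c₂ t)) (t₀ := 0)
    (by norm_num) hK.smoothField.contMDiff_one
    (fun t ht ↦ (h₁.isMIntegralCurveOn hW hH hc₁
      (fun t ht ↦ hχ1' _ (Or.inl (mem_image_of_mem _ ht)))
      (Ioo_subset_Icc_self ht)).hasMFDerivWithinAt)
    (fun t ht ↦ (h₂.isMIntegralCurveOn hW hH hc₂
      (fun t ht ↦ hχ1' _ (Or.inr (mem_image_of_mem _ ht)))
      (Ioo_subset_Icc_self ht)).hasMFDerivWithinAt)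
    (by rw [h0])
  exact fun t ht ↦ congrArg Prod.snd (h3 ht)

end Cutoff

/-! ### Extension of the isotopy to the whole cotangent bundle. -/

section Isotopy

variable {E : Type*} [NormedAddCommGroup E] [NormedSpace ℝ E] [FiniteDimensional ℝ E]
  {M : Type*} [TopologicalSpace M] [ChartedSpace E M] [IsManifold 𝓘(ℝ, E) ∞ M]
  [T2Space M] [CompactSpace M]
  {H : ℝ → CotangentBundle E M → ℝ} {W U : Set (CotangentBundle E M)}
  {G : ℝ → CotangentBundle E M → CotangentBundle E M}

theorem IsHamiltonianFlowOn.reparametrize (hG : IsHamiltonianFlowOn H W U G)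
    {z : CotangentBundle E M} (hz : z ∈ U) (s : Set ℝ) :
    IsReparametrizedCurveOn H (fun t ↦ G (Real.smoothTransition t) z) s :=
  fun t _ ↦ (hG.curve z hz).reparametrize t trivial

theorem IsHamiltonianFlowOn.continuousOn_orbit (hG : IsHamiltonianFlowOn H W U G)
    {z : CotangentBundle E M} (hz : z ∈ U) : ContinuousOn (fun t ↦ G t z) (Icc 0 1) := by
  intro t ht
  exact (isHamiltonianCurveOn_iff.1 (hG.curve z hz) t ht).continuousWithinAt

/-- `G` is given orbit by orbit. Near `z₀` it is compared with the smooth flow of `H` cut off near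
the orbit of `z₀`: nearby lines of that flow stay where the cutoff is one, hence are orbits of `H`
and agree with `G`. The outcome is compactness of the union of orbits. -/
theorem IsHamiltonianFlowOn.continuousOn_reparametrized (hG : IsHamiltonianFlowOn H W U G)
    (hW : IsOpen W) (hH : ContMDiffOn (suspModel E) 𝓘(ℝ, ℝ) ∞
      (fun x : ℝ × CotangentBundle E M ↦ H x.1 x.2) (Icc (0 : ℝ) 1 ×ˢ W)) :
    ContinuousOn (fun p : ℝ × CotangentBundle E M ↦ G (Real.smoothTransition p.1) p.2)
      (Icc 0 1 ×ˢ U) := by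
  rintro ⟨t₀, z₀⟩ ⟨ht₀, hz₀⟩
  have hA : IsCompact ((fun t ↦ G t z₀) '' Icc 0 1) :=
    isCompact_Icc.image_of_continuousOn (hG.continuousOn_orbit hz₀)
  obtain ⟨χ, L, hχ, hL, hLW, hχL, hχ1⟩ := exists_cutoff hA hW (by
    rintro _ ⟨t, ht, rfl⟩
    exact hG.mem t ht z₀ hz₀)
  have hK := smoothHamiltonian_cutoff hW hH hχ hL hLW hχL
  obtain ⟨Φ, hΦ, -⟩ := exists_flow_cutoffHamiltonian hK hL hχL
  have hΦc : Continuous fun p : ℝ × CotangentBundle E M ↦ (Φ p.1 (0, p.2)).2 :=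
    (contMDiff_suspFlow_snd hK hΦ).continuous.comp
      (continuous_fst.prodMk (continuous_const.prodMk continuous_snd))
  have hχ1' := eventually_nhdsSet_iff_forall.1 hχ1
  -- the flow of the cut off Hamiltonian through `z₀` is the given one
  have hγ : ∀ t, Φ t (0, z₀) = (t, G (Real.smoothTransition t) z₀) := by
    have h1 := isMIntegralCurve_Ioo_eq_of_contMDiff_boundaryless (t₀ := 0)
      hK.smoothField.contMDiff_one (hΦ.curve (0, z₀))
      (γ' := fun t ↦ (t, G (Real.smoothTransition t) z₀))
      (fun t ↦ (hG.reparametrize hz₀ univ).isMIntegralCurveOn hW hH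
        (fun t _ ↦ hG.mem _ (smoothTransition_mem_Icc t) z₀ hz₀)
        (fun t _ ↦ hχ1' _ (mem_image_of_mem _ (smoothTransition_mem_Icc t))) (mem_univ t))
      (by simp only [hΦ.zero, Real.smoothTransition.zero, hG.init z₀ hz₀])
    exact fun t ↦ congrFun h1 t
  -- nearby flow lines stay where the cutoff function is one
  let O : Set (CotangentBundle E M) := interior {y | χ y = 1} ∩ W
  have hO : IsOpen O := isOpen_interior.inter hW
  obtain ⟨u, v, -, hv, hu, hz₀v, huv⟩ := generalized_tube_lemma (s := Icc (-1 : ℝ) 2)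
    (t := {z₀}) isCompact_Icc isCompact_singleton (hO.preimage hΦc) (by
      rintro ⟨t, z⟩ ⟨-, rfl⟩
      change (Φ t (0, z)).2 ∈ O
      rw [hγ]
      exact ⟨mem_interior_iff_mem_nhds.2
        (hχ1' _ (mem_image_of_mem _ (smoothTransition_mem_Icc t))),
        hG.mem _ (smoothTransition_mem_Icc t) z hz₀⟩)
  have hv' : ∀ᶠ p in 𝓝[Icc (0 : ℝ) 1 ×ˢ U] (t₀, z₀), p.2 ∈ v :=
    (continuousAt_snd.eventually (hv.mem_nhds (singleton_subset_iff.1 hz₀v))).filter_mono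
      nhdsWithin_le_nhds
  refine hΦc.continuousAt.continuousWithinAt.congr_of_eventuallyEq ?_ ?_
  · filter_upwards [hv', self_mem_nhdsWithin] with p hpv hp
    have hmem : ∀ t ∈ Icc (-1 : ℝ) 2, (Φ t (0, p.2)).2 ∈ O := fun t ht ↦
      huv (mk_mem_prod (hu ht) hpv)
    have h1 : IsReparametrizedCurveOn H (fun t ↦ (Φ t (0, p.2)).2) (Icc (-1) 2) := by
      intro t ht
      have h2 := suspFlow_snd_hasMFDerivAt hΦ (0, p.2) t
      refine h2.congr_mfderiv ?_
      rw [zero_add]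
      exact congrArg (fun w : E × (E →L[ℝ] ℝ) ↦ (1 : ℝ →L[ℝ] ℝ).smulRight w)
        (hamField_cutoffHamiltonian (H := H) (χ := χ) (t := t)
          (mdifferentiableAt_of_contMDiffOn_time hW hH (smoothTransition_mem_Icc t) (hmem t ht).2)
          (mem_interior_iff_mem_nhds.1 (hmem t ht).1))
    exact (hG.reparametrize hp.2 _).eqOn hW hH h1
      (fun t _ ↦ hG.mem _ (smoothTransition_mem_Icc t) _ hp.2) (fun t ht ↦ (hmem t ht).2)
      (by simp only [hΦ.zero, Real.smoothTransition.zero, hG.init _ hp.2])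
      ⟨by linarith [hp.1.1], by linarith [hp.1.2]⟩
  · rw [hγ]

/-- The union of the orbits of a compact set is compact. -/
theorem IsHamiltonianFlowOn.isCompact_orbits (hG : IsHamiltonianFlowOn H W U G)
    (hW : IsOpen W) (hH : ContMDiffOn (suspModel E) 𝓘(ℝ, ℝ) ∞
      (fun x : ℝ × CotangentBundle E M ↦ H x.1 x.2) (Icc (0 : ℝ) 1 ×ˢ W)) (hU : IsCompact U) :
    IsCompact {y | ∃ t ∈ Icc (0 : ℝ) 1, ∃ z ∈ U, G t z = y} := by
  have h1 := (isCompact_Icc.prod hU).image_of_continuousOn (hG.continuousOn_reparametrized hW hH)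
  have heq : {y | ∃ t ∈ Icc (0 : ℝ) 1, ∃ z ∈ U, G t z = y} =
      (fun p : ℝ × CotangentBundle E M ↦ G (Real.smoothTransition p.1) p.2) '' (Icc 0 1 ×ˢ U) := by
    ext y
    constructor
    · rintro ⟨t, ht, z, hz, rfl⟩
      have h2 := intermediate_value_Icc (zero_le_one (α := ℝ))
        Real.smoothTransition.continuous.continuousOn
      rw [Real.smoothTransition.zero, Real.smoothTransition.one] at h2
      obtain ⟨s, hs, rfl⟩ := h2 ht
      exact ⟨(s, z), ⟨hs, hz⟩, rfl⟩
    · rintro ⟨⟨s, z⟩, ⟨-, hz⟩, rfl⟩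
      exact ⟨_, smoothTransition_mem_Icc s, z, hz, rfl⟩
  rw [heq]
  exact h1

/-- Extension of a Hamiltonian isotopy of a compact set to a compactly supported one. -/
theorem IsHamiltonianFlowOn.exists_extension (hG : IsHamiltonianFlowOn H W U G)
    (hW : IsOpen W) (hH : ContMDiffOn (suspModel E) 𝓘(ℝ, ℝ) ∞
      (fun x : ℝ × CotangentBundle E M ↦ H x.1 x.2) (Icc (0 : ℝ) 1 ×ˢ W)) (hU : IsCompact U)
    {V : Set (CotangentBundle E M)} (hV : IsOpen V)
    (hGV : ∀ t ∈ Icc (0 : ℝ) 1, ∀ z ∈ U, G t z ∈ V) :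
    ∃ φ : ℝ → ℝ → CotangentBundle E M → CotangentBundle E M,
      (∀ s t, IsExactMap (φ s t)) ∧ (∀ s z, φ s s z = z) ∧
      (∀ s t u z, φ t u (φ s t z) = φ s u z) ∧
      ContMDiff (𝓘(ℝ, ℝ).prod (suspModel E)) (cotangentModel E) ∞
        (fun p : ℝ × (ℝ × CotangentBundle E M) ↦ φ p.1 p.2.1 p.2.2) ∧
      (∀ s t, ∀ z ∈ V, φ s t z ∈ V) ∧
      ∀ t, ∀ z ∈ U, φ 0 t z = G (Real.smoothTransition t) z := by
  -- Cutting off inside `V` as well as `W` is what makes `V` invariant.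
  obtain ⟨χ, L, hχ, hL, hLO, hχL, hχ1⟩ := exists_cutoff (hG.isCompact_orbits hW hH hU)
    (hW.inter hV) (by
      rintro _ ⟨t, ht, z, hz, rfl⟩
      exact ⟨hG.mem t ht z hz, hGV t ht z hz⟩)
  have hK := smoothHamiltonian_cutoff hW hH hχ hL (hLO.trans inter_subset_left) hχL
  obtain ⟨Φ, hΦ, hΦL⟩ := exists_flow_cutoffHamiltonian hK hL hχL
  have hχ1' := eventually_nhdsSet_iff_forall.1 hχ1
  have hpair : ∀ r s z, Φ r (s, z) = (s + r, (Φ r (s, z)).2) := fun r s z ↦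
    Prod.ext (suspFlow_fst hΦ r (s, z)) rfl
  have hcocycle : ∀ s t u z, (Φ (u - t) (t, (Φ (t - s) (s, z)).2)).2 = (Φ (u - s) (s, z)).2 := by
    intro s t u z
    have h1 := hΦ.add hK.smoothField (u - t) (t - s) (s, z)
    rw [hpair (t - s) s z, sub_add_sub_cancel, add_sub_cancel] at h1
    rw [h1]
  have hself : ∀ s z, (Φ (s - s) (s, z)).2 = z := fun s z ↦ by rw [sub_self, hΦ.zero]
  refine ⟨fun s t z ↦ (Φ (t - s) (s, z)).2, fun s t ↦ isExactMap_suspFlow hK hΦ s (t - s), hself,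
    hcocycle, ?_, ?_, ?_⟩
  · refine (contMDiff_suspFlow_snd hK hΦ).comp (ContMDiff.prodMk ?_ ?_)
    · exact (contMDiff_fst.comp contMDiff_snd).sub contMDiff_fst
    · exact contMDiff_fst.prodMk (contMDiff_snd.comp contMDiff_snd)
  · intro s t z hz
    by_contra h
    -- Points outside `L` are fixed, so flowing back from an image outside `V` would return that
    -- image instead of `z ∈ V`.
    have h1 : (Φ (t - s) (s, z)).2 ∉ L := fun h' ↦ h (hLO h').2
    have h2 := hcocycle s t s z
    rw [hΦL _ _ _ h1, hself] at h2
    have h3 : (Φ (t - s) (s, z)).2 = z := h2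
    have h4 : (Φ (t - s) (s, z)).2 ∈ V := by rw [h3]; exact hz
    exact h h4
  · intro t z hz
    have h1 := isMIntegralCurve_Ioo_eq_of_contMDiff_boundaryless (t₀ := 0)
      hK.smoothField.contMDiff_one (hΦ.curve (0, z))
      (γ' := fun t ↦ (t, G (Real.smoothTransition t) z))
      (fun t ↦ (hG.reparametrize hz univ).isMIntegralCurveOn hW hH
        (fun t _ ↦ hG.mem _ (smoothTransition_mem_Icc t) z hz)
        (fun t _ ↦ hχ1' _ ⟨_, smoothTransition_mem_Icc t, z, hz, rfl⟩) (mem_univ t))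
      (by simp only [hΦ.zero, Real.smoothTransition.zero, hG.init z hz])
    have h2 := congrFun h1 t
    simp only [sub_zero]
    rw [h2]

end Isotopy

/-! ### Immersions depending on parameters. -/

section Parameters

theorem injective_fst_prod_iff {A B C : Type*} [NormedAddCommGroup A] [NormedSpace ℝ A]
    [NormedAddCommGroup B] [NormedSpace ℝ B] [NormedAddCommGroup C] [NormedSpace ℝ C]
    (L : A × B →L[ℝ] C) :
    Function.Injective ((ContinuousLinearMap.fst ℝ A B).prod L) ↔
      Function.Injective (L.comp (ContinuousLinearMap.inr ℝ A B)) := by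
  rw [injective_iff_map_eq_zero, injective_iff_map_eq_zero]
  constructor
  · intro h b hb
    exact congrArg Prod.snd (h (0, b) (Prod.ext rfl hb))
  · rintro h ⟨a, b⟩ hab
    have h1 : a = 0 := congrArg Prod.fst hab
    subst h1
    rw [h b (congrArg Prod.snd hab)]
    rfl

variable {FP : Type*} [NormedAddCommGroup FP] [NormedSpace ℝ FP]
  {HP : Type*} [TopologicalSpace HP] {IP : ModelWithCorners ℝ FP HP}
  {P : Type*} [TopologicalSpace P] [ChartedSpace HP P]
  {F : Type*} [NormedAddCommGroup F] [NormedSpace ℝ F]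
  {H : Type*} [TopologicalSpace H] {I : ModelWithCorners ℝ F H}
  {X : Type*} [TopologicalSpace X] [ChartedSpace H X]
  {F' : Type*} [NormedAddCommGroup F'] [NormedSpace ℝ F']
  {H' : Type*} [TopologicalSpace H'] {I' : ModelWithCorners ℝ F' H'}
  {Y : Type*} [TopologicalSpace Y] [ChartedSpace H' Y]

/-- Keeping the parameter in the target turns a family of immersions into a single immersion, so the
result on compact sets applies to the whole family. -/
theorem injective_mfderiv_param_iff {f : P × X → Y} {c : P} {x : X}
    (hf : MDifferentiableAt (IP.prod I) I' f (c, x)) :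
    Function.Injective (mfderiv (IP.prod I) (IP.prod I') (fun p : P × X ↦ (p.1, f p)) (c, x)) ↔
      Function.Injective (mfderiv I I' (fun x ↦ f (c, x)) x) := by
  have d1 := (hasMFDerivAt_fst (I := IP) (I' := I) (c, x)).prodMk hf.hasMFDerivAt
  have d2 : HasMFDerivAt I (IP.prod I) (fun x ↦ (c, x)) x (ContinuousLinearMap.inr ℝ FP F) :=
    (hasMFDerivAt_const c x).prodMk (hasMFDerivAt_id x)
  have d3 := HasMFDerivAt.comp x hf.hasMFDerivAt d2
  have e1 := d1.mfderiv
  have e2 : mfderiv I I' (fun x ↦ f (c, x)) x = _ := d3.mfderiv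
  rw [e1, e2]
  exact injective_fst_prod_iff (A := FP) (B := F) (C := F') (mfderiv (IP.prod I) I' f (c, x))

end Parameters

/-! ### Criteria for symplectic twist maps. -/

section TwistMapCriteria

variable {E : Type*} [NormedAddCommGroup E] [NormedSpace ℝ E] [FiniteDimensional ℝ E]
  {M : Type*} [TopologicalSpace M] [ChartedSpace E M] [IsManifold 𝓘(ℝ, E) ∞ M]
  [T2Space M]

/-- `(q, p) ↦ (q, Q)` is an injective immersion near every point of `K`. -/
def IsTwistOn (F : CotangentBundle E M → CotangentBundle E M) (K : Set (CotangentBundle E M)) :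
    Prop :=
  InjOn (twistMap F) K ∧ ∀ z ∈ K, Function.Injective (twistDeriv F z)

/-- The twist condition on a compact set is open in smooth families. -/
theorem exists_isTwistOn_of_family {f : ℝ → ℝ → CotangentBundle E M → CotangentBundle E M}
    (hf : ContMDiff (𝓘(ℝ, ℝ).prod (suspModel E)) (cotangentModel E) ∞
      (fun p : ℝ × (ℝ × CotangentBundle E M) ↦ f p.1 p.2.1 p.2.2))
    {K : Set (CotangentBundle E M)} (hK : IsCompact K)
    (hd : ∀ s ∈ Icc (0 : ℝ) 1, IsTwistOn (f s s) K) :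
    ∃ δ > 0, ∀ s ∈ Icc (0 : ℝ) 1, ∀ t, |t - s| < δ → IsTwistOn (f s t) K := by
  let Θ : (ℝ × ℝ) × CotangentBundle E M → M × M := fun p ↦ twistMap (f p.1.1 p.1.2) p.2
  have hΘ : ContMDiff ((𝓘(ℝ, ℝ).prod 𝓘(ℝ, ℝ)).prod (cotangentModel E)) (𝓘(ℝ, E).prod 𝓘(ℝ, E)) ∞
      Θ := by
    have h1 : ContMDiff ((𝓘(ℝ, ℝ).prod 𝓘(ℝ, ℝ)).prod (cotangentModel E)) (cotangentModel E) ∞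
        (fun p : (ℝ × ℝ) × CotangentBundle E M ↦ f p.1.1 p.1.2 p.2) :=
      hf.comp ((contMDiff_fst.comp contMDiff_fst).prodMk
        ((contMDiff_snd.comp contMDiff_fst).prodMk contMDiff_snd))
    exact (contMDiff_cotangent_proj.comp contMDiff_snd).prodMk (contMDiff_cotangent_proj.comp h1)
  let Ψ : (ℝ × ℝ) × CotangentBundle E M → (ℝ × ℝ) × (M × M) := fun p ↦ (p.1, Θ p)
  have hΨ : ContMDiff ((𝓘(ℝ, ℝ).prod 𝓘(ℝ, ℝ)).prod (cotangentModel E))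
      ((𝓘(ℝ, ℝ).prod 𝓘(ℝ, ℝ)).prod (𝓘(ℝ, E).prod 𝓘(ℝ, E))) ∞ Ψ := contMDiff_fst.prodMk hΘ
  have hder : ∀ (c : ℝ × ℝ) (z : CotangentBundle E M), Function.Injective
      (mfderiv ((𝓘(ℝ, ℝ).prod 𝓘(ℝ, ℝ)).prod (cotangentModel E))
      ((𝓘(ℝ, ℝ).prod 𝓘(ℝ, ℝ)).prod (𝓘(ℝ, E).prod 𝓘(ℝ, E))) Ψ (c, z)) ↔
      Function.Injective (twistDeriv (f c.1 c.2) z) := fun c z ↦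
    injective_mfderiv_param_iff (hΘ.mdifferentiable (by simp) (c, z))
  -- The hypothesis concerns the compact diagonal `s = t`. The good parameters contain a
  -- neighbourhood of it, whose uniform thickness is `δ`.
  let D : Set (ℝ × ℝ) := (fun s : ℝ ↦ (s, s)) '' Icc 0 1
  have hD : IsCompact D := isCompact_Icc.image (continuous_id.prodMk continuous_id)
  obtain ⟨t, ht, hinj, himm⟩ := exists_injOn_nhdsSet_of_injective_mfderiv
    (I := (𝓘(ℝ, ℝ).prod 𝓘(ℝ, ℝ)).prod (cotangentModel E))
    (I' := (𝓘(ℝ, ℝ).prod 𝓘(ℝ, ℝ)).prod (𝓘(ℝ, E).prod 𝓘(ℝ, E))) (f := Ψ)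
    (hD.prod hK) (fun p _ ↦ hΨ p) (by
      rintro ⟨_, z⟩ ⟨⟨s, hs, rfl⟩, hz⟩ ⟨c', z'⟩ ⟨-, hz'⟩ h
      have h1 : (s, s) = c' := congrArg Prod.fst h
      subst h1
      exact Prod.ext rfl ((hd s hs).1 hz hz' (congrArg Prod.snd h)))
    (by
      rintro ⟨_, z⟩ ⟨⟨s, hs, rfl⟩, hz⟩
      exact (hder (s, s) z).2 ((hd s hs).2 z hz))
  obtain ⟨u, v, hu, -, hDu, hKv, huv⟩ := generalized_tube_lemma hD hK isOpen_interior
    (subset_interior_iff_mem_nhdsSet.2 ht)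
  obtain ⟨δ, hδ, hδu⟩ := hD.exists_thickening_subset_open hu hDu
  refine ⟨δ, hδ, fun s hs r hr ↦ ?_⟩
  have h1 : (s, r) ∈ u := by
    refine hδu (Metric.mem_thickening_iff.2 ⟨(s, s), mem_image_of_mem _ hs, ?_⟩)
    rw [Prod.dist_eq, dist_self, Real.dist_eq]
    exact max_lt hδ hr
  have h2 : ∀ z ∈ K, ((s, r), z) ∈ t := fun z hz ↦ interior_subset (huv (mk_mem_prod h1 (hKv hz)))
  refine ⟨fun z hz z' hz' h ↦ ?_, fun z hz ↦ (hder (s, r) z).1 (himm _ (h2 z hz))⟩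
  exact congrArg Prod.snd (hinj (h2 z hz) (h2 z' hz') (Prod.ext rfl h))

/-- A continuous injection of the compact set `K` into a Hausdorff space is an embedding, and
embeddings restrict to `V`; injectivity on the open set `V` alone would not suffice. -/
theorem isSymplecticTwistMap_of_isTwistOn {V K : Set (CotangentBundle E M)} (hV : IsOpen V)
    (h0 : zeroSection E M ⊆ V) (hK : IsCompact K) (hVK : V ⊆ K)
    {F F' : CotangentBundle E M → CotangentBundle E M} (hF : IsExactMap F) (hF' : IsExactMap F')
    (hFF' : ∀ z, F (F' z) = z) (hF'F : ∀ z, F' (F z) = z) (hFV : ∀ z ∈ V, F z ∈ V)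
    (hF'V : ∀ z ∈ V, F' z ∈ V) (htw : IsTwistOn F K) : IsSymplecticTwistMap V F where
  isOpen := hV
  zeroSection_subset := h0
  bijOn := ⟨hFV, fun z _ z' _ h ↦ by rw [← hF'F z, h, hF'F],
    fun z hz ↦ ⟨F' z, hF'V z hz, hFF' z⟩⟩
  contMDiffOn := hF.1.contMDiffOn
  contMDiffOn_inverse := ⟨F', fun z _ ↦ hF'F z, hF'.1.contMDiffOn⟩
  exact := by
    obtain ⟨S, hS, hSF⟩ := hF.2
    exact ⟨S, hS.contMDiffOn, fun z _ ξ ↦ hSF z ξ⟩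
  twist_immersion := fun z hz ↦ htw.2 z (hVK hz)
  twist_embedding := by
    have : CompactSpace K := isCompact_iff_compactSpace.1 hK
    have h1 : IsEmbedding (K.domRestrict (twistMap F)) :=
      (Continuous.isClosedEmbedding ((contMDiff_twistMap hF.1).continuous.comp
        continuous_subtype_val) (injOn_iff_injective.1 htw.1)).isEmbedding
    exact h1.comp (IsEmbedding.inclusion hVK)

variable [CompactSpace M]

theorem twistMap_geodesicFlow_mul (g : Metric E M) (t s : ℝ) (z : CotangentBundle E M) :
    twistMap (geodesicFlow g (t * s)) z = twistMap (geodesicFlow g t) (fiberScale s z) := by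
  unfold twistMap
  rw [geodesicFlow_fiberScale]
  rfl

/-- By homogeneity the twist map of `h₀^s` is that of `h₀¹` precomposed with the linear isomorphism
`p ↦ s p` of the fibres. Negative `s` is allowed, which covers `h₀^{-ε}`. -/
theorem isTwistOn_geodesicFlow {g : Metric E M} {r : ℝ}
    (h : IsTwistOn (geodesicFlow g 1) {z | covectorNorm g z < r}) {s : ℝ} (hs : s ≠ 0)
    {C : ℝ} (hC : |s| * C < r) : IsTwistOn (geodesicFlow g s) {z | covectorNorm g z ≤ C} := by
  have hmem : ∀ z : CotangentBundle E M, covectorNorm g z ≤ C →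
      covectorNorm g (fiberScale s z) < r := fun z hz ↦ by
    rw [covectorNorm_fiberScale]
    exact (mul_le_mul_of_nonneg_left hz (abs_nonneg s)).trans_lt hC
  have heq : ∀ z : CotangentBundle E M, twistMap (geodesicFlow g s) z =
      twistMap (geodesicFlow g 1) (fiberScale s z) := fun z ↦ by
    rw [← twistMap_geodesicFlow_mul, one_mul]
  refine ⟨fun z hz z' hz' hzz' ↦ ?_, fun z hz ↦ ?_⟩
  · rw [heq, heq] at hzz'
    have h1 := congrArg (fiberScale s⁻¹) (h.1 (hmem z hz) (hmem z' hz') hzz')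
    rwa [fiberScale_fiberScale, fiberScale_fiberScale, inv_mul_cancel₀ hs, fiberScale_one,
      fiberScale_one] at h1
  · have d1 := ((contMDiff_twistMap (contMDiff_geodesicFlow_time g 1)).mdifferentiable (by simp)
      (fiberScale s z)).hasMFDerivAt
    have d2 := HasMFDerivAt.comp z d1 (mdifferentiableAt_fiberScale s z).hasMFDerivAt
    have heq' : twistMap (geodesicFlow g s) = twistMap (geodesicFlow g 1) ∘ fiberScale s :=
      funext heq
    rw [← heq'] at d2
    have h1 : ∀ ξ, twistDeriv (geodesicFlow g s) z ξ =
        twistDeriv (geodesicFlow g 1) (fiberScale s z) (cotangentMapDeriv (fiberScale s) z ξ) :=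
      fun ξ ↦ DFunLike.congr_fun d2.mfderiv ξ
    intro ξ ξ' hξ
    rw [h1, h1] at hξ
    have h2 := h.2 _ (hmem z hz) hξ
    rw [cotangentMapDeriv_fiberScale, cotangentMapDeriv_fiberScale] at h2
    refine Prod.ext (congrArg Prod.fst h2 :) ?_
    exact smul_right_injective _ hs (congrArg Prod.snd h2 :)

end TwistMapCriteria

/-! ### The decomposition into twist maps. -/

section Decomposition

variable {E : Type*} [NormedAddCommGroup E] [NormedSpace ℝ E] [FiniteDimensional ℝ E]
  {M : Type*} [TopologicalSpace M] [ChartedSpace E M] [IsManifold 𝓘(ℝ, E) ∞ M]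
  [T2Space M] [CompactSpace M]

theorem IsHamiltonianFlowOn.hasTwistDecomposition {g : Metric E M}
    {H : ℝ → CotangentBundle E M → ℝ} {W U : Set (CotangentBundle E M)}
    {G : ℝ → CotangentBundle E M → CotangentBundle E M} (hG : IsHamiltonianFlowOn H W U G)
    (hW : IsOpen W) (hH : ContMDiffOn (suspModel E) 𝓘(ℝ, ℝ) ∞
      (fun x : ℝ × CotangentBundle E M ↦ H x.1 x.2) (Icc (0 : ℝ) 1 ×ˢ W)) (hU : IsCompact U)
    {r ε C : ℝ} (hr : IsTwistOn (geodesicFlow g 1) {z | covectorNorm g z < r}) (hε : 0 < ε)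
    (hr0 : 0 < r) (hC : ε * C < r)
    (hGC : ∀ t ∈ Icc (0 : ℝ) 1, ∀ z ∈ U, covectorNorm g (G t z) ≤ C) :
    HasTwistDecomposition g ε U G := by
  -- The room between `C` and `C'` makes `V` an open set containing the orbits. Positivity of `C'`
  -- puts the zero section in `V`, and `ε C' < r` keeps `h₀^{±ε}` twist on the closure of the
  -- estimate, the compact set `K`.
  obtain ⟨C', hC', hC'r⟩ := exists_between (max_lt ((lt_div_iff₀' hε).2 hC) (div_pos hr0 hε))
  have hCC' : C < C' := (le_max_left _ _).trans_lt hC'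
  have hC'0 : 0 < C' := (le_max_right _ _).trans_lt hC'
  have hεC' : |ε| * C' < r := by rwa [abs_of_pos hε, ← lt_div_iff₀' hε]
  have hεC'' : |-ε| * C' < r := by rwa [abs_neg]
  let V : Set (CotangentBundle E M) := {z | covectorNorm g z < C'}
  let K : Set (CotangentBundle E M) := {z | covectorNorm g z ≤ C'}
  have hV : IsOpen V := isOpen_lt (continuous_covectorNorm g) continuous_const
  have hK : IsCompact K := isCompact_covectorNorm_le g C'
  have hVK : V ⊆ K := fun z (hz : covectorNorm g z < C') ↦ hz.le
  have h0V : zeroSection E M ⊆ V := fun z hz ↦ by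
    change covectorNorm g z < C'
    rwa [(covectorNorm_eq_zero_iff g z).2 hz]
  have hUV : U ⊆ V := fun z hz ↦ by
    have h := hGC 0 (by simp) z hz
    rw [hG.init z hz] at h
    exact h.trans_lt hCC'
  have hgV : ∀ t, ∀ z ∈ V, geodesicFlow g t z ∈ V := fun t z hz ↦ by
    change covectorNorm g _ < C'
    rwa [covectorNorm_geodesicFlow]
  obtain ⟨φ, hφe, hφ0, hφc, hφs, hφV, hφG⟩ := hG.exists_extension hW hH hU hV
    (fun t ht z hz ↦ (hGC t ht z hz).trans_lt hCC')
  -- For `s = t` the family reduces to `h₀^{-ε}`. The resulting `δ` bounds the length of the pieces,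
  -- uniformly in their starting time.
  obtain ⟨δ, hδ, htw⟩ := exists_isTwistOn_of_family
    (f := fun s t z ↦ geodesicFlow g (-ε) (φ s t z))
    ((contMDiff_geodesicFlow_time g (-ε)).comp hφs) hK (fun s _ ↦ by
      simp only [hφ0]
      exact isTwistOn_geodesicFlow hr (neg_ne_zero.2 hε.ne') hεC'')
  obtain ⟨n, hn⟩ := exists_nat_one_div_lt hδ
  let N := n + 1
  have hN : (0 : ℝ) < N := by positivity
  let τ : ℕ → ℝ := fun k ↦ k / N
  have hτs : ∀ k, |τ (k + 1) - τ k| < δ := fun k ↦ by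
    have h1 : τ (k + 1) - τ k = 1 / ((n : ℝ) + 1) := by
      simp only [τ, N]
      push_cast
      ring
    rwa [h1, abs_of_pos (by positivity)]
  have hτI : ∀ k ≤ N, τ k ∈ Icc (0 : ℝ) 1 := fun k hk ↦
    ⟨by positivity, (div_le_one hN).2 (by exact_mod_cast hk)⟩
  -- With `j = 2k + 1`, the quotient `j / 2` is `k`. The value at `0` is never used, since
  -- `iteratedComp` starts with `F 1`.
  let F : ℕ → CotangentBundle E M → CotangentBundle E M := fun j ↦
    if Even j then geodesicFlow g ε
    else fun z ↦ geodesicFlow g (-ε) (φ (τ (j / 2)) (τ (j / 2 + 1)) z)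
  have hFe : ∀ k, F (2 * k) = geodesicFlow g ε := fun k ↦ if_pos (even_two_mul k)
  have hFo : ∀ k, F (2 * k + 1) = fun z ↦ geodesicFlow g (-ε) (φ (τ k) (τ (k + 1)) z) := by
    intro k
    have h1 : (2 * k + 1) / 2 = k := by omega
    simp only [F]
    rw [if_neg (by simp), h1]
  have hcases : ∀ j ∈ Icc 1 (2 * N), (∃ k, j = 2 * k) ∨ ∃ k ≤ N, j = 2 * k + 1 := by
    rintro j ⟨hj1, hj2⟩
    rcases Nat.even_or_odd' j with ⟨k, h | h⟩
    · exact Or.inl ⟨k, h⟩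
    · exact Or.inr ⟨k, by omega, h⟩
  refine ⟨V, N, F, hUV, Nat.succ_pos n, ?_, fun k _ z _ ↦ by rw [hFe], ?_, ?_⟩
  · intro j hj
    rcases hcases j hj with ⟨k, rfl⟩ | ⟨k, hk, rfl⟩
    · rw [hFe]
      exact isSymplecticTwistMap_of_isTwistOn hV h0V hK hVK (isExactMap_geodesicFlow g ε)
        (isExactMap_geodesicFlow g (-ε)) (geodesicFlow_apply_neg g ε)
        (geodesicFlow_neg_apply g ε) (hgV ε) (hgV (-ε))
        (isTwistOn_geodesicFlow hr hε.ne' hεC')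
    · rw [hFo]
      exact isSymplecticTwistMap_of_isTwistOn hV h0V hK hVK
        (F' := fun z ↦ φ (τ (k + 1)) (τ k) (geodesicFlow g ε z))
        ((isExactMap_geodesicFlow g (-ε)).comp (hφe _ _))
        ((hφe _ _).comp (isExactMap_geodesicFlow g ε))
        (fun z ↦ by rw [hφc, hφ0, geodesicFlow_neg_apply])
        (fun z ↦ by rw [geodesicFlow_apply_neg, hφc, hφ0])
        (fun z hz ↦ hgV _ _ (hφV _ _ z hz)) (fun z hz ↦ hφV _ _ _ (hgV _ z hz))
        (htw _ (hτI k hk) _ (hτs k))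
  · intro z hz
    have hcomp : ∀ k, iteratedComp F (2 * k) z = φ 0 (τ k) z := by
      intro k
      induction k with
      | zero => simp [iteratedComp, τ, hφ0]
      | succ k ih =>
        change F (2 * (k + 1)) (F (2 * k + 1) (iteratedComp F (2 * k) z)) = _
        rw [ih, hFe, hFo, geodesicFlow_apply_neg, hφc]
    rw [hcomp, hφG _ z hz]
    have h1 : τ N = 1 := div_self hN.ne'
    rw [h1, Real.smoothTransition.one]
  · intro hGU hgU j hj
    rcases hcases j hj with ⟨k, rfl⟩ | ⟨k, hk, rfl⟩
    · rw [hFe, hgU]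
    · have hφU : ∀ t, φ 0 t '' U = U := fun t ↦ by
        rw [image_congr (hφG t)]
        exact hGU _ (smoothTransition_mem_Icc t)
      -- Only isotopies starting at time `0` are known to preserve `U`; writing `U` as the image of
      -- itself under `φ 0 (τ k)` and using the cocycle rule gives the other pieces.
      have h1 : φ (τ k) (τ (k + 1)) '' U = U := by
        conv_lhs => rw [← hφU (τ k)]
        rw [image_image]
        simp only [hφc]
        exact hφU _
      have h2 : geodesicFlow g (-ε) '' U = U := by
        conv_lhs => rw [← hgU]
        rw [image_image]
        simp only [geodesicFlow_neg_apply, image_id']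
      rw [hFo, ← image_image (geodesicFlow g (-ε)), h1, h2]

end Decomposition

end TwistMaps

end

theorem lemma3p4
    {E : Type*} [NormedAddCommGroup E] [NormedSpace ℝ E] [FiniteDimensional ℝ E]
    {M : Type*} [TopologicalSpace M] [ChartedSpace E M] [IsManifold 𝓘(ℝ, E) ∞ M]
    [T2Space M] [CompactSpace M]
    (g : TwistMaps.Metric E M)
    (U : Set (TwistMaps.CotangentBundle E M))
    (hUcompact : IsCompact U) (hUnhds : U ∈ 𝓝ˢ (TwistMaps.zeroSection E M))
    (W : Set (TwistMaps.CotangentBundle E M)) (hW : IsOpen W)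
    (H : ℝ → TwistMaps.CotangentBundle E M → ℝ)
    (hH : ContMDiffOn (𝓘(ℝ, ℝ).prod (TwistMaps.cotangentModel E)) 𝓘(ℝ, ℝ) ∞
      (fun x : ℝ × TwistMaps.CotangentBundle E M ↦ H x.1 x.2) (Icc (0 : ℝ) 1 ×ˢ W))
    (G : ℝ → TwistMaps.CotangentBundle E M → TwistMaps.CotangentBundle E M)
    (hG : TwistMaps.IsHamiltonianFlowOn H W U G)
    (hinv : MapsTo (G 1) U U) :
    (∀ C : ℝ, (∀ t ∈ Icc (0 : ℝ) 1, ∀ z ∈ U, TwistMaps.covectorNorm g (G t z) ≤ C) →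
      ENNReal.ofReal C < TwistMaps.injectivityRadius g →
        TwistMaps.HasTwistDecomposition g 1 U G) ∧
    (∃ ε₀ : ℝ, 0 < ε₀ ∧ ∀ ε : ℝ, 0 < ε → ε < ε₀ →
      TwistMaps.HasTwistDecomposition g ε U G) := by
  refine ⟨fun C hC hCR ↦ ?_, ?_⟩
  · obtain ⟨R, ⟨hinj, himm⟩, hCr⟩ := lt_sSup_iff.1 hCR
    -- The supremum need not be attained, so a finite `r` is taken strictly between `C` and an
    -- admissible radius `R`.
    obtain ⟨r, -, hCr, hrR⟩ := ENNReal.lt_iff_exists_real_btwn.1 hCr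
    obtain ⟨hCr, hr0⟩ := (ENNReal.ofReal_lt_ofReal_iff').1 hCr
    have hsub : ∀ z, TwistMaps.covectorNorm g z < r →
        ENNReal.ofReal (TwistMaps.covectorNorm g z) < R := fun z hz ↦
      (ENNReal.ofReal_le_ofReal hz.le).trans_lt hrR
    exact hG.hasTwistDecomposition hW hH hUcompact
      ⟨hinj.mono fun z hz ↦ hsub z hz, fun z hz ↦ himm z (hsub z hz)⟩ one_pos hr0
      (by rwa [one_mul]) hC
  · obtain ⟨r, hr, htw⟩ := TwistMaps.exists_injOn_twistMap_geodesicFlow g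
    obtain ⟨C, hC⟩ := ((hG.isCompact_orbits hW hH hUcompact).image
      (TwistMaps.continuous_covectorNorm g)).bddAbove
    -- This bound gives `ε (|C| + 1) < r`, hence `ε C < r` whatever the sign of `C`.
    refine ⟨r / (|C| + 1), by positivity, fun ε hε hεr ↦ ?_⟩
    refine hG.hasTwistDecomposition hW hH hUcompact htw hε hr (C := C) ?_
      fun t ht z hz ↦ hC (mem_image_of_mem _ ⟨t, ht, z, hz, rfl⟩)
    rw [lt_div_iff₀ (by positivity)] at hεr
    nlinarith [le_abs_self C]
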